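/- **Setting (Mangrove).** There are $n\ge 3f+2p+1$ validators, at most $f$ of them Byzantine; users may be honest or dishonest; links are authenticated and signatures of honest parties cannot be forged. Local computation and communication inside a validator take no time. Timers use a known bound $\Delta$; a *communication step* lasts $\delta$ with $0<\delta\le\Delta$: a message sent at time $s$ is delivered by $\max(s,\mathrm{GST})+\delta$, and before that the adversary controls delays. For each user actor $A$ and each reactive actor $X$, a validator $V$ runs an entity $V.A$, resp. $V.X$. *Transactions.* A UA transaction $(A,sn,\text{objects},\text{code})$ and a UA-RA transaction $(A,sn,X,\text{objects},\text{code},\text{call})$ are signed by the user of $A$; an RA-RA transaction is issued by a reactive actor to a reactive actor while executing a block. A transaction consumes owned objects; created objects are always new. A transaction of $A$ with number $sn$ is *ready* at $V.A$ when the one with number $sn-1$ (if $sn>0$) is executed there and $A$ owns the consumed objects there. An honest user issues transactions with consecutive numbers, not consuming an object twice, and issues a transaction only when some honest validator has executed its predecessor and each consumed object is owned by $A$ at some honest validator; it then broadcasts it. $V.A$ FP-locks at most one transaction per sequence number, and SP-locks at most one. *UA transactions (Parallel Optimistic Broadcast).* On receiving $tx$ from its user, $V.A$ broadcasts a vote for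 $tx$ if it can FP-lock it. With $n-p$ votes it decides $tx$. With $n-p-2f$ votes it SP-locks $tx$ if it can and proposes it to the Transaction Agreement of $(A,sn)$, whose outcome is also decided. A decided, correctly signed UA transaction is executed when it is ready. *Reactive actors (Parallel Optimistic Agreement, POA).* $V.X$ has a pool: UA-RA transactions to $X$ received from the user, correctly signed, FP-locked and ready at $V.A$, and RA-RA transactions to $X$ issued at $V$, none of them executed yet. Consecutive instances $k=0,1,\dots$ of the POA of $X$ are run, instance $k+1$ being started as soon as instance $k$ is decided. The leader of instance $k$ broadcasts its pool as a block when it starts the instance. If a validator, within $3\Delta$ of its own start, has the leader's block $B$ and all its RA-RA transactions are in its pool, it tries to FP-lock all UA-RA transactions of $B$; it votes for $B$ if all are correctly signed, FP-locked and, within $\Delta$, ready, and votes $\bot$ otherwise; its pool is sent along as a fallback block. With $n-p$ votes for $B$ it decides $B$. More than $3\Delta$ after its start and with $n-f$ votes, it enters the slow path: it proposes to Quorum Consensus a block with $n-p-2f$ votes if all its UA-RA transactions can be SP-locked, and otherwise the transactions contained in $n-2f$ fallback blocks, without the UA-RA ones that it cannot SP-lock. For each UA-RA transaction in the block decided by Quorum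 Consensus it tries to SP-lock it and proposes the SP-locked transaction to the Transaction Agreement of its sender and sequence number; the block without the losing transactions is decided. Decided blocks are executed deterministically. *Both.* Whoever decides broadcasts the decision with an unforgeable proof, and on a valid proof one decides. Quorum Consensus decides, in each instance, at most one block; at the time of the decision it contains every transaction that is in all proposals made by honest validators so far, and each of its transactions is in the proposals of at least $n-3f$ honest validators. Transaction Agreement decides at most one transaction, which was proposed by at least $n-3f$ honest validators. **Statement (fast execution).** Assume that at most $p$ (and at most $f$) validators are Byzantine. 1. *UA.* If an honest user issues a UA transaction at time $t\ge\mathrm{GST}$, then every honest validator has executed it by time $t+2\delta$. 2. *UA-RA.* Let an honest user issue a UA-RA transaction $tx$ with recipient $X$ at time $t\ge\mathrm{GST}$. Suppose that an honest validator $L$ starts, as soon as it has $tx$ in its pool for $X$, a POA instance of $X$ of which it is the leader; that every UA-RA transaction in the pool of $L$ for $X$ at that moment was issued by an honest user; and that no honest validator starts this instance before GST. Then every honest validator has executed $tx$ by time $t+3\delta$. 3. *RA-RA.* Let a reactive actor $X$ at an honest validator $L$ issue an RA-RA transaction $tx$ with recipient $Y$ at time $t\ge\mathrm{GST}$. Suppose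 that $L$ starts, as soon as it has $tx$ in its pool for $Y$, a POA instance of $Y$ of which it is the leader; that every UA-RA transaction in the pool of $L$ for $Y$ at that moment was issued by an honest user; and that no honest validator starts this instance before GST. Then every honest validator has executed $tx$ by time $t+2\delta$. -/

import Mathlib

namespace Mangrove

/-! ## Actors, objects, transactions -/

/-- The sets of names over which the system is described: validators, user actors,
reactive actors, owned objects, code blocks, function calls and digital signatures. -/
structure Names where
  Validator : Type
  User : Type
  Reactive : Type
  Obj : Type
  Code : Type
  Call : Type
  Sig : Type

/-- `⟨X, [O₁, …, Oₖ], Code_pre, Call, Code_post⟩`: the part common to all transactions that are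
sent to a reactive actor `X`. -/
structure CallBody (N : Names) where
  receiver : N.Reactive
  objs : Finset N.Obj
  codePre : N.Code
  call : N.Call
  codePost : N.Code

/-- The three kinds of transactions. User transactions carry a sequence number and a signature. -/
inductive Tx (N : Names) where
  | ua (A : N.User) (sn : ℕ) (objs : Finset N.Obj) (code : N.Code) (sig : N.Sig)
  | uara (A : N.User) (sn : ℕ) (body : CallBody N) (sig : N.Sig)
  | rara (X : N.Reactive) (body : CallBody N)

/-- A block (and a pool) is a finite set of transactions. -/
abbrev Block (N : Names) := Finset (Tx N)

namespace Tx

variable {N : Names}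

/-- Consumed objects. -/
def objs : Tx N → Finset N.Obj
  | ua _ _ os _ _ => os
  | uara _ _ b _ => b.objs
  | rara _ b => b.objs

/-- Sender and sequence number of a user transaction. -/
def key : Tx N → Option (N.User × ℕ)
  | ua A sn _ _ _ => some (A, sn)
  | uara A sn _ _ => some (A, sn)
  | rara _ _ => none

/-- The receiving reactive actor, if there is one. -/
def receiver : Tx N → Option N.Reactive
  | ua _ _ _ _ _ => none
  | uara _ _ b _ => some b.receiver
  | rara _ b => some b.receiver

def IsUARA (tx : Tx N) : Prop := ∃ A sn b s, tx = uara A sn b s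

def IsRARA (tx : Tx N) : Prop := ∃ X b, tx = rara X b

end Tx

/-- The effects of executing a transaction: objects created at user actors, objects created at
the executing reactive actor itself, outgoing reactive actor transactions (in order), and newly
spawned reactive actors. A UA transaction uses only the first and the last component. -/
structure Effects (N : Names) where
  userObjs : Finset (N.User × N.Obj)
  selfObjs : Finset N.Obj
  calls : List (CallBody N)
  actors : Finset N.Reactive

/-- The deterministic virtual machine. `pre`, `call` and `post` run `Code_pre`, `Call` and
`Code_post`; only `call` has access to the internal state of the reactive actor. A created object
is a new object: it remembers the transaction that created it. -/
structure VM (N : Names) where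
  Mem : Type
  Val : Type
  mem₀ : N.Reactive → Mem
  runUA : Tx N → Effects N
  pre : Tx N → Val
  call : N.Reactive → Mem → Tx N → Val → Mem × Val
  post : Tx N → Val → Effects N
  origin : N.Obj → Option (Tx N)
  origin_runUA : ∀ tx, ∀ q ∈ (runUA tx).userObjs, origin q.2 = some tx
  origin_post : ∀ tx v, ∀ q ∈ (post tx v).userObjs, origin q.2 = some tx

/-- `Code_pre`, then `Call`, then `Code_post`. -/
def VM.run {N : Names} (vm : VM N) (X : N.Reactive) (m : vm.Mem) (tx : Tx N) :
    vm.Mem × Effects N :=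
  let r := vm.call X m tx (vm.pre tx)
  (r.1, vm.post tx r.2)

/-- The parameters of a Mangrove deployment together with its failure and network model. -/
structure System (N : Names) where
  [validators : Fintype N.Validator]
  /-- bound on the number of Byzantine validators -/
  f : ℕ
  /-- bound on the number of Byzantine validators for the fast path -/
  p : ℕ
  size : 3 * f + 2 * p + 1 ≤ Fintype.card N.Validator
  byz : Finset N.Validator
  byz_card : byz.card ≤ f
  honestUser : Set N.User
  /-- signature verification; on user transactions only -/
  verify : Tx N → Prop
  /-- the known bound used by the timers -/
  Δ : ℝ
  /-- the duration of a communication step -/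
  δ : ℝ
  δ_pos : 0 < δ
  δ_le : δ ≤ Δ
  gst : ℝ
  leader : N.Reactive → ℕ → N.Validator
  /-- the deterministic order in which the transactions of a block are executed -/
  order : Block N → List (Tx N)
  mem_order : ∀ B tx, tx ∈ order B ↔ tx ∈ B
  nodup_order : ∀ B, (order B).Nodup
  vm : VM N
  genesisActors : Finset N.Reactive
  genesisUserObjs : Set (N.User × N.Obj)
  genesis_origin : ∀ q ∈ genesisUserObjs, vm.origin q.2 = none
  genesisActorObjs : N.Reactive → Set N.Obj

/-- The number `n` of validators. -/
def System.n {N : Names} (S : System N) : ℕ := @Fintype.card N.Validator S.validators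

/-! ## Local states of validators -/

/-- The state of the entity `V.A` of a validator `V` for a user actor `A`. -/
structure UserEntity (N : Names) where
  owned : Set N.Obj
  /-- the transaction executed with a given sequence number, if there is one -/
  done : ℕ → Option (Tx N)
  fpLocked : ℕ → Option (Tx N)
  spLocked : ℕ → Option (Tx N)
  /-- FP-locked UA-RA transactions received from the user, not yet sent to `V.X` -/
  awaiting : Set (Tx N)
  /-- UA-RA transactions executed by `V.X`, with the objects they created -/
  notices : Set (Tx N × Finset (N.User × N.Obj))
  pobDecided : ℕ → Option (Tx N)
  taProposed : ℕ → Option (Tx N)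
  taDecided : ℕ → Option (Tx N)

/-- Execution preconditions of a transaction of `A` at `V.A`: its predecessor is executed and the
consumed objects are owned. -/
def UserEntity.Ready {N : Names} (u : UserEntity N) (sn : ℕ) (objs : Finset N.Obj) : Prop :=
  (∀ m, sn = m + 1 → u.done m ≠ none) ∧ (objs : Set N.Obj) ⊆ u.owned

/-- Progress of `V.X` in the preparation of its proposal to Quorum Consensus. The second component
is the set of transactions for which an SP-lock was attempted. -/
inductive SlowPhase (N : Names) where
  | idle
  | candidate (B : Block N) (tried : Set (Tx N))
  | fallback (T : Block N) (tried : Set (Tx N))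
  | proposed

/-- The variables of `V.X` that belong to the current POA instance. -/
structure Attempt (N : Names) where
  /-- the leader's block being FP-locked, and the time at which this began -/
  fp : Option (Block N × ℝ)
  fpTried : Set (Tx N)
  fpReply : Tx N → Option Bool
  voted : Prop
  slow : SlowPhase N
  qcDecided : Option (Block N)
  /-- transactions of the block decided in Quorum Consensus that were handed over to
  Transaction Agreement -/
  taTried : Set (Tx N)

def Attempt.fresh (N : Names) : Attempt N where
  fp := none
  fpTried := ∅
  fpReply := fun _ => none
  voted := False
  slow := .idle
  qcDecided := none
  taTried := ∅

/-- The state of the entity `V.X` of a validator `V` for a reactive actor `X`. -/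
structure ActorEntity {N : Names} (S : System N) where
  created : Prop
  /-- the number of the current POA instance -/
  inst : ℕ
  /-- the time at which the current POA instance was initiated (the timer), if it was -/
  started : Option ℝ
  pool : Block N
  mem : S.vm.Mem
  owned : Set N.Obj
  executed : Set (Tx N)
  cur : Attempt N
  qcProposed : ℕ → Option (Block N)

/-- Messages on outer links. -/
inductive Msg (N : Names) where
  | tx (tx : Tx N)
  | pobVote (A : N.User) (sn : ℕ) (v : Option (Tx N))
  | pobProof (tx : Tx N)
  | proposal (X : N.Reactive) (k : ℕ) (B : Block N)
  | poaVote (X : N.Reactive) (k : ℕ) (v : Option (Block N)) (fb : Block N)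
  | poaProof (X : N.Reactive) (k : ℕ) (B : Block N)

/-- The transactions that are written in a message. -/
def Msg.txs {N : Names} : Msg N → Set (Tx N)
  | .tx t => {t}
  | .pobVote _ _ v => {t | v = some t}
  | .pobProof t => {t}
  | .proposal _ _ B => {t | t ∈ B}
  | .poaVote _ _ v fb => {t | t ∈ fb ∨ ∃ B, v = some B ∧ t ∈ B}
  | .poaProof _ _ B => {t | t ∈ B}

/-- Messages are sent by validators and by users, over authenticated links. -/
abbrev Source (N : Names) := N.Validator ⊕ N.User

structure Packet (N : Names) where
  src : Source N
  dst : N.Validator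
  msg : Msg N
  time : ℝ

structure Local {N : Names} (S : System N) where
  user : N.User → UserEntity N
  actor : N.Reactive → ActorEntity S
  inbox : Set (Source N × Msg N)

/-- A global state: the clock, the local states, the network, what honest users have issued, and
the outcomes of the Quorum Consensus and Transaction Agreement instances. -/
structure State {N : Names} (S : System N) where
  now : ℝ
  loc : N.Validator → Local S
  sent : Set (Packet N)
  nextSn : N.User → ℕ
  issued : Set (Tx N)
  qc : N.Reactive → ℕ → Option (Block N)
  ta : N.User → ℕ → Option (Tx N)

section Dynamics

open scoped Classical

variable {N : Names} {S : System N}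

/-- The initial state. -/
noncomputable def System.start (S : System N) : State S where
  now := 0
  loc := fun _ =>
    { user := fun A =>
        { owned := {o | (A, o) ∈ S.genesisUserObjs}
          done := fun _ => none
          fpLocked := fun _ => none
          spLocked := fun _ => none
          awaiting := ∅
          notices := ∅
          pobDecided := fun _ => none
          taProposed := fun _ => none
          taDecided := fun _ => none }
      actor := fun X =>
        { created := X ∈ S.genesisActors
          inst := 0
          started := none
          pool := ∅
          mem := S.vm.mem₀ X
          owned := S.genesisActorObjs X
          executed := ∅
          cur := Attempt.fresh N
          qcProposed := fun _ => none }
      inbox := ∅ }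
  sent := ∅
  nextSn := fun _ => 0
  issued := ∅
  qc := fun _ _ => none
  ta := fun _ _ => none

noncomputable def Local.setUser (l : Local S) (A : N.User) (u : UserEntity N) : Local S :=
  { l with user := Function.update l.user A u }

noncomputable def Local.setActor (l : Local S) (X : N.Reactive) (r : ActorEntity S) : Local S :=
  { l with actor := Function.update l.actor X r }

/-- Objects arrive at the user actors that own them. -/
def Local.credit (l : Local S) (c : Set (N.User × N.Obj)) : Local S :=
  { l with user := fun A => { l.user A with owned := (l.user A).owned ∪ {o | (A, o) ∈ c} } }

/-- New reactive actors come into existence. -/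
def Local.create (l : Local S) (Xs : Set N.Reactive) : Local S :=
  { l with actor := fun X =>
      { l.actor X with created := (l.actor X).created ∨ X ∈ Xs } }

noncomputable def State.setLocal (σ : State S) (V : N.Validator) (l : Local S) : State S :=
  { σ with loc := Function.update σ.loc V l }

/-- `src` sends `m` to all validators. -/
def State.broadcast (σ : State S) (src : Source N) (m : Msg N) : State S :=
  { σ with sent := σ.sent ∪ {q | q.src = src ∧ q.msg = m ∧ q.time = σ.now} }

/-! ## Execution of blocks on reactive actors -/

/-- Accumulator for the execution of a block. -/
structure Exec (S : System N) where
  mem : S.vm.Mem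
  owned : Set N.Obj
  executed : Set (Tx N)
  emitted : Block N
  notices : Set (Tx N × Finset (N.User × N.Obj))
  credits : Set (N.User × N.Obj)
  actors : Set N.Reactive

/-- One outgoing transaction: it is dropped if some consumed object is missing. -/
noncomputable def emitCall (X : N.Reactive) (q : Set N.Obj × Block N) (b : CallBody N) :
    Set N.Obj × Block N :=
  if (b.objs : Set N.Obj) ⊆ q.1 then (q.1 \ b.objs, insert (Tx.rara X b) q.2) else q

/-- Execution of one transaction at a reactive actor. The objects created for user actors are
delivered at once for RA-RA transactions, and through the sender for UA-RA transactions. -/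
noncomputable def execTx (X : N.Reactive) (a : Exec S) (tx : Tx N) : Exec S :=
  if tx ∈ a.executed then a else
    let r := S.vm.run X a.mem tx
    let e := r.2
    let out := e.calls.foldl (emitCall X) (a.owned ∪ e.selfObjs, a.emitted)
    { mem := r.1
      owned := out.1
      executed := insert tx a.executed
      emitted := out.2
      notices := if tx.IsUARA then insert (tx, e.userObjs) a.notices else a.notices
      credits := if tx.IsUARA then a.credits else a.credits ∪ e.userObjs
      actors := a.actors ∪ e.actors }

/-- Execution of a block by `V.X`. -/
noncomputable def execBlock (X : N.Reactive) (r : ActorEntity S) (B : Block N) : Exec S :=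
  (S.order B).foldl (execTx X)
    { mem := r.mem, owned := r.owned, executed := r.executed, emitted := ∅,
      notices := ∅, credits := ∅, actors := ∅ }

/-- Outgoing transactions reach the pools of their receivers, unless already executed there. -/
noncomputable def Local.addToPools (l : Local S) (E : Block N) : Local S :=
  { l with actor := fun Y =>
      { l.actor Y with
        pool := (l.actor Y).pool ∪
          E.filter (fun tx => tx.receiver = some Y ∧ tx ∉ (l.actor Y).executed) } }

/-- UA-RA transactions executed by reactive actors are reported to their senders. -/
def Local.addNotices (l : Local S) (c : Set (Tx N × Finset (N.User × N.Obj))) : Local S :=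
  { l with user := fun A =>
      { l.user A with
        notices := (l.user A).notices ∪ {q | q ∈ c ∧ ∃ sn, q.1.key = some (A, sn)} } }

/-- The local state after `V.X` decides `B` in its current POA instance: the block is executed and
the next instance is due to be initiated. -/
noncomputable def Local.applyBlock (l : Local S) (X : N.Reactive) (B : Block N) : Local S :=
  let r := l.actor X
  let e := execBlock X r B
  ((((l.setActor X
    { r with
      inst := r.inst + 1
      started := none
      pool := r.pool \ B
      mem := e.mem
      owned := e.owned
      executed := e.executed
      cur := Attempt.fresh N }).addToPools e.emitted).addNotices e.notices).credit e.credits).create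
      e.actors

/-! ## Votes and proofs -/

/-- Validators from which `V` received a POB vote for `tx`. -/
def Local.pobVoters (l : Local S) (A : N.User) (sn : ℕ) (tx : Tx N) : Set N.Validator :=
  {W | (Sum.inl W, Msg.pobVote A sn (some tx)) ∈ l.inbox}

/-- Validators from which `V` received a vote `v` in instance `k` of the POA of `X`. -/
def Local.poaVoters (l : Local S) (X : N.Reactive) (k : ℕ) (v : Option (Block N)) :
    Set N.Validator :=
  {W | ∃ fb, (Sum.inl W, Msg.poaVote X k v fb) ∈ l.inbox}

/-- Validators from which `V` received any vote in instance `k` of the POA of `X`. -/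
def Local.poaAllVoters (l : Local S) (X : N.Reactive) (k : ℕ) : Set N.Validator :=
  {W | ∃ v fb, (Sum.inl W, Msg.poaVote X k v fb) ∈ l.inbox}

/-- Validators from which `V` received a fallback block that contains `tx`. -/
def Local.fallbackVoters (l : Local S) (X : N.Reactive) (k : ℕ) (tx : Tx N) :
    Set N.Validator :=
  {W | ∃ v fb, (Sum.inl W, Msg.poaVote X k v fb) ∈ l.inbox ∧ tx ∈ fb}

/-- `B` is the result of the slow path of instance `k` of the POA of `X` when Quorum Consensus
decides `Bqc`: the UA-RA transactions that lose their Transaction Agreement are removed. -/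
def SlowResult (Bqc : Block N) (ta : N.User → ℕ → Option (Tx N)) (B : Block N) : Prop :=
  (∀ A sn b s, Tx.uara A sn b s ∈ Bqc → ta A sn ≠ none) ∧
  ∀ tx, tx ∈ B ↔ tx ∈ Bqc ∧ ∀ A sn b s, tx = Tx.uara A sn b s → ta A sn = some tx

/-- There are enough signatures for a valid proof that `B` is decided: `n - p` votes, or the
decisions of Quorum Consensus and of the Transaction Agreements. Signatures of honest validators
cannot be forged. -/
def State.PoaCert (σ : State S) (X : N.Reactive) (k : ℕ) (B : Block N) : Prop :=
  (∃ Q : Set N.Validator, S.n - S.p ≤ Q.ncard ∧ ∀ W ∈ Q, W ∉ S.byz →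
    ∃ fb, ∃ q ∈ σ.sent, q.src = Sum.inl W ∧ q.msg = Msg.poaVote X k (some B) fb) ∨
  ∃ Bqc, σ.qc X k = some Bqc ∧ SlowResult Bqc σ.ta B

/-- The same for the decision of `tx` in Parallel Optimistic Broadcast. -/
def State.PobCert (σ : State S) (tx : Tx N) : Prop :=
  ∃ A sn, tx.key = some (A, sn) ∧
    ((∃ Q : Set N.Validator, S.n - S.p ≤ Q.ncard ∧ ∀ W ∈ Q, W ∉ S.byz →
      ∃ q ∈ σ.sent, q.src = Sum.inl W ∧ q.msg = Msg.pobVote A sn (some tx)) ∨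
    σ.ta A sn = some tx)

/-! ## The protocol followed by honest validators -/

/-- The local actions of a validator. Each is taken as soon as its guard holds. -/
inductive Internal (N : Names) where
  | initiate (X : N.Reactive)
  | offer (A : N.User) (sn : ℕ) (b : CallBody N) (s : N.Sig)
  | fpBegin (X : N.Reactive) (B : Block N)
  | fpLock (X : N.Reactive) (A : N.User) (sn : ℕ) (b : CallBody N) (s : N.Sig)
  | fpReply (X : N.Reactive) (A : N.User) (sn : ℕ) (b : CallBody N) (s : N.Sig) (ok : Bool)
  | vote (X : N.Reactive)
  | slowCandidate (X : N.Reactive) (B : Block N)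
  | slowFallback (X : N.Reactive) (T : Block N)
  | spLock (X : N.Reactive) (A : N.User) (sn : ℕ) (b : CallBody N) (s : N.Sig)
  | qcPropose (X : N.Reactive)
  | taInitiate (X : N.Reactive) (A : N.User) (sn : ℕ) (b : CallBody N) (s : N.Sig)
  | poaDecide (X : N.Reactive) (B : Block N)
  | pobDecide (A : N.User) (sn : ℕ) (tx : Tx N)
  | pobSlow (A : N.User) (sn : ℕ) (os : Finset N.Obj) (c : N.Code) (s : N.Sig)
  | execUA (A : N.User) (sn : ℕ) (os : Finset N.Obj) (c : N.Code) (s : N.Sig)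
  | finishUARA (A : N.User) (sn : ℕ) (b : CallBody N) (s : N.Sig)
      (e : Finset (N.User × N.Obj))

/-- `V.A` replaces the entry of a lock table at `sn` by `tx` if it is empty. -/
noncomputable def lockIfFree (t : ℕ → Option (Tx N)) (sn : ℕ) (tx : Tx N) : ℕ → Option (Tx N) :=
  if t sn = none then Function.update t sn (some tx) else t

/-- All SP-locks on UA-RA transactions of `B` were attempted. -/
def AllTried (B : Block N) (tried : Set (Tx N)) : Prop :=
  ∀ tx ∈ B, tx.IsUARA → tx ∈ tried

/-- The UA-RA transaction `tx` is SP-locked by the entity of its sender. -/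
def Local.SPLocked (l : Local S) (tx : Tx N) : Prop :=
  ∃ A sn, tx.key = some (A, sn) ∧ (l.user A).spLocked sn = some tx

/-- The timer has expired and `n - f` votes have arrived. -/
def State.SlowDue (σ : State S) (V : N.Validator) (X : N.Reactive) : Prop :=
  (∃ t, ((σ.loc V).actor X).started = some t ∧ t + 3 * S.Δ < σ.now) ∧
  S.n - S.f ≤ ((σ.loc V).poaAllVoters X ((σ.loc V).actor X).inst).ncard

/-- `V.A` applies an executed transaction `tx` with sequence number `sn`: the consumed objects
disappear and the created ones are given to their owners. -/
noncomputable def Local.applyUser (l : Local S) (A : N.User) (sn : ℕ) (tx : Tx N)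
    (created : Set (N.User × N.Obj)) : Local S :=
  (l.setUser A
    { l.user A with
      owned := (l.user A).owned \ tx.objs
      done := Function.update (l.user A).done sn (some tx) }).credit created

/-- The local actions of validator `V`. -/
def InternalStep (V : N.Validator) (a : Internal N) (σ σ' : State S) : Prop :=
  let l := σ.loc V
  match a with
  -- start of the current POA instance; the leader broadcasts its pool
  | .initiate X =>
    let r := l.actor X
    r.created ∧ r.started = none ∧
    let σ₁ := σ.setLocal V (l.setActor X { r with started := some σ.now })
    σ' = if S.leader X r.inst = V then
        σ₁.broadcast (Sum.inl V) (.proposal X r.inst r.pool) else σ₁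
  -- `V.A` sends a UA-RA transaction to `V.X` once it is ready to be executed
  | .offer A sn b s =>
    let tx := Tx.uara A sn b s
    let u := l.user A
    let r := l.actor b.receiver
    tx ∈ u.awaiting ∧ u.Ready sn b.objs ∧
    σ' = σ.setLocal V ((l.setUser A { u with awaiting := u.awaiting \ {tx} }).setActor b.receiver
      { r with pool := if tx ∈ r.executed then r.pool else insert tx r.pool })
  -- `V.X` takes up the leader's block
  | .fpBegin X B =>
    let r := l.actor X
    (∃ t, r.started = some t ∧ σ.now ≤ t + 3 * S.Δ) ∧ r.cur.fp = none ∧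
    (Sum.inl (S.leader X r.inst), Msg.proposal X r.inst B) ∈ l.inbox ∧
    (∀ tx ∈ B, tx.receiver = some X) ∧
    (∀ tx ∈ B, tx.IsRARA → tx ∈ r.pool) ∧
    σ' = σ.setLocal V (l.setActor X { r with cur := { r.cur with fp := some (B, σ.now) } })
  -- `V.A` tries to FP-lock a UA-RA transaction of the block
  | .fpLock X A sn b s =>
    let tx := Tx.uara A sn b s
    let r := l.actor X
    let u := l.user A
    (∃ B v, r.cur.fp = some (B, v) ∧ tx ∈ B) ∧ tx ∉ r.cur.fpTried ∧
    σ' = σ.setLocal V ((l.setUser A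
        { u with fpLocked := if S.verify tx then lockIfFree u.fpLocked sn tx else u.fpLocked
          }).setActor X
      { r with cur := { r.cur with fpTried := insert tx r.cur.fpTried } })
  -- `V.A` answers: success if within time `Δ` the transaction is ready to be executed
  | .fpReply X A sn b s ok =>
    let tx := Tx.uara A sn b s
    let r := l.actor X
    let u := l.user A
    (∃ B v, r.cur.fp = some (B, v) ∧ tx ∈ B ∧
      (ok = true → S.verify tx ∧ u.fpLocked sn = some tx ∧ u.Ready sn b.objs ∧
        σ.now ≤ v + S.Δ) ∧
      (ok = false → ¬ S.verify tx ∨ u.fpLocked sn ≠ some tx ∨ v + S.Δ < σ.now)) ∧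
    tx ∈ r.cur.fpTried ∧ r.cur.fpReply tx = none ∧
    σ' = σ.setLocal V (l.setActor X
      { r with cur := { r.cur with fpReply := Function.update r.cur.fpReply tx (some ok) } })
  -- `V.X` votes, positively if all FP-locks succeeded, and adds its pool as a fallback block
  | .vote X =>
    let r := l.actor X
    ¬ r.cur.voted ∧ ∃ B v, r.cur.fp = some (B, v) ∧
    (∀ tx ∈ B, tx.IsUARA → r.cur.fpReply tx ≠ none) ∧
    σ' = (σ.setLocal V (l.setActor X { r with cur := { r.cur with voted := True } })).broadcast
      (Sum.inl V) (.poaVote X r.inst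
        (if ∀ tx ∈ B, tx.IsUARA → r.cur.fpReply tx = some true then some B else none) r.pool)
  -- slow path, with a block that may have been decided by another validator
  | .slowCandidate X B =>
    let r := l.actor X
    r.cur.slow = .idle ∧ σ.SlowDue V X ∧
    S.n - S.p - 2 * S.f ≤ (l.poaVoters X r.inst (some B)).ncard ∧
    σ' = σ.setLocal V (l.setActor X { r with cur := { r.cur with slow := .candidate B ∅ } })
  -- slow path, with the transactions of sufficiently many fallback blocks
  | .slowFallback X T =>
    let r := l.actor X
    ((r.cur.slow = .idle ∧ σ.SlowDue V X ∧
        ∀ B, (l.poaVoters X r.inst (some B)).ncard < S.n - S.p - 2 * S.f) ∨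
      ∃ B tried, r.cur.slow = .candidate B tried ∧ AllTried B tried ∧
        ∃ tx ∈ B, tx.IsUARA ∧ ¬ l.SPLocked tx) ∧
    (∀ tx, tx ∈ T ↔ S.n - 2 * S.f ≤ (l.fallbackVoters X r.inst tx).ncard) ∧
    σ' = σ.setLocal V (l.setActor X { r with cur := { r.cur with slow := .fallback T ∅ } })
  -- `V.A` tries to SP-lock a UA-RA transaction
  | .spLock X A sn b s =>
    let tx := Tx.uara A sn b s
    let r := l.actor X
    let u := l.user A
    ∃ B tried, tx ∈ B ∧ tx ∉ tried ∧
      ∃ next : SlowPhase N,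
        ((r.cur.slow = .candidate B tried ∧ next = .candidate B (insert tx tried)) ∨
          (r.cur.slow = .fallback B tried ∧ next = .fallback B (insert tx tried))) ∧
        σ' = σ.setLocal V ((l.setUser A
            { u with spLocked := lockIfFree u.spLocked sn tx }).setActor X
          { r with cur := { r.cur with slow := next } })
  -- `V.X` proposes to Quorum Consensus
  | .qcPropose X =>
    let r := l.actor X
    ∃ B tried P, AllTried B tried ∧
      ((r.cur.slow = .candidate B tried ∧ (∀ tx ∈ B, tx.IsUARA → l.SPLocked tx) ∧ P = B) ∨
        (r.cur.slow = .fallback B tried ∧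
          P = B.filter (fun tx => tx.IsRARA ∨ (tx.IsUARA ∧ l.SPLocked tx)))) ∧
      σ' = σ.setLocal V (l.setActor X
        { r with
          cur := { r.cur with slow := .proposed }
          qcProposed := Function.update r.qcProposed r.inst (some P) })
  -- `V.A` tries to SP-lock and then proposes its SP-locked transaction to Transaction Agreement
  | .taInitiate X A sn b s =>
    let tx := Tx.uara A sn b s
    let r := l.actor X
    let u := l.user A
    (∃ B, r.cur.qcDecided = some B ∧ tx ∈ B) ∧ tx ∉ r.cur.taTried ∧
    let sp := lockIfFree u.spLocked sn tx
    σ' = σ.setLocal V ((l.setUser A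
        { u with
          spLocked := sp
          taProposed := if u.taProposed sn = none then
            Function.update u.taProposed sn (sp sn) else u.taProposed }).setActor X
      { r with cur := { r.cur with taTried := insert tx r.cur.taTried } })
  -- `V.X` decides `B`: by votes, by a proof received, or by the slow path
  | .poaDecide X B =>
    let r := l.actor X
    r.started ≠ none ∧
    (S.n - S.p ≤ (l.poaVoters X r.inst (some B)).ncard ∨
      (∃ src, (src, Msg.poaProof X r.inst B) ∈ l.inbox) ∨
      ∃ Bqc, r.cur.qcDecided = some Bqc ∧ (∀ tx ∈ Bqc, tx.IsUARA → tx ∈ r.cur.taTried) ∧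
        SlowResult Bqc (fun A sn => (l.user A).taDecided sn) B) ∧
    σ' = (σ.setLocal V (l.applyBlock X B)).broadcast (Sum.inl V) (.poaProof X r.inst B)
  -- `V.A` decides in Parallel Optimistic Broadcast
  | .pobDecide A sn tx =>
    let u := l.user A
    u.pobDecided sn = none ∧ tx.key = some (A, sn) ∧
    (S.n - S.p ≤ (l.pobVoters A sn tx).ncard ∨
      (∃ src, (src, Msg.pobProof tx) ∈ l.inbox) ∨
      u.taDecided sn = some tx) ∧
    σ' = (σ.setLocal V (l.setUser A
      { u with pobDecided := Function.update u.pobDecided sn (some tx) })).broadcast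
      (Sum.inl V) (.pobProof tx)
  -- slow path of Parallel Optimistic Broadcast
  | .pobSlow A sn os c s =>
    let tx := Tx.ua A sn os c s
    let u := l.user A
    S.n - S.p - 2 * S.f ≤ (l.pobVoters A sn tx).ncard ∧
    (u.spLocked sn = none ∨ u.spLocked sn = some tx) ∧ u.taProposed sn = none ∧
    σ' = σ.setLocal V (l.setUser A
      { u with
        spLocked := Function.update u.spLocked sn (some tx)
        taProposed := Function.update u.taProposed sn (some tx) })
  -- execution of a decided UA transaction
  | .execUA A sn os c s =>
    let tx := Tx.ua A sn os c s
    let u := l.user A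
    u.pobDecided sn = some tx ∧ S.verify tx ∧ u.done sn = none ∧ u.Ready sn os ∧
    σ' = σ.setLocal V ((l.applyUser A sn tx (S.vm.runUA tx).userObjs).create
      (S.vm.runUA tx).actors)
  -- `V.A` takes notice of the execution of a UA-RA transaction by `V.X`
  | .finishUARA A sn b s e =>
    let tx := Tx.uara A sn b s
    let u := l.user A
    (tx, e) ∈ u.notices ∧ u.done sn = none ∧ u.Ready sn b.objs ∧
    σ' = σ.setLocal V (l.applyUser A sn tx e)

/-! ## Reception of messages, users, the adversary and the passage of time -/

/-- Reaction of `V` to the reception of a message. Only user transactions call for an immediate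
reaction; all other messages are just stored. -/
noncomputable def State.react (σ : State S) (V : N.Validator) (src : Source N) (m : Msg N) :
    State S :=
  let l := σ.loc V
  match src, m with
  | .inr A', .tx (.ua A sn os c s) =>
    let tx := Tx.ua A sn os c s
    let u := l.user A
    if A' ≠ A then σ
    else if u.fpLocked sn = none ∨ u.fpLocked sn = some tx then
      (σ.setLocal V (l.setUser A
        { u with fpLocked := Function.update u.fpLocked sn (some tx) })).broadcast
        (Sum.inl V) (.pobVote A sn (some tx))
    else σ.broadcast (Sum.inl V) (.pobVote A sn none)
  | .inr A', .tx (.uara A sn b s) =>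
    let tx := Tx.uara A sn b s
    let u := l.user A
    if A' = A ∧ S.verify tx ∧ (u.fpLocked sn = none ∨ u.fpLocked sn = some tx) then
      σ.setLocal V (l.setUser A
        { u with
          fpLocked := Function.update u.fpLocked sn (some tx)
          awaiting := insert tx u.awaiting })
    else σ
  | _, _ => σ

/-- The actions of the whole system. -/
inductive Action (N : Names) where
  | internal (V : N.Validator) (a : Internal N)
  | deliver (V : N.Validator) (src : Source N) (m : Msg N)
  | issue (A : N.User) (tx : Tx N)
  | adversary (src : Source N) (V : N.Validator) (m : Msg N)
  | qcOutcome (X : N.Reactive) (k : ℕ) (B : Block N)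
  | qcDecide (V : N.Validator) (X : N.Reactive)
  | taOutcome (A : N.User) (sn : ℕ) (tx : Tx N)
  | taDecide (V : N.Validator) (A : N.User) (sn : ℕ)
  | tick (t : ℝ)

/-- Quorum Validity of Quorum Consensus at the moment of the decision, with respect to the
proposals that honest validators have made: (I) what they all propose is decided; (II) what is
decided is proposed by at least `n - 3f` of them. -/
def State.QuorumValid (σ : State S) (X : N.Reactive) (k : ℕ) (B : Block N) : Prop :=
  (∀ tx, (∀ V, V ∉ S.byz → ∀ P, ((σ.loc V).actor X).qcProposed k = some P → tx ∈ P) → tx ∈ B) ∧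
  ∀ tx ∈ B, S.n - 3 * S.f ≤
    {V | V ∉ S.byz ∧ ∃ P, ((σ.loc V).actor X).qcProposed k = some P ∧ tx ∈ P}.ncard

/-- The transition relation of the system. -/
def Step (a : Action N) (σ σ' : State S) : Prop :=
  match a with
  -- honest validators follow the protocol
  | .internal V a => V ∉ S.byz ∧ InternalStep V a σ σ'
  -- perfect links
  | .deliver V src m =>
    V ∉ S.byz ∧ (∃ t, (⟨src, V, m, t⟩ : Packet N) ∈ σ.sent) ∧ (src, m) ∉ (σ.loc V).inbox ∧
    σ' = (σ.setLocal V { σ.loc V with inbox := insert (src, m) (σ.loc V).inbox }).react V src m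
  -- an honest user signs and broadcasts its next transaction, having learned from the validators
  -- that its previous one is executed and that it owns the objects to be consumed; so some honest
  -- validator is in a corresponding state
  | .issue A tx =>
    A ∈ S.honestUser ∧ tx.key = some (A, σ.nextSn A) ∧ S.verify tx ∧
    (∀ m, σ.nextSn A = m + 1 → ∃ V, V ∉ S.byz ∧ ((σ.loc V).user A).done m ≠ none) ∧
    (∀ o ∈ tx.objs, (∃ V, V ∉ S.byz ∧ o ∈ ((σ.loc V).user A).owned) ∧
      ∀ tx' ∈ σ.issued, (∃ sn, tx'.key = some (A, sn)) → o ∉ tx'.objs) ∧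
    σ' = State.broadcast
      { σ with
        nextSn := Function.update σ.nextSn A (σ.nextSn A + 1)
        issued := insert tx σ.issued } (Sum.inr A) (.tx tx)
  -- Byzantine validators and dishonest users send arbitrary messages, but cannot forge the
  -- signatures of honest users and validators
  | .adversary src V m =>
    (match src with
      | .inl W => W ∈ S.byz
      | .inr A => A ∉ S.honestUser) ∧
    (∀ tx ∈ m.txs, ∀ A sn, tx.key = some (A, sn) → A ∈ S.honestUser → S.verify tx →
      tx ∈ σ.issued) ∧
    (∀ tx, m = .pobProof tx → σ.PobCert tx) ∧
    (∀ X k B, m = .poaProof X k B → σ.PoaCert X k B) ∧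
    σ' = { σ with sent := insert ⟨src, V, m, σ.now⟩ σ.sent }
  -- Quorum Consensus reaches a decision, and honest validators learn it (at any later time)
  | .qcOutcome X k B =>
    σ.qc X k = none ∧ σ.QuorumValid X k B ∧
    σ' = { σ with qc := Function.update σ.qc X (Function.update (σ.qc X) k (some B)) }
  | .qcDecide V X =>
    let r := (σ.loc V).actor X
    V ∉ S.byz ∧ r.started ≠ none ∧ r.cur.qcDecided = none ∧ σ.qc X r.inst ≠ none ∧
    σ' = σ.setLocal V ((σ.loc V).setActor X
      { r with cur := { r.cur with qcDecided := σ.qc X r.inst } })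
  -- the same for Transaction Agreement
  | .taOutcome A sn tx =>
    σ.ta A sn = none ∧
    S.n - 3 * S.f ≤
      {V | V ∉ S.byz ∧ ((σ.loc V).user A).taProposed sn = some tx}.ncard ∧
    σ' = { σ with ta := Function.update σ.ta A (Function.update (σ.ta A) sn (some tx)) }
  | .taDecide V A sn =>
    let u := (σ.loc V).user A
    V ∉ S.byz ∧ u.taDecided sn = none ∧ σ.ta A sn ≠ none ∧
    σ' = σ.setLocal V ((σ.loc V).setUser A
      { u with taDecided := Function.update u.taDecided sn (σ.ta A sn) })
  -- Time passes only when no honest validator has a local action to take (local computation takes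
  -- no time), and a message sent at time `s` to an honest validator is delivered by
  -- `max s gst + δ`.
  | .tick t =>
    σ.now < t ∧
    (∀ V, V ∉ S.byz → ∀ a σ'', ¬ InternalStep V a σ σ'') ∧
    (∀ q ∈ σ.sent, q.dst ∉ S.byz → (q.src, q.msg) ∉ (σ.loc q.dst).inbox →
      t ≤ max q.time S.gst + S.δ) ∧
    σ' = { σ with now := t }

end Dynamics

/-- A run of the system: an infinite sequence of steps from the initial state in which time
grows without bound. -/
structure Run {N : Names} (S : System N) where
  st : ℕ → State S
  act : ℕ → Action N
  st_zero : st 0 = S.start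
  step : ∀ i, Step (act i) (st i) (st (i + 1))
  unbounded : ∀ T : ℝ, ∃ i, T ≤ (st i).now

/-! ## Events of a run -/

section Events

variable {N : Names} {S : System N}

/-- Validator `V` has executed `tx`: a UA transaction on the entity of its sender, any other
transaction on the entity of its receiver. -/
def State.Executed (σ : State S) (V : N.Validator) : Tx N → Prop
  | .ua A sn os c s => ((σ.loc V).user A).done sn = some (.ua A sn os c s)
  | .uara A sn b s => Tx.uara A sn b s ∈ ((σ.loc V).actor b.receiver).executed
  | .rara X b => Tx.rara X b ∈ ((σ.loc V).actor b.receiver).executed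

/-- Every honest validator has executed `tx` by time `T`. -/
def Run.ExecutedBy (ρ : Run S) (tx : Tx N) (T : ℝ) : Prop :=
  ∀ V, V ∉ S.byz → ∃ i, (ρ.st i).now ≤ T ∧ (ρ.st i).Executed V tx

/-- At step `i` user `A` issues `tx`. -/
def Run.Issues (ρ : Run S) (i : ℕ) (A : N.User) (tx : Tx N) : Prop :=
  ρ.act i = .issue A tx

/-- At step `i` the entity of the reactive actor `X` at `V` issues the transaction `tx`, as an
effect of executing a block. -/
def Run.Emits (ρ : Run S) (i : ℕ) (V : N.Validator) (X : N.Reactive) (tx : Tx N) : Prop :=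
  ∃ B, ρ.act i = .internal V (.poaDecide X B) ∧
    tx ∈ (execBlock X (((ρ.st i).loc V).actor X) B).emitted

/-- At step `j` validator `V` starts instance `k` of the POA of `X`. -/
def Run.Starts (ρ : Run S) (j : ℕ) (V : N.Validator) (X : N.Reactive) (k : ℕ) : Prop :=
  ρ.act j = .internal V (.initiate X) ∧ (((ρ.st j).loc V).actor X).inst = k

/-- At step `j`, as soon as it has `tx` in its pool for `X`, the honest validator `L` starts
instance `k` of the POA of `X`, of which it is the leader. -/
def Run.PromptLeader (ρ : Run S) (j : ℕ) (L : N.Validator) (X : N.Reactive) (k : ℕ)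
    (tx : Tx N) : Prop :=
  L ∉ S.byz ∧ S.leader X k = L ∧ ρ.Starts j L X k ∧
  tx ∈ (((ρ.st j).loc L).actor X).pool ∧
  ∀ i ≤ j, tx ∈ (((ρ.st i).loc L).actor X).pool → (ρ.st i).now = (ρ.st j).now

/-- Good pool: all UA-RA transactions in the pool of `L.X` at step `j` are by honest users. -/
def Run.GoodPool (ρ : Run S) (j : ℕ) (L : N.Validator) (X : N.Reactive) : Prop :=
  ∀ A sn b s, Tx.uara A sn b s ∈ (((ρ.st j).loc L).actor X).pool → A ∈ S.honestUser

/-- Instance `k` of the POA of `X` runs after GST: no honest validator starts it before. -/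
def Run.AfterGST (ρ : Run S) (X : N.Reactive) (k : ℕ) : Prop :=
  ∀ i V, V ∉ S.byz → ρ.Starts i V X k → S.gst ≤ (ρ.st i).now

end Events

end Mangrove

/-! Safety rests on quorum intersection. Since `n ≥ 3f + 2p + 1`, a set of `n - p` validators and a
set of `n - p - 2f` validators have more than `f` common members, hence a common honest one, and an
honest validator FP-locks at most one transaction per sender and sequence number. A transaction that
is SP-locked, proposed to Transaction Agreement or decided there is always FP-locked by the honest
members of a set of `n - p - 2f` validators (`Run.spLocked`, `Run.ta_sound`). So a fast quorum and
Transaction Agreement never confirm different transactions (`Run.confirmed_unique`). The same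
counting is applied to votes for blocks: if `n - p` validators vote for a block, then every honest
proposal to Quorum Consensus is that block, and no transaction of it loses its Transaction
Agreement. Hence a POA instance has at most one certified block (`Run.poaCert_unique`).

Consequently the executed state is the same everywhere up to progress. The state of a reactive actor
depends only on the number of decided instances (`Run.actor_spec`). The objects owned by a user
actor are those credited so far minus those consumed so far, irrespective of the order of execution,
because created objects are new (`Run.owned_iff`). For honest users, unforgeability gives that only
issued transactions can be locked or confirmed (`Run.signatures`), and issued transactions compete
neither for sequence numbers nor for objects.

For the timing, consider the last state before the clock exceeds a time `T`. The next step is a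
tick, so no honest validator has an enabled action, and everything sent by `T - δ` after GST has
arrived (`Run.exists_settled`). In such a state, whatever was executed anywhere by time `T - δ` is
executed at every honest validator: a missing execution would be an enabled action, because proofs
are broadcast with each decision (`Run.reached`).

The bounds follow by counting communication steps. For a UA transaction one step brings the
transaction to all honest validators, which vote, and a second step brings `n - p` votes, as at most
`p` validators are Byzantine. For a POA instance with an honest leader, one step brings the leader's
pool to all honest validators, together with everything needed to find its transactions ready, and
they vote for it unless they have already left the instance; the second step brings the votes or a
proof. The slow path cannot interfere: no honest validator starts more than `δ` before the leader
(`Run.Leads.le_start`), so no timer of length `3Δ` has expired within `2δ` of the leader's start.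
This is `Run.Leads.executed`. A UA-RA transaction needs one more step to reach the pool of the
leader, whereas an RA-RA transaction is put there at once. -/

namespace Mangrove

open scoped Classical

variable {N : Names} {S : System N}

/-! ### Components of updated states. -/

section Projections

variable (σ : State S) (l : Local S) (V W : N.Validator) (A A' : N.User) (X Y : N.Reactive)

theorem State.setLocal_loc : (σ.setLocal V l).loc W = if W = V then l else σ.loc W := by
  simp [State.setLocal, Function.update_apply]

@[simp] theorem State.broadcast_loc (s m) : (σ.broadcast s m).loc = σ.loc := rfl
theorem State.mem_broadcast (s m) (q : Packet N) : q ∈ (σ.broadcast s m).sent ↔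
    q ∈ σ.sent ∨ q.src = s ∧ q.msg = m ∧ q.time = σ.now := Iff.rfl

@[simp] theorem Local.setUser_actor (u) : (l.setUser A u).actor = l.actor := rfl
@[simp] theorem Local.setUser_inbox (u) : (l.setUser A u).inbox = l.inbox := rfl
theorem Local.setUser_user (u) :
    (l.setUser A u).user A' = if A' = A then u else l.user A' := by
  simp [Local.setUser, Function.update_apply]
@[simp] theorem Local.setActor_user (u) : (l.setActor X u).user = l.user := rfl
@[simp] theorem Local.setActor_inbox (u) : (l.setActor X u).inbox = l.inbox := rfl
theorem Local.setActor_actor (r) :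
    (l.setActor X r).actor Y = if Y = X then r else l.actor Y := by
  simp [Local.setActor, Function.update_apply]

@[simp] theorem Local.credit_actor (c) : (l.credit c).actor = l.actor := rfl
theorem Local.credit_user (c) : (l.credit c).user A =
    { l.user A with owned := (l.user A).owned ∪ {o | (A, o) ∈ c} } := rfl
@[simp] theorem Local.create_user (c) : (l.create c).user = l.user := rfl
@[simp] theorem Local.create_inbox (c) : (l.create c).inbox = l.inbox := rfl
theorem Local.create_actor (c) : (l.create c).actor X =
    { l.actor X with created := (l.actor X).created ∨ X ∈ c } := rfl
@[simp] theorem Local.applyUser_actor (sn tx c) : (l.applyUser A sn tx c).actor = l.actor := rfl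
@[simp] theorem Local.applyUser_inbox (sn tx c) : (l.applyUser A sn tx c).inbox = l.inbox := rfl
theorem Local.applyUser_user (sn tx c) : (l.applyUser A sn tx c).user A' =
    { l.user A' with
      owned := (if A' = A then (l.user A).owned \ tx.objs else (l.user A').owned) ∪
        {o | (A', o) ∈ c}
      done := if A' = A then Function.update (l.user A).done sn (some tx)
        else (l.user A').done } := by
  unfold Local.applyUser
  rw [Local.credit_user, Local.setUser_user]
  split_ifs with h
  · subst h; rfl
  · rfl

@[simp] theorem Local.applyBlock_inbox (B) : (l.applyBlock X B).inbox = l.inbox := rfl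
theorem Local.applyBlock_user (B) : (l.applyBlock X B).user A =
    { l.user A with
      notices := (l.user A).notices ∪
        {q | q ∈ (execBlock X (l.actor X) B).notices ∧ ∃ sn, q.1.key = some (A, sn)}
      owned := (l.user A).owned ∪ {o | (A, o) ∈ (execBlock X (l.actor X) B).credits} } := rfl
theorem Local.applyBlock_actor_self (B) : (l.applyBlock X B).actor X =
    { created := (l.actor X).created ∨ X ∈ (execBlock X (l.actor X) B).actors
      inst := (l.actor X).inst + 1
      started := none
      pool := ((l.actor X).pool \ B) ∪ (execBlock X (l.actor X) B).emitted.filter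
        (fun tx => tx.receiver = some X ∧ tx ∉ (execBlock X (l.actor X) B).executed)
      mem := (execBlock X (l.actor X) B).mem
      owned := (execBlock X (l.actor X) B).owned
      executed := (execBlock X (l.actor X) B).executed
      cur := Attempt.fresh N
      qcProposed := (l.actor X).qcProposed } := by
  simp [Local.applyBlock, Local.create_actor, Local.addNotices, Local.addToPools,
    Local.setActor_actor]
theorem Local.applyBlock_actor_of_ne (B) (h : Y ≠ X) : (l.applyBlock X B).actor Y =
    { l.actor Y with
      created := (l.actor Y).created ∨ Y ∈ (execBlock X (l.actor X) B).actors
      pool := (l.actor Y).pool ∪ (execBlock X (l.actor X) B).emitted.filter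
        (fun tx => tx.receiver = some Y ∧ tx ∉ (l.actor Y).executed) } := by
  simp [Local.applyBlock, Local.create_actor, Local.addNotices, Local.addToPools,
    Local.setActor_actor, h]
end Projections

/-! ### The effect of a single step, component by component. -/

/-- The local actions that always act on the entities `V.A`. -/
def Internal.AffectsUser (A : N.User) : Internal N → Prop
  | .pobDecide A' _ _ => A = A'
  | .fpLock _ A' _ _ _ => A = A'
  | .spLock _ A' _ _ _ => A = A'
  | .poaDecide _ _ => True
  | .execUA _ _ _ _ _ => True
  | .finishUARA _ _ _ _ _ => True
  | _ => False

/-- The local actions that always act on the entities `V.X`. -/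
def Internal.AffectsActor (X : N.Reactive) : Internal N → Prop
  | .initiate Y => X = Y
  | .offer _ _ b _ => X = b.receiver
  | .vote Y => X = Y
  | .poaDecide _ _ => True
  | .execUA _ _ _ _ _ => True
  | _ => False

/-- The possible effects of a step on the entity `V.A`. -/
inductive UserStep (σ : State S) (V : N.Validator) (A : N.User) :
    Action N → UserEntity N → Prop
  -- The side condition makes case analysis useful for a known action: if that action always
  -- rewrites the entity, this rule is ruled out.
  | refl (a) (h : ∀ b, a = .internal V b → ¬ b.AffectsUser A) :
      UserStep σ V A a ((σ.loc V).user A)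
  | offer (sn b s) (hV : V ∉ S.byz) (haw : Tx.uara A sn b s ∈ ((σ.loc V).user A).awaiting)
      (hr : ((σ.loc V).user A).Ready sn b.objs) :
      UserStep σ V A (.internal V (.offer A sn b s))
        { (σ.loc V).user A with awaiting := ((σ.loc V).user A).awaiting \ {Tx.uara A sn b s} }
  | fpLock (X sn b s B v) (hV : V ∉ S.byz)
      (hB : ((σ.loc V).actor X).cur.fp = some (B, v)) (htx : Tx.uara A sn b s ∈ B) :
      UserStep σ V A (.internal V (.fpLock X A sn b s))
        { (σ.loc V).user A with
          fpLocked := if S.verify (Tx.uara A sn b s) then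
            lockIfFree ((σ.loc V).user A).fpLocked sn (Tx.uara A sn b s)
            else ((σ.loc V).user A).fpLocked }
  | spLock (X sn b s B tried) (hV : V ∉ S.byz) (htx : Tx.uara A sn b s ∈ B)
      (hs : ((σ.loc V).actor X).cur.slow = .candidate B tried ∨
        ((σ.loc V).actor X).cur.slow = .fallback B tried) :
      UserStep σ V A (.internal V (.spLock X A sn b s))
        { (σ.loc V).user A with
          spLocked := lockIfFree ((σ.loc V).user A).spLocked sn (Tx.uara A sn b s) }
  | taInitiate (X sn b s B) (hV : V ∉ S.byz)
      (hB : ((σ.loc V).actor X).cur.qcDecided = some B) (htx : Tx.uara A sn b s ∈ B) :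
      UserStep σ V A (.internal V (.taInitiate X A sn b s))
        { (σ.loc V).user A with
          spLocked := lockIfFree ((σ.loc V).user A).spLocked sn (Tx.uara A sn b s)
          taProposed := if ((σ.loc V).user A).taProposed sn = none then
            Function.update ((σ.loc V).user A).taProposed sn
              (lockIfFree ((σ.loc V).user A).spLocked sn (Tx.uara A sn b s) sn)
            else ((σ.loc V).user A).taProposed }
  | poaDecide (X B) (hV : V ∉ S.byz) :
      UserStep σ V A (.internal V (.poaDecide X B))
        { (σ.loc V).user A with
          notices := ((σ.loc V).user A).notices ∪
            {q | q ∈ (execBlock X ((σ.loc V).actor X) B).notices ∧ ∃ sn, q.1.key = some (A, sn)}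
          owned := ((σ.loc V).user A).owned ∪
            {o | (A, o) ∈ (execBlock X ((σ.loc V).actor X) B).credits} }
  | pobDecide (sn tx) (hV : V ∉ S.byz) (hn : ((σ.loc V).user A).pobDecided sn = none)
      (hk : tx.key = some (A, sn))
      (hd : S.n - S.p ≤ ((σ.loc V).pobVoters A sn tx).ncard ∨
        (∃ src, (src, Msg.pobProof tx) ∈ (σ.loc V).inbox) ∨
        ((σ.loc V).user A).taDecided sn = some tx) :
      UserStep σ V A (.internal V (.pobDecide A sn tx))
        { (σ.loc V).user A with
          pobDecided := Function.update ((σ.loc V).user A).pobDecided sn (some tx) }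
  | pobSlow (sn os c s) (hV : V ∉ S.byz)
      (hq : S.n - S.p - 2 * S.f ≤ ((σ.loc V).pobVoters A sn (.ua A sn os c s)).ncard)
      (hs : ((σ.loc V).user A).spLocked sn = none ∨
        ((σ.loc V).user A).spLocked sn = some (.ua A sn os c s)) :
      UserStep σ V A (.internal V (.pobSlow A sn os c s))
        { (σ.loc V).user A with
          spLocked := Function.update ((σ.loc V).user A).spLocked sn (some (.ua A sn os c s))
          taProposed :=
            Function.update ((σ.loc V).user A).taProposed sn (some (.ua A sn os c s)) }
  | execUA (A' sn os c s) (hV : V ∉ S.byz)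
      (hd : ((σ.loc V).user A').pobDecided sn = some (.ua A' sn os c s))
      (hv : S.verify (.ua A' sn os c s)) (hn : ((σ.loc V).user A').done sn = none)
      (hr : ((σ.loc V).user A').Ready sn os) :
      UserStep σ V A (.internal V (.execUA A' sn os c s))
        { (σ.loc V).user A with
          owned := (if A = A' then ((σ.loc V).user A').owned \ os
            else ((σ.loc V).user A).owned) ∪ {o | (A, o) ∈ (S.vm.runUA (.ua A' sn os c s)).userObjs}
          done := if A = A' then Function.update ((σ.loc V).user A').done sn
            (some (.ua A' sn os c s)) else ((σ.loc V).user A).done }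
  | finishUARA (A' sn b s e) (hV : V ∉ S.byz)
      (hd : (Tx.uara A' sn b s, e) ∈ ((σ.loc V).user A').notices)
      (hn : ((σ.loc V).user A').done sn = none)
      (hr : ((σ.loc V).user A').Ready sn b.objs) :
      UserStep σ V A (.internal V (.finishUARA A' sn b s e))
        { (σ.loc V).user A with
          owned := (if A = A' then ((σ.loc V).user A').owned \ b.objs
            else ((σ.loc V).user A).owned) ∪ {o | (A, o) ∈ e}
          done := if A = A' then Function.update ((σ.loc V).user A').done sn
            (some (.uara A' sn b s)) else ((σ.loc V).user A).done }
  | receiveUA (sn os c s) (hV : V ∉ S.byz)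
      (hm : ∃ t, (⟨.inr A, V, .tx (.ua A sn os c s), t⟩ : Packet N) ∈ σ.sent)
      (hf : ((σ.loc V).user A).fpLocked sn = none ∨
        ((σ.loc V).user A).fpLocked sn = some (.ua A sn os c s)) :
      UserStep σ V A (.deliver V (.inr A) (.tx (.ua A sn os c s)))
        { (σ.loc V).user A with
          fpLocked := Function.update ((σ.loc V).user A).fpLocked sn (some (.ua A sn os c s)) }
  | receiveUARA (sn b s) (hV : V ∉ S.byz)
      (hm : ∃ t, (⟨.inr A, V, .tx (.uara A sn b s), t⟩ : Packet N) ∈ σ.sent)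
      (hv : S.verify (.uara A sn b s))
      (hf : ((σ.loc V).user A).fpLocked sn = none ∨
        ((σ.loc V).user A).fpLocked sn = some (.uara A sn b s)) :
      UserStep σ V A (.deliver V (.inr A) (.tx (.uara A sn b s)))
        { (σ.loc V).user A with
          fpLocked := Function.update ((σ.loc V).user A).fpLocked sn (some (.uara A sn b s))
          awaiting := insert (.uara A sn b s) ((σ.loc V).user A).awaiting }
  | taDecide (sn) (hV : V ∉ S.byz) (hn : ((σ.loc V).user A).taDecided sn = none) :
      UserStep σ V A (.taDecide V A sn)
        { (σ.loc V).user A with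
          taDecided := Function.update ((σ.loc V).user A).taDecided sn (σ.ta A sn) }

/-- The possible effects of a step on the entity `V.X`. -/
inductive ActorStep (σ : State S) (V : N.Validator) (X : N.Reactive) :
    Action N → ActorEntity S → Prop
  | refl (a) (h : ∀ b, a = .internal V b → ¬ b.AffectsActor X) :
      ActorStep σ V X a ((σ.loc V).actor X)
  | initiate (hV : V ∉ S.byz) (hc : ((σ.loc V).actor X).created)
      (hs : ((σ.loc V).actor X).started = none) :
      ActorStep σ V X (.internal V (.initiate X))
        { (σ.loc V).actor X with started := some σ.now }
  | offer (A sn b s) (hX : b.receiver = X) (hV : V ∉ S.byz)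
      (haw : Tx.uara A sn b s ∈ ((σ.loc V).user A).awaiting)
      (hr : ((σ.loc V).user A).Ready sn b.objs) :
      ActorStep σ V X (.internal V (.offer A sn b s))
        { (σ.loc V).actor X with
          pool := if Tx.uara A sn b s ∈ ((σ.loc V).actor X).executed then
            ((σ.loc V).actor X).pool else insert (.uara A sn b s) ((σ.loc V).actor X).pool }
  | fpBegin (B) (hV : V ∉ S.byz) (hn : ((σ.loc V).actor X).cur.fp = none)
      (hm : (Sum.inl (S.leader X ((σ.loc V).actor X).inst),
        Msg.proposal X ((σ.loc V).actor X).inst B) ∈ (σ.loc V).inbox)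
      (hX : ∀ tx ∈ B, tx.receiver = some X) :
      ActorStep σ V X (.internal V (.fpBegin X B))
        { (σ.loc V).actor X with
          cur := { ((σ.loc V).actor X).cur with fp := some (B, σ.now) } }
  | fpLock (A sn b s) (hV : V ∉ S.byz) :
      ActorStep σ V X (.internal V (.fpLock X A sn b s))
        { (σ.loc V).actor X with
          cur := { ((σ.loc V).actor X).cur with
            fpTried := insert (.uara A sn b s) ((σ.loc V).actor X).cur.fpTried } }
  | fpReply (A sn b s ok B v) (hV : V ∉ S.byz) (hf : ((σ.loc V).actor X).cur.fp = some (B, v))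
      (htx : Tx.uara A sn b s ∈ B)
      (ht : ok = true → S.verify (.uara A sn b s) ∧
        ((σ.loc V).user A).fpLocked sn = some (.uara A sn b s))
      (hff : ok = false → ¬ S.verify (.uara A sn b s) ∨
        ((σ.loc V).user A).fpLocked sn ≠ some (.uara A sn b s) ∨ v + S.Δ < σ.now)
      (htr : Tx.uara A sn b s ∈ ((σ.loc V).actor X).cur.fpTried) :
      ActorStep σ V X (.internal V (.fpReply X A sn b s ok))
        { (σ.loc V).actor X with
          cur := { ((σ.loc V).actor X).cur with
            fpReply :=
              Function.update ((σ.loc V).actor X).cur.fpReply (.uara A sn b s) (some ok) } }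
  | vote (hV : V ∉ S.byz) :
      ActorStep σ V X (.internal V (.vote X))
        { (σ.loc V).actor X with cur := { ((σ.loc V).actor X).cur with voted := True } }
  | slowCandidate (B) (hV : V ∉ S.byz) (hd : σ.SlowDue V X)
      (hq : S.n - S.p - 2 * S.f ≤
        ((σ.loc V).poaVoters X ((σ.loc V).actor X).inst (some B)).ncard) :
      ActorStep σ V X (.internal V (.slowCandidate X B))
        { (σ.loc V).actor X with
          cur := { ((σ.loc V).actor X).cur with slow := .candidate B ∅ } }
  | slowFallback (T) (hV : V ∉ S.byz)
      (hd : (σ.SlowDue V X ∧ ∀ B,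
          ((σ.loc V).poaVoters X ((σ.loc V).actor X).inst (some B)).ncard < S.n - S.p - 2 * S.f) ∨
        ∃ B tried, ((σ.loc V).actor X).cur.slow = .candidate B tried ∧ AllTried B tried ∧
          ∃ tx ∈ B, tx.IsUARA ∧ ¬ (σ.loc V).SPLocked tx)
      (hT : ∀ tx, tx ∈ T ↔
        S.n - 2 * S.f ≤ ((σ.loc V).fallbackVoters X ((σ.loc V).actor X).inst tx).ncard) :
      ActorStep σ V X (.internal V (.slowFallback X T))
        { (σ.loc V).actor X with
          cur := { ((σ.loc V).actor X).cur with slow := .fallback T ∅ } }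
  | spCandidate (A sn b s B tried) (hV : V ∉ S.byz)
      (hs : ((σ.loc V).actor X).cur.slow = .candidate B tried) :
      ActorStep σ V X (.internal V (.spLock X A sn b s))
        { (σ.loc V).actor X with
          cur := { ((σ.loc V).actor X).cur with
            slow := .candidate B (insert (.uara A sn b s) tried) } }
  | spFallback (A sn b s B tried) (hV : V ∉ S.byz)
      (hs : ((σ.loc V).actor X).cur.slow = .fallback B tried) :
      ActorStep σ V X (.internal V (.spLock X A sn b s))
        { (σ.loc V).actor X with
          cur := { ((σ.loc V).actor X).cur with
            slow := .fallback B (insert (.uara A sn b s) tried) } }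
  | qcPropose (B tried P) (hV : V ∉ S.byz)
      (hs : (((σ.loc V).actor X).cur.slow = .candidate B tried ∧
          P = B) ∨
        (((σ.loc V).actor X).cur.slow = .fallback B tried ∧
          P = B.filter (fun tx => tx.IsRARA ∨ (tx.IsUARA ∧ (σ.loc V).SPLocked tx)))) :
      ActorStep σ V X (.internal V (.qcPropose X))
        { (σ.loc V).actor X with
          cur := { ((σ.loc V).actor X).cur with slow := .proposed }
          qcProposed := Function.update ((σ.loc V).actor X).qcProposed
            ((σ.loc V).actor X).inst (some P) }
  | taInitiate (A sn b s) (hV : V ∉ S.byz) :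
      ActorStep σ V X (.internal V (.taInitiate X A sn b s))
        { (σ.loc V).actor X with
          cur := { ((σ.loc V).actor X).cur with
            taTried := insert (.uara A sn b s) ((σ.loc V).actor X).cur.taTried } }
  | qcDecide (hV : V ∉ S.byz) (hn : ((σ.loc V).actor X).cur.qcDecided = none) :
      ActorStep σ V X (.qcDecide V X)
        { (σ.loc V).actor X with
          cur := { ((σ.loc V).actor X).cur with
            qcDecided := σ.qc X ((σ.loc V).actor X).inst } }
  | poaDecide (B) (hV : V ∉ S.byz) (hs : ((σ.loc V).actor X).started ≠ none) :
      ActorStep σ V X (.internal V (.poaDecide X B))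
        { created := ((σ.loc V).actor X).created ∨
            X ∈ (execBlock X ((σ.loc V).actor X) B).actors
          inst := ((σ.loc V).actor X).inst + 1
          started := none
          pool := (((σ.loc V).actor X).pool \ B) ∪
            (execBlock X ((σ.loc V).actor X) B).emitted.filter (fun tx =>
              tx.receiver = some X ∧ tx ∉ (execBlock X ((σ.loc V).actor X) B).executed)
          mem := (execBlock X ((σ.loc V).actor X) B).mem
          owned := (execBlock X ((σ.loc V).actor X) B).owned
          executed := (execBlock X ((σ.loc V).actor X) B).executed
          cur := Attempt.fresh N
          qcProposed := ((σ.loc V).actor X).qcProposed }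
  | poaDecideOther (Y B) (h : X ≠ Y) (hV : V ∉ S.byz) :
      ActorStep σ V X (.internal V (.poaDecide Y B))
        { (σ.loc V).actor X with
          created := ((σ.loc V).actor X).created ∨
            X ∈ (execBlock Y ((σ.loc V).actor Y) B).actors
          pool := ((σ.loc V).actor X).pool ∪
            (execBlock Y ((σ.loc V).actor Y) B).emitted.filter (fun tx =>
              tx.receiver = some X ∧ tx ∉ ((σ.loc V).actor X).executed) }
  | execUA (A sn os c s) (hV : V ∉ S.byz) :
      ActorStep σ V X (.internal V (.execUA A sn os c s))
        { (σ.loc V).actor X with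
          created := ((σ.loc V).actor X).created ∨
            X ∈ (S.vm.runUA (.ua A sn os c s)).actors }

/-- The messages that may be sent in a step. -/
inductive SendStep (σ : State S) : Action N → Source N → Msg N → Prop
  | proposal (V X) (hV : V ∉ S.byz) (hl : S.leader X ((σ.loc V).actor X).inst = V) :
      SendStep σ (.internal V (.initiate X)) (.inl V)
        (.proposal X ((σ.loc V).actor X).inst ((σ.loc V).actor X).pool)
  | vote (V X B v) (hV : V ∉ S.byz) (hn : ¬ ((σ.loc V).actor X).cur.voted)
      (hf : ((σ.loc V).actor X).cur.fp = some (B, v))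
      (hr : ∀ tx ∈ B, tx.IsUARA → ((σ.loc V).actor X).cur.fpReply tx ≠ none) :
      SendStep σ (.internal V (.vote X)) (.inl V)
        (.poaVote X ((σ.loc V).actor X).inst
          (if ∀ tx ∈ B, tx.IsUARA → ((σ.loc V).actor X).cur.fpReply tx = some true then some B
            else none) ((σ.loc V).actor X).pool)
  | poaProof (V X B) (hV : V ∉ S.byz)
      (hd : S.n - S.p ≤ ((σ.loc V).poaVoters X ((σ.loc V).actor X).inst (some B)).ncard ∨
        (∃ src, (src, Msg.poaProof X ((σ.loc V).actor X).inst B) ∈ (σ.loc V).inbox) ∨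
        ∃ Bqc, ((σ.loc V).actor X).cur.qcDecided = some Bqc ∧
          SlowResult Bqc (fun A sn => ((σ.loc V).user A).taDecided sn) B) :
      SendStep σ (.internal V (.poaDecide X B)) (.inl V)
        (.poaProof X ((σ.loc V).actor X).inst B)
  | pobProof (V A sn tx) (hV : V ∉ S.byz) (hk : tx.key = some (A, sn))
      (hd : S.n - S.p ≤ ((σ.loc V).pobVoters A sn tx).ncard ∨
        (∃ src, (src, Msg.pobProof tx) ∈ (σ.loc V).inbox) ∨
        ((σ.loc V).user A).taDecided sn = some tx) :
      SendStep σ (.internal V (.pobDecide A sn tx)) (.inl V) (.pobProof tx)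
  | pobVote (V A sn os c s) (hV : V ∉ S.byz)
      (hm : ∃ t, (⟨.inr A, V, .tx (.ua A sn os c s), t⟩ : Packet N) ∈ σ.sent)
      (hf : ((σ.loc V).user A).fpLocked sn = none ∨
        ((σ.loc V).user A).fpLocked sn = some (.ua A sn os c s)) :
      SendStep σ (.deliver V (.inr A) (.tx (.ua A sn os c s))) (.inl V)
        (.pobVote A sn (some (.ua A sn os c s)))
  | pobRefuse (V A sn os c s) (hV : V ∉ S.byz) :
      SendStep σ (.deliver V (.inr A) (.tx (.ua A sn os c s))) (.inl V) (.pobVote A sn none)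
  | issue (A tx) (hA : A ∈ S.honestUser) (hk : tx.key = some (A, σ.nextSn A)) (hv : S.verify tx) :
      SendStep σ (.issue A tx) (.inr A) (.tx tx)
  | adversary (src V m)
      (hs : match src with
        | .inl W => W ∈ S.byz
        | .inr A => A ∉ S.honestUser)
      (ht : ∀ tx ∈ m.txs, ∀ A sn, tx.key = some (A, sn) → A ∈ S.honestUser → S.verify tx →
        tx ∈ σ.issued)
      (hpob : ∀ tx, m = .pobProof tx → σ.PobCert tx)
      (hpoa : ∀ X k B, m = .poaProof X k B → σ.PoaCert X k B) :
      SendStep σ (.adversary src V m) src m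

section

variable {a : Action N} {σ σ' : State S}

theorem UserStep.of_eq {V A} {u : UserEntity N} (h : u = (σ.loc V).user A)
    (h₁ : ∀ b, a = .internal V b → ¬ b.AffectsUser A) :
    UserStep σ V A a u := h ▸ .refl a h₁

theorem ActorStep.of_eq {V X} {r : ActorEntity S} (h : r = (σ.loc V).actor X)
    (h₁ : ∀ b, a = .internal V b → ¬ b.AffectsActor X) :
    ActorStep σ V X a r := h ▸ .refl a h₁

/-- The transition relation is unfolded here and in the companions `Step.actorStep` and
`Step.sendStep`, so that most invariants below are proved by `cases` on the few rules that touch the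
component in question, with the relevant guards at hand. -/
theorem Step.userStep (h : Step a σ σ') (V A) : UserStep σ V A a ((σ'.loc V).user A) := by
  rcases a with ⟨W, a⟩ | ⟨W, src, m⟩ | _ | _ | _ | ⟨W, X⟩ | _ | ⟨W, A', sn⟩ | _
  · obtain ⟨hW, h⟩ := h
    by_cases hVW : V = W
    swap
    -- The action belongs to another validator `W`, so the state of `V` is untouched.
    · refine .of_eq ?_ (by simp [Ne.symm hVW])
      rcases a with _ | _ | _ | _ | _ | _ | _ | _ | _ | _ | _ | _ | _ | _ | _ | _ <;>
        simp only [InternalStep] at h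
      case initiate => obtain ⟨-, -, rfl⟩ := h; split_ifs <;> simp [State.setLocal_loc, hVW]
      case spLock =>
        obtain ⟨_, _, _, _, _, _, rfl⟩ := h; simp [State.setLocal_loc, hVW]
      case vote => obtain ⟨_, _, _, _, _, rfl⟩ := h; simp [State.setLocal_loc, hVW]
      case qcPropose => obtain ⟨_, _, _, _, _, rfl⟩ := h; simp [State.setLocal_loc, hVW]
      all_goals
        first
        | obtain ⟨_, rfl⟩ := h
        | obtain ⟨_, _, rfl⟩ := h
        | obtain ⟨_, _, _, rfl⟩ := h
        | obtain ⟨_, _, _, _, rfl⟩ := h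
        | obtain ⟨_, _, _, _, _, rfl⟩ := h
        simp [State.setLocal_loc, hVW]
    subst hVW
    rcases a with _ | ⟨A', sn, b, s⟩ | _ | ⟨X, A', sn, b, s⟩ | _ | _ | _ | _ | ⟨X, A', sn, b, s⟩ |
      _ | ⟨X, A', sn, b, s⟩ | ⟨X, B⟩ | ⟨A', sn, tx⟩ | ⟨A', sn, os, c, s⟩ | ⟨A', sn, os, c, s⟩ |
      ⟨A', sn, b, s, e⟩ <;> simp only [InternalStep] at h
    · obtain ⟨-, -, rfl⟩ := h
      refine .of_eq ?_ (by simp [Internal.AffectsUser])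
      split_ifs <;> simp [State.setLocal_loc]
    · obtain ⟨h₁, h₂, rfl⟩ := h
      by_cases hA : A = A'
      · subst hA; simpa [State.setLocal_loc, Local.setUser_user] using .offer sn b s hW h₁ h₂
      · exact .of_eq (by simp [State.setLocal_loc, Local.setUser_user, hA])
          (by simp [Internal.AffectsUser])
    · obtain ⟨-, -, -, -, -, rfl⟩ := h
      exact .of_eq (by simp [State.setLocal_loc]) (by simp [Internal.AffectsUser])
    · obtain ⟨⟨B, v, h₁, h₂⟩, -, rfl⟩ := h
      by_cases hA : A = A'
      · subst hA; simpa [State.setLocal_loc, Local.setUser_user] using .fpLock X sn b s B v hW h₁ h₂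
      · exact .of_eq (by simp [State.setLocal_loc, Local.setUser_user, hA])
          (by simp [Internal.AffectsUser, hA])
    · obtain ⟨-, -, -, rfl⟩ := h
      exact .of_eq (by simp [State.setLocal_loc]) (by simp [Internal.AffectsUser])
    · obtain ⟨-, _, -, -, -, rfl⟩ := h
      exact .of_eq (by simp [State.setLocal_loc]) (by simp [Internal.AffectsUser])
    · obtain ⟨-, -, -, rfl⟩ := h
      exact .of_eq (by simp [State.setLocal_loc]) (by simp [Internal.AffectsUser])
    · obtain ⟨-, -, rfl⟩ := h
      exact .of_eq (by simp [State.setLocal_loc]) (by simp [Internal.AffectsUser])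
    · obtain ⟨B, tried, h₁, -, next, h₂, rfl⟩ := h
      by_cases hA : A = A'
      · subst hA
        simpa [State.setLocal_loc, Local.setUser_user] using
          .spLock X sn b s B tried hW h₁ (h₂.imp (·.1) (·.1))
      · exact .of_eq (by simp [State.setLocal_loc, Local.setUser_user, hA])
          (by simp [Internal.AffectsUser, hA])
    · obtain ⟨-, -, -, -, -, rfl⟩ := h
      exact .of_eq (by simp [State.setLocal_loc]) (by simp [Internal.AffectsUser])
    · obtain ⟨⟨B, h₁, h₂⟩, -, rfl⟩ := h
      by_cases hA : A = A'
      · subst hA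
        simpa [State.setLocal_loc, Local.setUser_user] using .taInitiate X sn b s B hW h₁ h₂
      · exact .of_eq (by simp [State.setLocal_loc, Local.setUser_user, hA])
          (by simp [Internal.AffectsUser])
    · obtain ⟨-, -, rfl⟩ := h
      simpa [State.setLocal_loc, Local.applyBlock_user] using .poaDecide X B hW
    · obtain ⟨h₁, h₂, h₃, rfl⟩ := h
      by_cases hA : A = A'
      · subst hA
        simpa [State.setLocal_loc, Local.setUser_user] using .pobDecide sn tx hW h₁ h₂ h₃
      · exact .of_eq (by simp [State.setLocal_loc, Local.setUser_user, hA])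
          (by simp [Internal.AffectsUser, hA])
    · obtain ⟨h₁, h₂, h₃, rfl⟩ := h
      by_cases hA : A = A'
      · subst hA
        simpa [State.setLocal_loc, Local.setUser_user] using .pobSlow sn os c s hW h₁ h₂
      · exact .of_eq (by simp [State.setLocal_loc, Local.setUser_user, hA])
          (by simp [Internal.AffectsUser])
    · obtain ⟨h₁, h₂, h₃, h₄, rfl⟩ := h
      simpa [State.setLocal_loc, Local.applyUser_user, Tx.objs] using
        .execUA (A := A) A' sn os c s hW h₁ h₂ h₃ h₄
    · obtain ⟨h₁, h₂, h₃, rfl⟩ := h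
      simpa [State.setLocal_loc, Local.applyUser_user, Tx.objs] using
        .finishUARA (A := A) A' sn b s e hW h₁ h₂ h₃
  · obtain ⟨hW, ht, -, rfl⟩ := h
    set l' : Local S := { σ.loc W with inbox := insert (src, m) (σ.loc W).inbox } with hl'
    have hu : ∀ V A, ((σ.setLocal W l').loc V).user A = (σ.loc V).user A := by
      intro V A; rw [State.setLocal_loc]; split_ifs with hh <;> simp [hl', hh]
    unfold State.react
    split
    · rename_i A' A'' sn os c s
      dsimp only
      split_ifs with h₁ h₂
      · exact .of_eq (hu _ _) (by simp)
      · rw [not_not] at h₁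
        subst h₁
        simp only [State.broadcast_loc]
        rw [State.setLocal_loc]
        split_ifs with hVW
        · subst hVW
          rw [Local.setUser_user]
          split_ifs with hA
          · subst hA
            simp only [hu] at h₂ ⊢
            exact .receiveUA sn os c s hW ht h₂
          · exact .of_eq (hu _ _) (by simp)
        · exact .of_eq (hu _ _) (by simp)
      · exact .of_eq (hu _ _) (by simp)
    · rename_i A' A'' sn b s
      dsimp only
      split_ifs with h₁
      · obtain ⟨rfl, h₁, h₂⟩ := h₁
        rw [State.setLocal_loc]
        split_ifs with hVW
        · subst hVW
          rw [Local.setUser_user]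
          split_ifs with hA
          · subst hA
            simp only [hu] at h₂ ⊢
            exact .receiveUARA sn b s hW ht h₁ h₂
          · exact .of_eq (hu _ _) (by simp)
        · exact .of_eq (hu _ _) (by simp)
      · exact .of_eq (hu _ _) (by simp)
    · exact .of_eq (hu _ _) (by simp)
  · obtain ⟨_, _, _, _, _, rfl⟩ := h
    exact .refl _ (by simp)
  · obtain ⟨_, _, _, _, rfl⟩ := h
    exact .refl _ (by simp)
  · obtain ⟨_, _, rfl⟩ := h
    exact .refl _ (by simp)
  · obtain ⟨hW, _, _, _, rfl⟩ := h
    refine .of_eq ?_ (by simp)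
    rw [State.setLocal_loc]
    split_ifs with hh <;> simp [hh]
  · obtain ⟨_, _, rfl⟩ := h
    exact .refl _ (by simp)
  · obtain ⟨hW, h₁, h₂, rfl⟩ := h
    rw [State.setLocal_loc]
    split_ifs with hVW
    · subst hVW
      rw [Local.setUser_user]
      split_ifs with hA
      · subst hA
        exact .taDecide sn hW h₁
      · exact .refl _ (by simp)
    · exact .refl _ (by simp)
  · obtain ⟨_, _, _, rfl⟩ := h
    exact .refl _ (by simp)

theorem Step.actorStep (h : Step a σ σ') (V X) : ActorStep σ V X a ((σ'.loc V).actor X) := by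
  rcases a with ⟨W, a⟩ | ⟨W, src, m⟩ | _ | _ | _ | ⟨W, Y⟩ | _ | ⟨W, A', sn⟩ | _
  · obtain ⟨hW, h⟩ := h
    by_cases hVW : V = W
    swap
    · refine .of_eq ?_ (by simp [Ne.symm hVW])
      rcases a with _ | _ | _ | _ | _ | _ | _ | _ | _ | _ | _ | _ | _ | _ | _ | _ <;>
        simp only [InternalStep] at h
      case initiate => obtain ⟨-, -, rfl⟩ := h; split_ifs <;> simp [State.setLocal_loc, hVW]
      case spLock =>
        obtain ⟨_, _, _, _, _, _, rfl⟩ := h; simp [State.setLocal_loc, hVW]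
      case vote => obtain ⟨_, _, _, _, _, rfl⟩ := h; simp [State.setLocal_loc, hVW]
      case qcPropose => obtain ⟨_, _, _, _, _, rfl⟩ := h; simp [State.setLocal_loc, hVW]
      all_goals
        first
        | obtain ⟨_, rfl⟩ := h
        | obtain ⟨_, _, rfl⟩ := h
        | obtain ⟨_, _, _, rfl⟩ := h
        | obtain ⟨_, _, _, _, rfl⟩ := h
        | obtain ⟨_, _, _, _, _, rfl⟩ := h
        simp [State.setLocal_loc, hVW]
    subst hVW
    rcases a with Y | ⟨A, sn, b, s⟩ | ⟨Y, B⟩ | ⟨Y, A, sn, b, s⟩ | ⟨Y, A, sn, b, s, ok⟩ | Y |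
      ⟨Y, B⟩ | ⟨Y, T⟩ | ⟨Y, A, sn, b, s⟩ | Y | ⟨Y, A, sn, b, s⟩ | ⟨Y, B⟩ | ⟨A, sn, tx⟩ |
      ⟨A, sn, os, c, s⟩ | ⟨A, sn, os, c, s⟩ | ⟨A, sn, b, s, e⟩ <;> simp only [InternalStep] at h
    · obtain ⟨h₁, h₂, rfl⟩ := h
      by_cases hX : X = Y
      · subst hX
        split_ifs <;> simpa [State.setLocal_loc, Local.setActor_actor] using .initiate hW h₁ h₂
      · refine .of_eq ?_ (by simp [Internal.AffectsActor, hX])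
        split_ifs <;> simp [State.setLocal_loc, Local.setActor_actor, hX]
    · obtain ⟨h₁, h₂, rfl⟩ := h
      by_cases hX : X = b.receiver
      · subst hX
        simpa [State.setLocal_loc, Local.setActor_actor] using .offer A sn b s rfl hW h₁ h₂
      · exact .of_eq (by simp [State.setLocal_loc, Local.setActor_actor, hX])
          (by simp [Internal.AffectsActor, hX])
    · obtain ⟨-, h₁, h₂, h₃, -, rfl⟩ := h
      by_cases hX : X = Y
      · subst hX
        simpa [State.setLocal_loc, Local.setActor_actor] using .fpBegin B hW h₁ h₂ h₃
      · exact .of_eq (by simp [State.setLocal_loc, Local.setActor_actor, hX])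
          (by simp [Internal.AffectsActor])
    · obtain ⟨-, -, rfl⟩ := h
      by_cases hX : X = Y
      · subst hX
        simpa [State.setLocal_loc, Local.setActor_actor] using .fpLock A sn b s hW
      · exact .of_eq (by simp [State.setLocal_loc, Local.setActor_actor, hX])
          (by simp [Internal.AffectsActor])
    · obtain ⟨⟨B, v, h₁, h₂, h₃, h₄⟩, h₅, -, rfl⟩ := h
      by_cases hX : X = Y
      · subst hX
        simpa [State.setLocal_loc, Local.setActor_actor] using
          .fpReply A sn b s ok B v hW h₁ h₂ (fun h => ⟨(h₃ h).1, (h₃ h).2.1⟩) h₄ h₅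
      · exact .of_eq (by simp [State.setLocal_loc, Local.setActor_actor, hX])
          (by simp [Internal.AffectsActor])
    · obtain ⟨-, _, -, -, -, rfl⟩ := h
      by_cases hX : X = Y
      · subst hX
        simpa [State.setLocal_loc, Local.setActor_actor] using .vote hW
      · exact .of_eq (by simp [State.setLocal_loc, Local.setActor_actor, hX])
          (by simp [Internal.AffectsActor, hX])
    · obtain ⟨-, h₁, h₂, rfl⟩ := h
      by_cases hX : X = Y
      · subst hX
        simpa [State.setLocal_loc, Local.setActor_actor] using .slowCandidate B hW h₁ h₂
      · exact .of_eq (by simp [State.setLocal_loc, Local.setActor_actor, hX])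
          (by simp [Internal.AffectsActor])
    · obtain ⟨h₁, h₂, rfl⟩ := h
      by_cases hX : X = Y
      · subst hX
        simpa [State.setLocal_loc, Local.setActor_actor] using
          .slowFallback T hW (h₁.imp_left (·.2)) h₂
      · exact .of_eq (by simp [State.setLocal_loc, Local.setActor_actor, hX])
          (by simp [Internal.AffectsActor])
    · obtain ⟨B, tried, -, -, next, h₂, rfl⟩ := h
      by_cases hX : X = Y
      · subst hX
        rcases h₂ with ⟨h₂, rfl⟩ | ⟨h₂, rfl⟩
        · simpa [State.setLocal_loc, Local.setActor_actor] using .spCandidate A sn b s B tried hW h₂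
        · simpa [State.setLocal_loc, Local.setActor_actor] using .spFallback A sn b s B tried hW h₂
      · exact .of_eq (by simp [State.setLocal_loc, Local.setActor_actor, hX])
          (by simp [Internal.AffectsActor])
    · obtain ⟨B, tried, P, -, h₁, rfl⟩ := h
      by_cases hX : X = Y
      · subst hX
        simpa [State.setLocal_loc, Local.setActor_actor] using
          .qcPropose B tried P hW (h₁.imp_left fun h => ⟨h.1, h.2.2⟩)
      · exact .of_eq (by simp [State.setLocal_loc, Local.setActor_actor, hX])
          (by simp [Internal.AffectsActor])
    · obtain ⟨-, -, rfl⟩ := h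
      by_cases hX : X = Y
      · subst hX
        simpa [State.setLocal_loc, Local.setActor_actor] using .taInitiate A sn b s hW
      · exact .of_eq (by simp [State.setLocal_loc, Local.setActor_actor, hX])
          (by simp [Internal.AffectsActor])
    · obtain ⟨h₁, -, rfl⟩ := h
      by_cases hX : X = Y
      · subst hX
        simpa [State.setLocal_loc, Local.applyBlock_actor_self] using .poaDecide B hW h₁
      · simpa [State.setLocal_loc, Local.applyBlock_actor_of_ne _ _ _ _ hX] using
          .poaDecideOther Y B hX hW
    · obtain ⟨-, -, -, rfl⟩ := h
      exact .of_eq (by simp [State.setLocal_loc]) (by simp [Internal.AffectsActor])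
    · obtain ⟨-, -, -, rfl⟩ := h
      exact .of_eq (by simp [State.setLocal_loc]) (by simp [Internal.AffectsActor])
    · obtain ⟨-, -, -, -, rfl⟩ := h
      simpa [State.setLocal_loc, Local.create_actor] using .execUA A sn os c s hW
    · obtain ⟨-, -, -, rfl⟩ := h
      exact .of_eq (by simp [State.setLocal_loc]) (by simp [Internal.AffectsActor])
  · obtain ⟨hW, ht, -, rfl⟩ := h
    refine .of_eq ?_ (by simp [Internal.AffectsActor])
    set l' : Local S := { σ.loc W with inbox := insert (src, m) (σ.loc W).inbox } with hl'
    have hu : ∀ V X, ((σ.setLocal W l').loc V).actor X = (σ.loc V).actor X := by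
      intro V A; rw [State.setLocal_loc]; split_ifs with hh <;> simp [hl', hh]
    unfold State.react
    split
    · dsimp only
      split_ifs with h₁ h₂
      · exact hu _ _
      · simp only [State.broadcast_loc]
        rw [State.setLocal_loc]
        split_ifs with hVW
        · subst hVW; exact hu _ _
        · exact hu _ _
      · exact hu _ _
    · dsimp only
      split_ifs with h₁
      · rw [State.setLocal_loc]
        split_ifs with hVW
        · subst hVW; exact hu _ _
        · exact hu _ _
      · exact hu _ _
    · exact hu _ _
  · obtain ⟨_, _, _, _, _, rfl⟩ := h
    exact .refl _ (by simp [Internal.AffectsActor])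
  · obtain ⟨_, _, _, _, rfl⟩ := h
    exact .refl _ (by simp [Internal.AffectsActor])
  · obtain ⟨_, _, rfl⟩ := h
    exact .refl _ (by simp [Internal.AffectsActor])
  · obtain ⟨hW, _, h₁, _, rfl⟩ := h
    rw [State.setLocal_loc]
    split_ifs with hVW
    · subst hVW
      rw [Local.setActor_actor]
      split_ifs with hX
      · subst hX
        exact .qcDecide hW h₁
      · exact .refl _ (by simp [Internal.AffectsActor])
    · exact .refl _ (by simp [Internal.AffectsActor])
  · obtain ⟨_, _, rfl⟩ := h
    exact .refl _ (by simp [Internal.AffectsActor])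
  · obtain ⟨hW, h₁, h₂, rfl⟩ := h
    refine .of_eq ?_ (by simp [Internal.AffectsActor])
    rw [State.setLocal_loc]
    split_ifs with hVW
    · subst hVW; rfl
    · rfl
  · obtain ⟨_, _, _, rfl⟩ := h
    exact .refl _ (by simp [Internal.AffectsActor])

/-- The first appearance of a packet identifies the rule that produced it, along with the guard that
held at that moment. All invariants about the network start from here. -/
theorem Step.sendStep (h : Step a σ σ') (q : Packet N) (hq : q ∈ σ'.sent) :
    q ∈ σ.sent ∨ (q.time = σ.now ∧ SendStep σ a q.src q.msg) := by
  rcases a with ⟨W, a⟩ | ⟨W, src, m⟩ | _ | ⟨src, W, m⟩ | _ | ⟨W, Y⟩ | _ | ⟨W, A', sn⟩ | _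
  · obtain ⟨hW, h⟩ := h
    rcases a with Y | ⟨A, sn, b, s⟩ | ⟨Y, B⟩ | ⟨Y, A, sn, b, s⟩ | ⟨Y, A, sn, b, s, ok⟩ | Y |
      ⟨Y, B⟩ | ⟨Y, T⟩ | ⟨Y, A, sn, b, s⟩ | Y | ⟨Y, A, sn, b, s⟩ | ⟨Y, B⟩ | ⟨A, sn, tx⟩ |
      ⟨A, sn, os, c, s⟩ | ⟨A, sn, os, c, s⟩ | ⟨A, sn, b, s, e⟩ <;> simp only [InternalStep] at h
    case initiate =>
      obtain ⟨h₁, h₂, rfl⟩ := h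
      split_ifs at hq with hl
      · rw [State.mem_broadcast] at hq
        rcases hq with hq | ⟨h₃, h₄, h₅⟩
        · exact .inl hq
        · rw [h₃, h₄]; exact .inr ⟨h₅, .proposal W Y hW hl⟩
      · exact .inl hq
    case vote =>
      obtain ⟨h₁, B, v, h₂, h₃, rfl⟩ := h
      rw [State.mem_broadcast] at hq
      rcases hq with hq | ⟨h₄, h₅, h₆⟩
      · exact .inl hq
      · rw [h₄, h₅]; exact .inr ⟨h₆, .vote W Y B v hW h₁ h₂ h₃⟩
    case poaDecide =>
      obtain ⟨-, h₁, rfl⟩ := h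
      rw [State.mem_broadcast] at hq
      rcases hq with hq | ⟨h₄, h₅, h₆⟩
      · exact .inl hq
      · rw [h₄, h₅]
        exact .inr ⟨h₆, .poaProof W Y B hW (h₁.imp_right (Or.imp_right
          fun ⟨C, h₁, h₂, h₃⟩ => ⟨C, h₁, h₃⟩))⟩
    case pobDecide =>
      obtain ⟨-, h₁, h₂, rfl⟩ := h
      rw [State.mem_broadcast] at hq
      rcases hq with hq | ⟨h₄, h₅, h₆⟩
      · exact .inl hq
      · rw [h₄, h₅]; exact .inr ⟨h₆, .pobProof W A sn tx hW h₁ h₂⟩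
    case spLock => obtain ⟨_, _, _, _, _, _, rfl⟩ := h; exact .inl hq
    case qcPropose => obtain ⟨_, _, _, _, _, rfl⟩ := h; exact .inl hq
    all_goals
      first
      | obtain ⟨_, rfl⟩ := h
      | obtain ⟨_, _, rfl⟩ := h
      | obtain ⟨_, _, _, rfl⟩ := h
      | obtain ⟨_, _, _, _, rfl⟩ := h
      | obtain ⟨_, _, _, _, _, rfl⟩ := h
      exact .inl hq
  · obtain ⟨hW, ht, -, rfl⟩ := h
    set l' : Local S := { σ.loc W with inbox := insert (src, m) (σ.loc W).inbox } with hl'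
    have hu : ∀ A, ((σ.setLocal W l').loc W).user A = (σ.loc W).user A := by
      intro A; simp [State.setLocal_loc, hl']
    unfold State.react at hq
    split at hq
    · rename_i A' A'' sn os c s
      dsimp only at hq
      split_ifs at hq with h₁ h₂
      · exact .inl hq
      · rw [not_not] at h₁
        subst h₁
        rw [State.mem_broadcast] at hq
        rcases hq with hq | ⟨h₃, h₄, h₅⟩
        · exact .inl hq
        · rw [h₃, h₄]
          rw [hu] at h₂
          exact .inr ⟨h₅, .pobVote W A' sn os c s hW ht h₂⟩
      · rw [not_not] at h₁
        subst h₁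
        rw [State.mem_broadcast] at hq
        rcases hq with hq | ⟨h₃, h₄, h₅⟩
        · exact .inl hq
        · rw [h₃, h₄]
          exact .inr ⟨h₅, .pobRefuse W A' sn os c s hW⟩
    · dsimp only at hq
      split_ifs at hq <;> exact .inl hq
    · exact .inl hq
  · obtain ⟨h₁, h₂, h₃, _, _, rfl⟩ := h
    rw [State.mem_broadcast] at hq
    rcases hq with hq | ⟨h₄, h₅, h₆⟩
    · exact .inl hq
    · rw [h₄, h₅]; exact .inr ⟨h₆, .issue _ _ h₁ h₂ h₃⟩
  · obtain ⟨h₁, h₂, h₃, h₄, rfl⟩ := h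
    rcases hq with rfl | hq
    · exact .inr ⟨rfl, .adversary src W m h₁ h₂ h₃ h₄⟩
    · exact .inl hq
  · obtain ⟨_, _, rfl⟩ := h; exact .inl hq
  · obtain ⟨_, _, _, _, rfl⟩ := h; exact .inl hq
  · obtain ⟨_, _, rfl⟩ := h; exact .inl hq
  · obtain ⟨_, _, _, rfl⟩ := h; exact .inl hq
  · obtain ⟨_, _, _, rfl⟩ := h; exact .inl hq

/-- A step either is the passage of time, and changes nothing else, or leaves the clock alone. -/
theorem Step.now (h : Step a σ σ') :
    σ'.now = σ.now ∨ σ.now < σ'.now ∧ ∃ t, a = .tick t := by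
  rcases a with ⟨W, a⟩ | ⟨W, src, m⟩ | _ | ⟨src, W, m⟩ | _ | ⟨W, Y⟩ | _ | ⟨W, A', sn⟩ | t
  · obtain ⟨-, h⟩ := h
    left
    rcases a with Y | ⟨A, sn, b, s⟩ | ⟨Y, B⟩ | ⟨Y, A, sn, b, s⟩ | ⟨Y, A, sn, b, s, ok⟩ | Y |
      ⟨Y, B⟩ | ⟨Y, T⟩ | ⟨Y, A, sn, b, s⟩ | Y | ⟨Y, A, sn, b, s⟩ | ⟨Y, B⟩ | ⟨A, sn, tx⟩ |
      ⟨A, sn, os, c, s⟩ | ⟨A, sn, os, c, s⟩ | ⟨A, sn, b, s, e⟩ <;> simp only [InternalStep] at h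
    case initiate => obtain ⟨_, _, rfl⟩ := h; split_ifs <;> rfl
    case vote => obtain ⟨_, _, _, _, _, rfl⟩ := h; rfl
    case spLock => obtain ⟨_, _, _, _, _, _, rfl⟩ := h; rfl
    case qcPropose => obtain ⟨_, _, _, _, _, rfl⟩ := h; rfl
    all_goals
      first
      | obtain ⟨_, rfl⟩ := h
      | obtain ⟨_, _, rfl⟩ := h
      | obtain ⟨_, _, _, rfl⟩ := h
      | obtain ⟨_, _, _, _, rfl⟩ := h
      | obtain ⟨_, _, _, _, _, rfl⟩ := h
      rfl
  · obtain ⟨-, -, -, rfl⟩ := h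
    left
    unfold State.react
    split
    · dsimp only; split_ifs <;> rfl
    · dsimp only; split_ifs <;> rfl
    · rfl
  · obtain ⟨_, _, _, _, _, rfl⟩ := h; exact .inl rfl
  · obtain ⟨_, _, _, _, rfl⟩ := h; exact .inl rfl
  · obtain ⟨_, _, rfl⟩ := h; exact .inl rfl
  · obtain ⟨_, _, _, _, rfl⟩ := h; exact .inl rfl
  · obtain ⟨_, _, rfl⟩ := h; exact .inl rfl
  · obtain ⟨_, _, _, rfl⟩ := h; exact .inl rfl
  · obtain ⟨h, _, _, rfl⟩ := h; exact .inr ⟨h, t, rfl⟩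

theorem Step.sent_subset (h : Step a σ σ') : σ.sent ⊆ σ'.sent := by
  rcases a with ⟨W, a⟩ | ⟨W, src, m⟩ | _ | ⟨src, W, m⟩ | _ | ⟨W, Y⟩ | _ | ⟨W, A', sn⟩ | t
  · obtain ⟨-, h⟩ := h
    rcases a with Y | ⟨A, sn, b, s⟩ | ⟨Y, B⟩ | ⟨Y, A, sn, b, s⟩ | ⟨Y, A, sn, b, s, ok⟩ | Y |
      ⟨Y, B⟩ | ⟨Y, T⟩ | ⟨Y, A, sn, b, s⟩ | Y | ⟨Y, A, sn, b, s⟩ | ⟨Y, B⟩ | ⟨A, sn, tx⟩ |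
      ⟨A, sn, os, c, s⟩ | ⟨A, sn, os, c, s⟩ | ⟨A, sn, b, s, e⟩ <;> simp only [InternalStep] at h
    case initiate =>
      obtain ⟨_, _, rfl⟩ := h
      split_ifs
      · exact fun q hq => .inl hq
      · exact subset_rfl
    case vote => obtain ⟨_, _, _, _, _, rfl⟩ := h; exact fun q hq => .inl hq
    case poaDecide => obtain ⟨_, _, rfl⟩ := h; exact fun q hq => .inl hq
    case pobDecide => obtain ⟨_, _, _, rfl⟩ := h; exact fun q hq => .inl hq
    case spLock => obtain ⟨_, _, _, _, _, _, rfl⟩ := h; exact subset_rfl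
    case qcPropose => obtain ⟨_, _, _, _, _, rfl⟩ := h; exact subset_rfl
    all_goals
      first
      | obtain ⟨_, rfl⟩ := h
      | obtain ⟨_, _, rfl⟩ := h
      | obtain ⟨_, _, _, rfl⟩ := h
      | obtain ⟨_, _, _, _, rfl⟩ := h
      | obtain ⟨_, _, _, _, _, rfl⟩ := h
      exact subset_rfl
  · obtain ⟨-, -, -, rfl⟩ := h
    unfold State.react
    split
    · dsimp only
      split_ifs
      · exact subset_rfl
      · exact fun q hq => .inl hq
      · exact fun q hq => .inl hq
    · dsimp only; split_ifs <;> exact subset_rfl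
    · exact subset_rfl
  · obtain ⟨_, _, _, _, _, rfl⟩ := h; exact fun q hq => .inl hq
  · obtain ⟨_, _, _, _, rfl⟩ := h; exact Set.subset_insert _ _
  · obtain ⟨_, _, rfl⟩ := h; exact subset_rfl
  · obtain ⟨_, _, _, _, rfl⟩ := h; exact subset_rfl
  · obtain ⟨_, _, rfl⟩ := h; exact subset_rfl
  · obtain ⟨_, _, _, rfl⟩ := h; exact subset_rfl
  · obtain ⟨h, _, _, rfl⟩ := h; exact subset_rfl

theorem InternalStep.frame {V : N.Validator} {b : Internal N} (h : InternalStep V b σ σ') :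
    σ'.issued = σ.issued ∧ σ'.nextSn = σ.nextSn ∧ σ'.qc = σ.qc ∧ σ'.ta = σ.ta ∧
      ∀ W, (σ'.loc W).inbox = (σ.loc W).inbox := by
  rcases b with Y | ⟨A, sn, b, s⟩ | ⟨Y, B⟩ | ⟨Y, A, sn, b, s⟩ | ⟨Y, A, sn, b, s, ok⟩ | Y |
    ⟨Y, B⟩ | ⟨Y, T⟩ | ⟨Y, A, sn, b, s⟩ | Y | ⟨Y, A, sn, b, s⟩ | ⟨Y, B⟩ | ⟨A, sn, tx⟩ |
    ⟨A, sn, os, c, s⟩ | ⟨A, sn, os, c, s⟩ | ⟨A, sn, b, s, e⟩ <;> simp only [InternalStep] at h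
  case initiate =>
    obtain ⟨_, _, rfl⟩ := h
    split_ifs <;> refine ⟨rfl, rfl, rfl, rfl, fun W => ?_⟩ <;>
      simp only [State.broadcast_loc, State.setLocal_loc] <;> split_ifs with hh <;> simp [hh]
  case vote =>
    obtain ⟨_, _, _, _, _, rfl⟩ := h
    refine ⟨rfl, rfl, rfl, rfl, fun W => ?_⟩
    simp only [State.broadcast_loc, State.setLocal_loc]; split_ifs with hh <;> simp [hh]
  case spLock =>
    obtain ⟨_, _, _, _, _, _, rfl⟩ := h
    refine ⟨rfl, rfl, rfl, rfl, fun W => ?_⟩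
    simp only [State.setLocal_loc]; split_ifs with hh <;> simp [hh]
  case qcPropose =>
    obtain ⟨_, _, _, _, _, rfl⟩ := h
    refine ⟨rfl, rfl, rfl, rfl, fun W => ?_⟩
    simp only [State.setLocal_loc]; split_ifs with hh <;> simp [hh]
  all_goals
    first
    | obtain ⟨_, rfl⟩ := h
    | obtain ⟨_, _, rfl⟩ := h
    | obtain ⟨_, _, _, rfl⟩ := h
    | obtain ⟨_, _, _, _, rfl⟩ := h
    | obtain ⟨_, _, _, _, _, rfl⟩ := h
    refine ⟨rfl, rfl, rfl, rfl, fun W => ?_⟩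
    simp only [State.broadcast_loc, State.setLocal_loc]; split_ifs with hh <;> simp [hh]

theorem State.react_frame (σ : State S) (V src m) :
    (σ.react V src m).issued = σ.issued ∧ (σ.react V src m).nextSn = σ.nextSn ∧
      (σ.react V src m).qc = σ.qc ∧ (σ.react V src m).ta = σ.ta ∧
      ∀ W, ((σ.react V src m).loc W).inbox = (σ.loc W).inbox := by
  unfold State.react
  split
  · dsimp only
    split_ifs <;> refine ⟨rfl, rfl, rfl, rfl, fun W => ?_⟩ <;>
      simp only [State.broadcast_loc, State.setLocal_loc]
    split_ifs with hh <;> simp [hh]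
  · dsimp only
    split_ifs <;> refine ⟨rfl, rfl, rfl, rfl, fun W => ?_⟩ <;>
      simp only [State.setLocal_loc]
    split_ifs with hh <;> simp [hh]
  · exact ⟨rfl, rfl, rfl, rfl, fun W => rfl⟩

theorem Step.inbox (h : Step a σ σ') (V) :
    (σ'.loc V).inbox = (σ.loc V).inbox ∨ ∃ src m, a = .deliver V src m ∧
      (∃ t, (⟨src, V, m, t⟩ : Packet N) ∈ σ.sent) ∧
      (σ'.loc V).inbox = insert (src, m) (σ.loc V).inbox := by
  rcases a with ⟨W, a⟩ | ⟨W, src, m⟩ | _ | ⟨src, W, m⟩ | _ | ⟨W, Y⟩ | _ | ⟨W, A', sn⟩ | t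
  · exact .inl (h.2.frame.2.2.2.2 V)
  · obtain ⟨-, h₁, -, rfl⟩ := h
    rw [(State.react_frame _ _ _ _).2.2.2.2, State.setLocal_loc]
    split_ifs with hh
    · subst hh; exact .inr ⟨src, m, rfl, h₁, rfl⟩
    · exact .inl rfl
  · obtain ⟨_, _, _, _, _, rfl⟩ := h; exact .inl rfl
  · obtain ⟨_, _, _, _, rfl⟩ := h; exact .inl rfl
  · obtain ⟨_, _, rfl⟩ := h; exact .inl rfl
  · obtain ⟨_, _, _, _, rfl⟩ := h
    rw [State.setLocal_loc]; split_ifs with hh <;> simp [hh]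
  · obtain ⟨_, _, rfl⟩ := h; exact .inl rfl
  · obtain ⟨_, _, _, rfl⟩ := h
    rw [State.setLocal_loc]; split_ifs with hh <;> simp [hh]
  · obtain ⟨h, _, _, rfl⟩ := h; exact .inl rfl

theorem Step.qc (h : Step a σ σ') (X k) :
    σ'.qc X k = σ.qc X k ∨
      ∃ B, σ.qc X k = none ∧ σ.QuorumValid X k B ∧ σ'.qc X k = some B := by
  rcases a with ⟨W, a⟩ | ⟨W, src, m⟩ | _ | ⟨src, W, m⟩ | ⟨Y, k', B⟩ | ⟨W, Y⟩ | _ |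
    ⟨W, A', sn⟩ | t
  · exact .inl (by rw [h.2.frame.2.2.1])
  · obtain ⟨-, -, -, rfl⟩ := h
    rw [(State.react_frame _ _ _ _).2.2.1]; exact .inl rfl
  · obtain ⟨_, _, _, _, _, rfl⟩ := h; exact .inl rfl
  · obtain ⟨_, _, _, _, rfl⟩ := h; exact .inl rfl
  · obtain ⟨h₁, h₂, rfl⟩ := h
    by_cases hX : X = Y
    · subst hX
      by_cases hk : k = k'
      · subst hk; exact .inr ⟨B, h₁, h₂, by simp⟩
      · left; simp [hk]
    · left; simp [hX]
  · obtain ⟨_, _, _, _, rfl⟩ := h; exact .inl rfl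
  · obtain ⟨_, _, rfl⟩ := h; exact .inl rfl
  · obtain ⟨_, _, _, rfl⟩ := h; exact .inl rfl
  · obtain ⟨h, _, _, rfl⟩ := h; exact .inl rfl

theorem Step.ta (h : Step a σ σ') (A sn) :
    σ'.ta A sn = σ.ta A sn ∨
      ∃ tx, σ.ta A sn = none ∧ S.n - 3 * S.f ≤
        {V | V ∉ S.byz ∧ ((σ.loc V).user A).taProposed sn = some tx}.ncard ∧
        σ'.ta A sn = some tx := by
  rcases a with ⟨W, a⟩ | ⟨W, src, m⟩ | _ | ⟨src, W, m⟩ | ⟨Y, k', B⟩ | ⟨W, Y⟩ | ⟨A', sn', tx⟩ |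
    ⟨W, A', sn'⟩ | t
  · exact .inl (by rw [h.2.frame.2.2.2.1])
  · obtain ⟨-, -, -, rfl⟩ := h
    rw [(State.react_frame _ _ _ _).2.2.2.1]; exact .inl rfl
  · obtain ⟨_, _, _, _, _, rfl⟩ := h; exact .inl rfl
  · obtain ⟨_, _, _, _, rfl⟩ := h; exact .inl rfl
  · obtain ⟨_, _, rfl⟩ := h; exact .inl rfl
  · obtain ⟨_, _, _, _, rfl⟩ := h; exact .inl rfl
  · obtain ⟨h₁, h₂, rfl⟩ := h
    by_cases hX : A = A'
    · subst hX
      by_cases hk : sn = sn'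
      · subst hk; exact .inr ⟨tx, h₁, h₂, by simp⟩
      · left; simp [hk]
    · left; simp [hX]
  · obtain ⟨_, _, _, rfl⟩ := h; exact .inl rfl
  · obtain ⟨h, _, _, rfl⟩ := h; exact .inl rfl

theorem Step.issued (h : Step a σ σ') :
    (σ'.issued = σ.issued ∧ σ'.nextSn = σ.nextSn) ∨
      ∃ A tx, a = .issue A tx ∧ σ'.issued = insert tx σ.issued ∧
        σ'.nextSn = Function.update σ.nextSn A (σ.nextSn A + 1) := by
  rcases a with ⟨W, a⟩ | ⟨W, src, m⟩ | ⟨A, tx⟩ | ⟨src, W, m⟩ | ⟨Y, k', B⟩ | ⟨W, Y⟩ |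
    ⟨A', sn', tx⟩ | ⟨W, A', sn'⟩ | t
  · exact .inl ⟨h.2.frame.1, h.2.frame.2.1⟩
  · obtain ⟨-, -, -, rfl⟩ := h
    exact .inl ⟨(State.react_frame _ _ _ _).1, (State.react_frame _ _ _ _).2.1⟩
  · obtain ⟨_, _, _, _, _, rfl⟩ := h; exact .inr ⟨A, tx, rfl, rfl, rfl⟩
  · obtain ⟨_, _, _, _, rfl⟩ := h; exact .inl ⟨rfl, rfl⟩
  · obtain ⟨_, _, rfl⟩ := h; exact .inl ⟨rfl, rfl⟩
  · obtain ⟨_, _, _, _, rfl⟩ := h; exact .inl ⟨rfl, rfl⟩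
  · obtain ⟨_, _, rfl⟩ := h; exact .inl ⟨rfl, rfl⟩
  · obtain ⟨_, _, _, rfl⟩ := h; exact .inl ⟨rfl, rfl⟩
  · obtain ⟨h, _, _, rfl⟩ := h; exact .inl ⟨rfl, rfl⟩

end

/-! ### Counting -/

theorem System.size' (S : System N) : 3 * S.f + 2 * S.p + 1 ≤ S.n := S.size

theorem System.ncard_le (S : System N) (Q : Set N.Validator) : Q.ncard ≤ S.n := by
  let _ := S.validators
  rw [System.n, ← Nat.card_eq_fintype_card, ← Set.ncard_univ]
  exact Set.ncard_le_ncard (Set.subset_univ _) (Set.toFinite _)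

theorem System.ncard_mono (S : System N) {Q R : Set N.Validator} (h : Q ⊆ R) :
    Q.ncard ≤ R.ncard := by
  have := S.validators
  exact Set.ncard_le_ncard h (Set.toFinite _)

theorem System.add_ncard_le (S : System N) (Q R : Set N.Validator) :
    Q.ncard + R.ncard ≤ S.n + (Q ∩ R).ncard := by
  have := S.validators
  have := Set.ncard_union_add_ncard_inter Q R (Set.toFinite _) (Set.toFinite _)
  have := S.ncard_le (Q ∪ R)
  omega

theorem System.le_ncard_honest (S : System N) (Q : Set N.Validator) :
    Q.ncard ≤ {W ∈ Q | W ∉ S.byz}.ncard + S.byz.card := by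
  have := S.validators
  have h : Q ⊆ {W ∈ Q | W ∉ S.byz} ∪ S.byz := by
    intro W hW
    by_cases hb : W ∈ S.byz
    · exact .inr hb
    · exact .inl ⟨hW, hb⟩
  have h₁ := S.ncard_mono h
  have h₂ := Set.ncard_union_le {W ∈ Q | W ∉ S.byz} (S.byz : Set N.Validator)
  rw [Set.ncard_coe_finset] at h₂
  omega

theorem System.exists_honest (S : System N) {Q : Set N.Validator} (h : S.f < Q.ncard) :
    ∃ W ∈ Q, W ∉ S.byz := by
  have h₁ := S.le_ncard_honest Q
  have h₂ := S.byz_card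
  have : ({W ∈ Q | W ∉ S.byz} : Set N.Validator).Nonempty := by
    rw [Set.nonempty_iff_ne_empty]
    intro h₃
    rw [h₃, Set.ncard_empty] at h₁
    omega
  exact this

/-- Inclusion-exclusion leaves more than `f` common members. In most applications the sizes are `n -
p` and `n - p - 2f`, and the hypothesis then amounts to `n > 3f + 2p`. -/
theorem System.exists_honest_inter (S : System N) {Q R : Set N.Validator}
    (h : S.n + S.f < Q.ncard + R.ncard) : ∃ W, W ∈ Q ∧ W ∈ R ∧ W ∉ S.byz := by
  have := S.add_ncard_le Q R
  obtain ⟨W, ⟨h₁, h₂⟩, h₃⟩ := S.exists_honest (Q := Q ∩ R) (by omega)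
  exact ⟨W, h₁, h₂, h₃⟩

/-- The honest validators alone form a fast quorum. This is where the assumption that at most `p`
validators are actually Byzantine enters. -/
theorem System.le_ncard_of_honest (S : System N) (hp : S.byz.card ≤ S.p) {Q : Set N.Validator}
    (h : ∀ W, W ∉ S.byz → W ∈ Q) : S.n - S.p ≤ Q.ncard := by
  have h₁ := S.le_ncard_honest Set.univ
  have h₂ := S.ncard_mono (Q := {W ∈ Set.univ | W ∉ S.byz}) (R := Q) fun W hW => h W hW.2
  have h₃ : (Set.univ : Set N.Validator).ncard = S.n := by
    have := S.validators
    rw [Set.ncard_univ, Nat.card_eq_fintype_card]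
    unfold System.n
    congr!
  omega

/-! ### Steps and single fields -/

theorem lockIfFree_apply (t : ℕ → Option (Tx N)) (sn m tx) :
    lockIfFree t sn tx m = if m = sn ∧ t sn = none then some tx else t m := by
  unfold lockIfFree
  by_cases h : t sn = none
  · by_cases hm : m = sn <;> simp [h, hm]
  · simp [h]

theorem lockIfFree_of_eq_some {t : ℕ → Option (Tx N)} {sn m tx tx'} (h : t m = some tx') :
    lockIfFree t sn tx m = some tx' := by
  rw [lockIfFree_apply, if_neg, h]
  rintro ⟨rfl, h'⟩
  simp [h] at h'

theorem lockIfFree_self_ne_none (t : ℕ → Option (Tx N)) (sn tx) :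
    lockIfFree t sn tx sn ≠ none := by
  rw [lockIfFree_apply]
  split_ifs with h
  · simp
  · simpa using h

section

variable {a : Action N} {σ σ' : State S}

/-- FP-locks are never released: every rule that writes to a slot finds it empty or already holding
the same transaction. -/
theorem Step.fpLocked_mono (h : Step a σ σ') {V A sn tx}
    (hf : ((σ.loc V).user A).fpLocked sn = some tx) :
    ((σ'.loc V).user A).fpLocked sn = some tx := by
  have hu := h.userStep V A
  generalize (σ'.loc V).user A = u at hu ⊢
  cases hu <;> try exact hf
  case fpLock =>
    dsimp only
    split_ifs
    · exact lockIfFree_of_eq_some hf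
    · exact hf
  case receiveUA sn' os c s _ _ h₁ =>
    by_cases h₂ : sn = sn'
    · subst h₂; simp_all
    · simp [h₂, hf]
  case receiveUARA sn' b s _ _ _ h₁ =>
    by_cases h₂ : sn = sn'
    · subst h₂; simp_all
    · simp [h₂, hf]

/-- A lock has one of two sources, a message of the user itself or a leader's block that is being
FP-locked. In the second case the signature has been checked, which is what unforgeability needs, as
the block may come from a Byzantine leader. -/
theorem Step.fpLocked (h : Step a σ σ') {V A sn tx}
    (hf : ((σ'.loc V).user A).fpLocked sn = some tx) :
    ((σ.loc V).user A).fpLocked sn = some tx ∨ tx.key = some (A, sn) ∧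
      ((∃ t, (⟨.inr A, V, .tx tx, t⟩ : Packet N) ∈ σ.sent) ∨
        S.verify tx ∧ ∃ X B v, ((σ.loc V).actor X).cur.fp = some (B, v) ∧ tx ∈ B) := by
  have hu := h.userStep V A
  generalize (σ'.loc V).user A = u at hu hf
  cases hu <;> try exact .inl hf
  case fpLock X sn' b s B v hV hB htx =>
    dsimp only at hf
    split_ifs at hf with hv
    · rw [lockIfFree_apply] at hf
      split_ifs at hf with h₁
      · cases hf
        obtain ⟨rfl, -⟩ := h₁
        exact .inr ⟨rfl, .inr ⟨hv, X, B, v, hB, htx⟩⟩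
      · exact .inl hf
    · exact .inl hf
  case receiveUA sn' os c s _ hm h₁ =>
    by_cases h₂ : sn = sn'
    · subst h₂
      simp only [Function.update_self, Option.some.injEq] at hf
      subst hf
      exact .inr ⟨rfl, .inl hm⟩
    · left; simpa [h₂] using hf
  case receiveUARA sn' b s _ hm _ h₁ =>
    by_cases h₂ : sn = sn'
    · subst h₂
      simp only [Function.update_self, Option.some.injEq] at hf
      subst hf
      exact .inr ⟨rfl, .inl hm⟩
    · left; simpa [h₂] using hf

theorem Step.issued_mono (h : Step a σ σ') : σ.issued ⊆ σ'.issued := by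
  rcases h.issued with h | ⟨_, _, _, h, _⟩
  · rw [h.1]
  · rw [h]; exact Set.subset_insert _ _

theorem Step.now_le (h : Step a σ σ') : σ.now ≤ σ'.now := by
  rcases h.now with h | h
  · exact h.ge
  · exact h.1.le

theorem Step.qc_mono (h : Step a σ σ') {X k B} (hB : σ.qc X k = some B) :
    σ'.qc X k = some B := by
  rcases h.qc X k with h | ⟨_, h, _⟩
  · rw [h, hB]
  · simp [hB] at h

theorem Step.ta_mono (h : Step a σ σ') {A sn tx} (hB : σ.ta A sn = some tx) :
    σ'.ta A sn = some tx := by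
  rcases h.ta A sn with h | ⟨_, h, _⟩
  · rw [h, hB]
  · simp [hB] at h

theorem Step.done_mono (h : Step a σ σ') {V A sn tx}
    (hf : ((σ.loc V).user A).done sn = some tx) :
    ((σ'.loc V).user A).done sn = some tx := by
  have hu := h.userStep V A
  generalize (σ'.loc V).user A = u at hu ⊢
  cases hu <;> try exact hf
  case execUA A' sn' os c s _ _ _ h₁ _ =>
    dsimp only
    split_ifs with hA
    · subst hA
      by_cases h₂ : sn = sn'
      · subst h₂; simp_all
      · simp [h₂, hf]
    · exact hf
  case finishUARA A' sn' b s e _ _ h₁ _ =>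
    dsimp only
    split_ifs with hA
    · subst hA
      by_cases h₂ : sn = sn'
      · subst h₂; simp_all
      · simp [h₂, hf]
    · exact hf

end

theorem Run.mono (ρ : Run S) {P : State S → Prop}
    (hP : ∀ i, P (ρ.st i) → P (ρ.st (i + 1))) {i j : ℕ} (hij : i ≤ j)
    (hi : P (ρ.st i)) : P (ρ.st j) := by
  induction j, hij using Nat.le_induction with
  | base => exact hi
  | succ j _ ih => exact hP j ih

theorem Run.now_mono (ρ : Run S) {i j : ℕ} (hij : i ≤ j) : (ρ.st i).now ≤ (ρ.st j).now :=
  ρ.mono (P := fun σ => (ρ.st i).now ≤ σ.now) (fun k h => h.trans (ρ.step k).now_le) hij le_rfl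

theorem Run.sent_mono (ρ : Run S) {i j : ℕ} (hij : i ≤ j) : (ρ.st i).sent ⊆ (ρ.st j).sent :=
  ρ.mono (P := fun σ => (ρ.st i).sent ⊆ σ.sent)
    (fun k h => h.trans (ρ.step k).sent_subset) hij subset_rfl

theorem Run.issued_mono (ρ : Run S) {i j : ℕ} (hij : i ≤ j) :
    (ρ.st i).issued ⊆ (ρ.st j).issued :=
  ρ.mono (P := fun σ => (ρ.st i).issued ⊆ σ.issued)
    (fun k h => h.trans (ρ.step k).issued_mono) hij subset_rfl

theorem Run.done_mono (ρ : Run S) {V A sn tx} {i j : ℕ} (hij : i ≤ j)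
    (h : (((ρ.st i).loc V).user A).done sn = some tx) :
    (((ρ.st j).loc V).user A).done sn = some tx :=
  ρ.mono (P := fun σ => ((σ.loc V).user A).done sn = some tx)
    (fun k h => (ρ.step k).done_mono h) hij h

/-! ### Quorums and locks -/

/-- `V` has FP-locked `tx`. -/
def State.FPLocked (σ : State S) (V : N.Validator) (tx : Tx N) : Prop :=
  ∃ A sn, tx.key = some (A, sn) ∧ ((σ.loc V).user A).fpLocked sn = some tx

/-- The honest members of a set of `m` validators have FP-locked `tx`. -/
def State.Backed (σ : State S) (m : ℕ) (tx : Tx N) : Prop :=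
  ∃ Q : Set N.Validator, m ≤ Q.ncard ∧ ∀ W ∈ Q, W ∉ S.byz → σ.FPLocked W tx

/-- The honest members of a set of `m` validators have voted for `B`. -/
def State.Votes (σ : State S) (m : ℕ) (X : N.Reactive) (k : ℕ) (B : Block N) : Prop :=
  ∃ Q : Set N.Validator, m ≤ Q.ncard ∧ ∀ W ∈ Q, W ∉ S.byz →
    ∃ fb, ∃ q ∈ σ.sent, q.src = Sum.inl W ∧ q.msg = Msg.poaVote X k (some B) fb

/-- `tx` is a transaction to `X`, FP-locked at `V` if it comes from a user. -/
def State.Fit (σ : State S) (V : N.Validator) (X : N.Reactive) (tx : Tx N) : Prop :=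
  tx.receiver = some X ∧ (tx.IsUARA → σ.FPLocked V tx)

/-- `tx` is a transaction to `X`, FP-locked by sufficiently many validators if it comes from a
user. -/
def State.Sound (σ : State S) (X : N.Reactive) (tx : Tx N) : Prop :=
  tx.receiver = some X ∧ (tx.IsUARA → σ.Backed (S.n - S.p - 2 * S.f) tx)

theorem Tx.isUARA_of_receiver {tx : Tx N} {X q} (h : tx.receiver = some X)
    (hk : tx.key = some q) : tx.IsUARA := by
  cases tx with
  | ua => simp [Tx.receiver] at h
  | uara A sn b s => exact ⟨A, sn, b, s, rfl⟩
  | rara => simp [Tx.key] at hk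

section

variable {a : Action N} {σ σ' : State S}

theorem State.FPLocked.step {V} {tx : Tx N} (hf : σ.FPLocked V tx) (h : Step a σ σ') :
    σ'.FPLocked V tx := by
  obtain ⟨A, sn, h₁, h₂⟩ := hf
  exact ⟨A, sn, h₁, h.fpLocked_mono h₂⟩

theorem State.Backed.step {m} {tx : Tx N} (hf : σ.Backed m tx) (h : Step a σ σ') :
    σ'.Backed m tx := by
  obtain ⟨Q, h₁, h₂⟩ := hf
  exact ⟨Q, h₁, fun W hW hb => (h₂ W hW hb).step h⟩

theorem State.Backed.mono {m m'} {tx : Tx N} (hf : σ.Backed m tx) (h : m' ≤ m) :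
    σ.Backed m' tx := by
  obtain ⟨Q, h₁, h₂⟩ := hf
  exact ⟨Q, h.trans h₁, h₂⟩

theorem State.Votes.step {m X k B} (hf : σ.Votes m X k B) (h : Step a σ σ') :
    σ'.Votes m X k B := by
  obtain ⟨Q, h₁, h₂⟩ := hf
  refine ⟨Q, h₁, fun W hW hb => ?_⟩
  obtain ⟨fb, q, h₃, h₄⟩ := h₂ W hW hb
  exact ⟨fb, q, h.sent_subset h₃, h₄⟩

theorem State.Fit.step {V X} {tx : Tx N} (hf : σ.Fit V X tx) (h : Step a σ σ') :
    σ'.Fit V X tx :=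
  ⟨hf.1, fun ht => (hf.2 ht).step h⟩

theorem State.Sound.step {X} {tx : Tx N} (hf : σ.Sound X tx) (h : Step a σ σ') :
    σ'.Sound X tx :=
  ⟨hf.1, fun ht => (hf.2 ht).step h⟩

/-- An honest validator common to both sets has a single FP-lock for the common sender and sequence
number. -/
theorem State.Backed.eq {m m'} {tx tx' : Tx N} {q} (h : σ.Backed m tx) (h' : σ.Backed m' tx')
    (hq : tx.key = some q) (hq' : tx'.key = some q) (hm : S.n + S.f < m + m') : tx = tx' := by
  obtain ⟨Q, h₁, h₂⟩ := h
  obtain ⟨Q', h₁', h₂'⟩ := h'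
  obtain ⟨W, hW, hW', hb⟩ := S.exists_honest_inter (Q := Q) (R := Q') (by omega)
  obtain ⟨A, sn, h₃, h₄⟩ := h₂ W hW hb
  obtain ⟨A', sn', h₃', h₄'⟩ := h₂' W hW' hb
  obtain ⟨rfl, rfl⟩ : A = A' ∧ sn = sn' := by
    rw [hq] at h₃; rw [hq'] at h₃'; simpa using h₃.symm.trans h₃'
  rw [h₄] at h₄'
  simpa using h₄'

theorem State.Backed.exists_honest {m} {tx : Tx N} (h : σ.Backed m tx) (hm : S.f < m) :
    ∃ W, W ∉ S.byz ∧ σ.FPLocked W tx := by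
  obtain ⟨Q, h₁, h₂⟩ := h
  obtain ⟨W, hW, hb⟩ := S.exists_honest (Q := Q) (by omega)
  exact ⟨W, hb, h₂ W hW hb⟩

end

/-! ### Emitted transactions -/

theorem foldl_emitCall_subset (X : N.Reactive) (l : List (CallBody N)) (q tx)
    (h : tx ∈ (l.foldl (emitCall X) q).2) : tx ∈ q.2 ∨ tx.IsRARA := by
  induction l generalizing q with
  | nil => exact .inl h
  | cons b l ih =>
    rw [List.foldl_cons] at h
    rcases ih _ h with h | h
    · unfold emitCall at h
      split_ifs at h
      · rw [Finset.mem_insert] at h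
        rcases h with rfl | h
        · exact .inr ⟨X, b, rfl⟩
        · exact .inl h
      · exact .inl h
    · exact .inr h

theorem isRARA_of_mem_emitted {X : N.Reactive} {r : ActorEntity S} {B : Block N} {tx : Tx N}
    (h : tx ∈ (execBlock X r B).emitted) : tx.IsRARA := by
  unfold execBlock at h
  suffices ∀ (l : List (Tx N)) (e : Exec S), tx ∈ (l.foldl (execTx X) e).emitted →
      tx ∈ e.emitted ∨ tx.IsRARA by
    rcases this _ _ h with h | h
    · simp at h
    · exact h
  intro l
  induction l with
  | nil => exact fun e h => .inl h
  | cons tx' l ih =>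
    intro e h
    rw [List.foldl_cons] at h
    rcases ih _ h with h | h
    · by_cases h₁ : tx' ∈ e.executed
      · rw [execTx, if_pos h₁] at h
        exact .inl h
      · rw [execTx, if_neg h₁] at h
        exact foldl_emitCall_subset _ _ _ _ h
    · exact .inr h

theorem Tx.IsUARA.not_isRARA {tx : Tx N} (h : tx.IsUARA) : ¬ tx.IsRARA := by
  rintro ⟨X, b, rfl⟩
  obtain ⟨A, sn, b, s, h⟩ := h
  cases h

/-! ### Invariants about messages and locks -/

theorem Run.time_le (ρ : Run S) (i : ℕ) : ∀ q ∈ (ρ.st i).sent, q.time ≤ (ρ.st i).now := by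
  induction i with
  | zero => rw [ρ.st_zero]; simp [System.start]
  | succ i ih =>
    intro q hq
    rcases (ρ.step i).sendStep q hq with h | h
    · exact (ih q h).trans (ρ.step i).now_le
    · rw [h.1]; exact (ρ.step i).now_le

theorem Run.sent_of_inbox (ρ : Run S) (i : ℕ) {V src m} :
    (src, m) ∈ ((ρ.st i).loc V).inbox → ∃ t, (⟨src, V, m, t⟩ : Packet N) ∈ (ρ.st i).sent := by
  induction i with
  | zero => rw [ρ.st_zero]; simp [System.start]
  | succ i ih =>
    intro h
    rcases (ρ.step i).inbox V with h₁ | ⟨src', m', -, ⟨t, h₁⟩, h₂⟩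
    · rw [h₁] at h
      obtain ⟨t, ht⟩ := ih h
      exact ⟨t, (ρ.step i).sent_subset ht⟩
    · rw [h₂] at h
      rcases h with h | h
      · cases h
        exact ⟨t, (ρ.step i).sent_subset h₁⟩
      · obtain ⟨t, ht⟩ := ih h
        exact ⟨t, (ρ.step i).sent_subset ht⟩

theorem Run.fpLocked_key (ρ : Run S) (i : ℕ) {V A sn tx} :
    (((ρ.st i).loc V).user A).fpLocked sn = some tx → tx.key = some (A, sn) := by
  induction i with
  | zero => rw [ρ.st_zero]; simp [System.start]
  | succ i ih =>
    intro h
    rcases (ρ.step i).fpLocked h with h | h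
    · exact ih h
    · exact h.1

theorem Run.awaiting (ρ : Run S) (i : ℕ) {V A tx} :
    tx ∈ (((ρ.st i).loc V).user A).awaiting →
      S.verify tx ∧ (ρ.st i).FPLocked V tx ∧ ∃ sn b s, tx = .uara A sn b s := by
  induction i with
  | zero => rw [ρ.st_zero]; simp [System.start]
  | succ i ih =>
    intro h
    have hu := (ρ.step i).userStep V A
    suffices tx ∈ (((ρ.st i).loc V).user A).awaiting ∨ S.verify tx ∧
        (ρ.st (i + 1)).FPLocked V tx ∧ ∃ sn b s, tx = .uara A sn b s by
      rcases this with h | h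
      · exact ⟨(ih h).1, (ih h).2.1.step (ρ.step i), (ih h).2.2⟩
      · exact h
    unfold State.FPLocked
    generalize ha : ρ.act i = a at hu
    generalize hu' : ((ρ.st (i + 1)).loc V).user A = u at hu h
    cases hu <;> try exact .inl h
    case offer => exact .inl h.1
    case receiveUARA sn b s _ _ hv _ =>
      rcases h with rfl | h
      · exact .inr ⟨hv, ⟨A, sn, rfl, by simp [hu']⟩, sn, b, s, rfl⟩
      · exact .inl h

/-- A UA-RA transaction enters a pool only from `awaiting`, after verification and FP-locking;
everything else in a pool was emitted by a block and is an RA-RA transaction. -/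
theorem Run.pool (ρ : Run S) (i : ℕ) {V X tx} :
    tx ∈ (((ρ.st i).loc V).actor X).pool →
      (ρ.st i).Fit V X tx ∧ (tx.IsUARA → S.verify tx) := by
  induction i with
  | zero => rw [ρ.st_zero]; simp [System.start]
  | succ i ih =>
    intro h
    have hu := (ρ.step i).actorStep V X
    suffices tx ∈ (((ρ.st i).loc V).actor X).pool ∨ (∃ A, tx.receiver = some X ∧
        tx ∈ (((ρ.st i).loc V).user A).awaiting) ∨ (∃ Y B, tx.receiver = some X ∧
        tx ∈ (execBlock Y (((ρ.st i).loc V).actor Y) B).emitted) by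
      rcases this with h | ⟨A, hX, h⟩ | ⟨Y, B, hX, h⟩
      · exact ⟨(ih h).1.step (ρ.step i), (ih h).2⟩
      · have := ρ.awaiting i h
        exact ⟨⟨hX, fun _ => this.2.1.step (ρ.step i)⟩, fun _ => this.1⟩
      · have := isRARA_of_mem_emitted h
        exact ⟨⟨hX, fun h => absurd this h.not_isRARA⟩, fun h => absurd this h.not_isRARA⟩
    generalize ((ρ.st (i + 1)).loc V).actor X = u at hu h
    generalize ρ.act i = a at hu
    cases hu <;> try exact .inl h
    case offer A sn b s hX _ haw hr =>
      subst hX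
      dsimp only at h
      split_ifs at h
      · exact .inl h
      · rw [Finset.mem_insert] at h
        rcases h with rfl | h
        · exact .inr (.inl ⟨A, rfl, haw⟩)
        · exact .inl h
    case poaDecide B _ _ =>
      simp only [Finset.mem_union, Finset.mem_sdiff, Finset.mem_filter] at h
      rcases h with h | h
      · exact .inl h.1
      · exact .inr (.inr ⟨X, B, h.2.1, h.1⟩)
    case poaDecideOther Y B _ _ =>
      simp only [Finset.mem_union, Finset.mem_filter] at h
      rcases h with h | h
      · exact .inl h
      · exact .inr (.inr ⟨Y, B, h.2.1, h.1⟩)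

/-- The inequality `t ≤ v` between the sending of the proposal and the beginning of FP-locking later
shows that the delay `Δ` granted for FP-locking has not run out. -/
theorem Run.fp (ρ : Run S) (i : ℕ) {V X B v} :
    (((ρ.st i).loc V).actor X).cur.fp = some (B, v) →
      (∀ tx ∈ B, tx.receiver = some X) ∧ v ≤ (ρ.st i).now ∧ ∃ t ≤ v,
        (⟨.inl (S.leader X (((ρ.st i).loc V).actor X).inst), V,
          .proposal X (((ρ.st i).loc V).actor X).inst B, t⟩ : Packet N) ∈ (ρ.st i).sent := by
  induction i with
  | zero => rw [ρ.st_zero]; simp [System.start, Attempt.fresh]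
  | succ i ih =>
    intro h
    have hs := (ρ.step i).sent_subset
    have hn := (ρ.step i).now_le
    have ih' : (((ρ.st i).loc V).actor X).cur.fp = some (B, v) →
      (∀ tx ∈ B, tx.receiver = some X) ∧ v ≤ (ρ.st (i + 1)).now ∧ ∃ t ≤ v,
        (⟨.inl (S.leader X (((ρ.st i).loc V).actor X).inst), V,
          .proposal X (((ρ.st i).loc V).actor X).inst B, t⟩ : Packet N) ∈
            (ρ.st (i + 1)).sent := fun h =>
      ⟨(ih h).1, (ih h).2.1.trans hn, let ⟨t, h₁, h₂⟩ := (ih h).2.2; ⟨t, h₁, hs h₂⟩⟩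
    have hu := (ρ.step i).actorStep V X
    generalize ((ρ.st (i + 1)).loc V).actor X = u at hu h ⊢
    generalize ρ.act i = a at hu
    cases hu <;> try exact ih' h
    case fpBegin B' _ _ hm hX =>
      simp only [Option.some.injEq, Prod.mk.injEq] at h
      obtain ⟨rfl, rfl⟩ := h
      obtain ⟨t, ht⟩ := ρ.sent_of_inbox i hm
      exact ⟨hX, hn, t, ρ.time_le i _ ht, hs ht⟩
    case poaDecide => simp [Attempt.fresh] at h

theorem Run.fpReply_true (ρ : Run S) (i : ℕ) {V X tx} :
    (((ρ.st i).loc V).actor X).cur.fpReply tx = some true →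
      S.verify tx ∧ (ρ.st i).FPLocked V tx := by
  induction i with
  | zero => rw [ρ.st_zero]; simp [System.start, Attempt.fresh]
  | succ i ih =>
    intro h
    suffices (((ρ.st i).loc V).actor X).cur.fpReply tx = some true ∨
        S.verify tx ∧ (ρ.st i).FPLocked V tx by
      rcases this with h | h
      · exact ⟨(ih h).1, (ih h).2.step (ρ.step i)⟩
      · exact ⟨h.1, h.2.step (ρ.step i)⟩
    have hu := (ρ.step i).actorStep V X
    generalize ((ρ.st (i + 1)).loc V).actor X = u at hu h
    generalize ρ.act i = a at hu
    cases hu <;> try exact .inl h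
    case fpReply A sn b s ok B v _ _ _ ht _ _ =>
      by_cases htx : tx = .uara A sn b s
      · subst htx
        simp only [Function.update_self, Option.some.injEq] at h
        exact .inr ⟨(ht h).1, A, sn, rfl, (ht h).2⟩
      · left; simpa [htx] using h
    case poaDecide => simp [Attempt.fresh] at h

/-- A vote for a block requires a positive reply, hence an FP-lock, for each of its UA-RA
transactions; the fallback block is the voter's pool, whose UA-RA transactions are FP-locked as
well. -/
theorem Run.vote_fit (ρ : Run S) (i : ℕ) {q : Packet N} {W X k v fb}
    (hq : q ∈ (ρ.st i).sent) (hW : q.src = .inl W) (hb : W ∉ S.byz)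
    (hm : q.msg = .poaVote X k v fb) :
    (∀ B, v = some B → ∀ tx ∈ B, (ρ.st i).Fit W X tx) ∧ ∀ tx ∈ fb, (ρ.st i).Fit W X tx := by
  induction i with
  | zero => rw [ρ.st_zero] at hq; simp [System.start] at hq
  | succ i ih =>
    suffices q ∈ (ρ.st i).sent ∨ ((∀ B, v = some B → ∀ tx ∈ B, (ρ.st i).Fit W X tx) ∧
        ∀ tx ∈ fb, (ρ.st i).Fit W X tx) by
      have : (∀ B, v = some B → ∀ tx ∈ B, (ρ.st i).Fit W X tx) ∧
        ∀ tx ∈ fb, (ρ.st i).Fit W X tx := this.elim ih id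
      exact ⟨fun B hB tx htx => (this.1 B hB tx htx).step (ρ.step i),
        fun tx htx => (this.2 tx htx).step (ρ.step i)⟩
    rcases (ρ.step i).sendStep q hq with h | ⟨-, h⟩
    · exact .inl h
    · right
      rw [hW, hm] at h
      generalize hv : v = v' at h
      generalize ρ.act i = a at h
      cases h
      case vote B v hV hn hf hr =>
        refine ⟨fun B' hB' tx htx => ?_, fun tx htx => (ρ.pool i htx).1⟩
        split_ifs at hB' with hall
        cases hB'
        exact ⟨(ρ.fp i hf).1 tx htx, fun hu => (ρ.fpReply_true i (hall tx htx hu)).2⟩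
      case adversary hs _ _ _ => exact absurd hs hb

theorem Run.pobVote_fpLocked (ρ : Run S) (i : ℕ) {q : Packet N} {W A sn tx}
    (hq : q ∈ (ρ.st i).sent) (hW : q.src = .inl W) (hb : W ∉ S.byz)
    (hm : q.msg = .pobVote A sn (some tx)) : (ρ.st i).FPLocked W tx := by
  induction i with
  | zero => rw [ρ.st_zero] at hq; simp [System.start] at hq
  | succ i ih =>
    rcases (ρ.step i).sendStep q hq with h | ⟨-, h⟩
    · exact (ih h).step (ρ.step i)
    · rw [hW, hm] at h
      generalize ha : ρ.act i = a at h
      cases h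
      case pobVote os c s hV hsent hf =>
        have hst := ρ.step i
        rw [ha] at hst
        obtain ⟨_, _, _, h⟩ := hst
        refine ⟨A, sn, rfl, ?_⟩
        -- Storing the message does not touch `V.A`, so the guard in `State.react` is evaluated on
        -- the old lock table.
        have h₁ : (((ρ.st i).setLocal W { (ρ.st i).loc W with
          inbox := insert (Sum.inr A, Msg.tx (.ua A sn os c s)) ((ρ.st i).loc W).inbox }).loc
            W).user A = ((ρ.st i).loc W).user A := by simp [State.setLocal_loc]
        simp only [State.react] at h
        rw [h₁] at h
        rw [h]
        simp [hf, State.setLocal_loc, Local.setUser_user]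
      case adversary hs _ _ _ => exact absurd hs hb

theorem Run.votes_of_inbox (ρ : Run S) (i : ℕ) {V X k B m}
    (h : m ≤ (((ρ.st i).loc V).poaVoters X k (some B)).ncard) : (ρ.st i).Votes m X k B := by
  refine ⟨_, h, fun W hW _ => ?_⟩
  obtain ⟨fb, hfb⟩ := hW
  obtain ⟨t, ht⟩ := ρ.sent_of_inbox i hfb
  exact ⟨fb, _, ht, rfl, rfl⟩

theorem Run.backed_of_votes (ρ : Run S) (i : ℕ) {X k B m} (h : (ρ.st i).Votes m X k B)
    (hm : S.f < m) {tx} (htx : tx ∈ B) :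
    tx.receiver = some X ∧ (tx.IsUARA → (ρ.st i).Backed m tx) := by
  obtain ⟨Q, h₁, h₂⟩ := h
  have h₃ : ∀ W ∈ Q, W ∉ S.byz → (ρ.st i).Fit W X tx := by
    intro W hW hb
    obtain ⟨fb, q, hq, hs, hm⟩ := h₂ W hW hb
    exact (ρ.vote_fit i hq hs hb hm).1 B rfl tx htx
  obtain ⟨W, hW, hb⟩ := S.exists_honest (Q := Q) (by omega)
  exact ⟨(h₃ W hW hb).1, fun hu => ⟨Q, h₁, fun W hW hb => (h₃ W hW hb).2 hu⟩⟩

theorem Run.sound_of_votes (ρ : Run S) (i : ℕ) {X k B}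
    (h : (ρ.st i).Votes (S.n - S.p - 2 * S.f) X k B) {tx} (htx : tx ∈ B) :
    (ρ.st i).Sound X tx :=
  ρ.backed_of_votes i h (by have := S.size'; omega) htx

/-- The `n - 2f` owners of the fallback blocks are at least as many as required, and more than `f`,
so one of them is honest and vouches for the receiver. -/
theorem Run.sound_of_fallback (ρ : Run S) (i : ℕ) {V X k tx}
    (h : S.n - 2 * S.f ≤ (((ρ.st i).loc V).fallbackVoters X k tx).ncard) :
    (ρ.st i).Sound X tx := by
  have h₃ : ∀ W ∈ ((ρ.st i).loc V).fallbackVoters X k tx, W ∉ S.byz →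
      (ρ.st i).Fit W X tx := by
    rintro W ⟨v, fb, h, htx⟩ hb
    obtain ⟨t, ht⟩ := ρ.sent_of_inbox i h
    exact (ρ.vote_fit i ht rfl hb rfl).2 tx htx
  obtain ⟨W, hW, hb⟩ := S.exists_honest (Q := ((ρ.st i).loc V).fallbackVoters X k tx)
    (by have := S.size'; omega)
  exact ⟨(h₃ W hW hb).1, fun hu => ⟨_, le_trans (by omega) h, fun W hW hb => (h₃ W hW hb).2 hu⟩⟩

/-- The block that is being treated in the slow path. -/
def SlowPhase.block : SlowPhase N → Block N
  | .idle => ∅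
  | .candidate B _ => B
  | .fallback B _ => B
  | .proposed => ∅

/-- A block is taken up in the slow path only on `n - p - 2f` votes, or transaction by transaction
on `n - 2f` fallback blocks. -/
theorem Run.slow_sound (ρ : Run S) (i : ℕ) {V X tx} :
    tx ∈ (((ρ.st i).loc V).actor X).cur.slow.block → (ρ.st i).Sound X tx := by
  induction i with
  | zero => rw [ρ.st_zero]; simp [System.start, Attempt.fresh, SlowPhase.block]
  | succ i ih =>
    intro h
    suffices tx ∈ (((ρ.st i).loc V).actor X).cur.slow.block ∨ (ρ.st i).Sound X tx by
      exact (this.elim ih id).step (ρ.step i)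
    have hu := (ρ.step i).actorStep V X
    generalize ((ρ.st (i + 1)).loc V).actor X = u at hu h
    generalize ρ.act i = a at hu
    cases hu <;> try exact .inl h
    case slowCandidate B _ _ hq => exact .inr (ρ.sound_of_votes i (ρ.votes_of_inbox i hq) h)
    case slowFallback T _ _ hT => exact .inr (ρ.sound_of_fallback i ((hT tx).1 h))
    case spCandidate hs => left; rw [hs]; exact h
    case spFallback hs => left; rw [hs]; exact h
    case qcPropose => simp [SlowPhase.block] at h
    case poaDecide => simp [SlowPhase.block, Attempt.fresh] at h

theorem Run.qcProposed_sound (ρ : Run S) (i : ℕ) {V X k P tx} :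
    (((ρ.st i).loc V).actor X).qcProposed k = some P → tx ∈ P → (ρ.st i).Sound X tx := by
  induction i with
  | zero => rw [ρ.st_zero]; simp [System.start]
  | succ i ih =>
    intro h htx
    suffices (((ρ.st i).loc V).actor X).qcProposed k = some P ∨ (ρ.st i).Sound X tx by
      exact (this.elim (ih · htx) id).step (ρ.step i)
    have hu := (ρ.step i).actorStep V X
    generalize ((ρ.st (i + 1)).loc V).actor X = u at hu h
    generalize ρ.act i = a at hu
    cases hu <;> try exact .inl h
    case qcPropose B tried P' _ hs =>
      by_cases hk : k = (((ρ.st i).loc V).actor X).inst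
      · subst hk
        simp only [Function.update_self, Option.some.injEq] at h
        subst h
        right
        rcases hs with ⟨hs, rfl⟩ | ⟨hs, rfl⟩
        · exact ρ.slow_sound i (by rw [hs]; exact htx)
        · exact ρ.slow_sound i (by rw [hs]; exact (Finset.mem_filter.1 htx).1)
      · left; simpa [hk] using h

/-- Since `n - 3f > 0`, each transaction of the decided block stems from some honest proposal. -/
theorem Run.qc_sound (ρ : Run S) (i : ℕ) {X k B tx} :
    (ρ.st i).qc X k = some B → tx ∈ B → (ρ.st i).Sound X tx := by
  induction i with
  | zero => rw [ρ.st_zero]; simp [System.start]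
  | succ i ih =>
    intro h htx
    rcases (ρ.step i).qc X k with h₁ | ⟨B', -, h₁, h₂⟩
    · exact (ih (h₁ ▸ h) htx).step (ρ.step i)
    · rw [h₂, Option.some.injEq] at h
      subst h
      have h₃ := h₁.2 tx htx
      have : Set.Nonempty {V | V ∉ S.byz ∧ ∃ P,
          (((ρ.st i).loc V).actor X).qcProposed k = some P ∧ tx ∈ P} := by
        rw [Set.nonempty_iff_ne_empty]
        intro h₄
        rw [h₄, Set.ncard_empty] at h₃
        have := S.size'
        omega
      obtain ⟨V, -, P, hP, htx⟩ := this
      exact (ρ.qcProposed_sound i hP htx).step (ρ.step i)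

theorem Run.qcDecided (ρ : Run S) (i : ℕ) {V X B} :
    (((ρ.st i).loc V).actor X).cur.qcDecided = some B →
      (ρ.st i).qc X (((ρ.st i).loc V).actor X).inst = some B := by
  induction i with
  | zero => rw [ρ.st_zero]; simp [System.start, Attempt.fresh]
  | succ i ih =>
    intro h
    have hu := (ρ.step i).actorStep V X
    have hm := fun X k B => (ρ.step i).qc_mono (X := X) (k := k) (B := B)
    generalize ((ρ.st (i + 1)).loc V).actor X = u at hu h ⊢
    generalize ρ.act i = a at hu
    cases hu <;> try exact hm _ _ _ (ih h)
    case qcDecide => exact hm _ _ _ h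
    case poaDecide => simp [Attempt.fresh] at h

/-- Each way of obtaining an SP-lock starts from a transaction backed by `n - p - 2f` validators: it
lies in a block treated in the slow path, in a block decided by Quorum Consensus, or has that many
votes in Parallel Optimistic Broadcast. -/
theorem Run.spLocked (ρ : Run S) (i : ℕ) {V A sn tx} :
    (((ρ.st i).loc V).user A).spLocked sn = some tx →
      tx.key = some (A, sn) ∧ (ρ.st i).Backed (S.n - S.p - 2 * S.f) tx := by
  induction i with
  | zero => rw [ρ.st_zero]; simp [System.start]
  | succ i ih =>
    intro h
    suffices (((ρ.st i).loc V).user A).spLocked sn = some tx ∨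
        tx.key = some (A, sn) ∧ (ρ.st i).Backed (S.n - S.p - 2 * S.f) tx by
      have := this.elim ih id
      exact ⟨this.1, this.2.step (ρ.step i)⟩
    have hu := (ρ.step i).userStep V A
    generalize ((ρ.st (i + 1)).loc V).user A = u at hu h
    generalize ρ.act i = a at hu
    cases hu <;> try exact .inl h
    case spLock X sn' b s B tried _ htx hs =>
      dsimp only at h
      rw [lockIfFree_apply] at h
      split_ifs at h with h₁
      · cases h
        obtain ⟨rfl, -⟩ := h₁
        refine .inr ⟨rfl, (ρ.slow_sound i (V := V) (X := X) ?_).2 ⟨_, _, _, _, rfl⟩⟩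
        rcases hs with hs | hs <;> rw [hs] <;> exact htx
      · exact .inl h
    case taInitiate X sn' b s B _ hB htx =>
      dsimp only at h
      rw [lockIfFree_apply] at h
      split_ifs at h with h₁
      · cases h
        obtain ⟨rfl, -⟩ := h₁
        exact .inr ⟨rfl, (ρ.qc_sound i (ρ.qcDecided i hB) htx).2 ⟨_, _, _, _, rfl⟩⟩
      · exact .inl h
    case pobSlow sn' os c s _ hq _ =>
      by_cases h₁ : sn = sn'
      · subst h₁
        simp only [Function.update_self, Option.some.injEq] at h
        subst h
        refine .inr ⟨rfl, _, hq, fun W hW hb => ?_⟩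
        obtain ⟨t, ht⟩ := ρ.sent_of_inbox i hW
        exact ρ.pobVote_fpLocked i ht rfl hb rfl
      · left; simpa [h₁] using h

theorem Run.taProposed (ρ : Run S) (i : ℕ) {V A sn tx} :
    (((ρ.st i).loc V).user A).taProposed sn = some tx →
      tx.key = some (A, sn) ∧ (ρ.st i).Backed (S.n - S.p - 2 * S.f) tx := by
  induction i with
  | zero => rw [ρ.st_zero]; simp [System.start]
  | succ i ih =>
    intro h
    -- The SP-lock is looked up after the step, because the step that makes the proposal may also
    -- set the lock.
    suffices (((ρ.st i).loc V).user A).taProposed sn = some tx ∨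
        (((ρ.st (i + 1)).loc V).user A).spLocked sn = some tx by
      rcases this with h | h
      · exact ⟨(ih h).1, (ih h).2.step (ρ.step i)⟩
      · exact ρ.spLocked (i + 1) h
    have hu := (ρ.step i).userStep V A
    generalize ((ρ.st (i + 1)).loc V).user A = u at hu h ⊢
    generalize ρ.act i = a at hu
    cases hu <;> try exact .inl h
    case taInitiate X sn' b s B _ hB htx =>
      dsimp only at h ⊢
      split_ifs at h with h₂
      · by_cases h₁ : sn = sn'
        · subst h₁; right; simpa using h
        · left; simpa [h₁] using h
      · exact .inl h
    case pobSlow sn' os c s _ hq _ =>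
      by_cases h₁ : sn = sn'
      · subst h₁; right; simpa using h
      · left; simpa [h₁] using h

/-- Some honest validator proposed the outcome, as `n - 3f > 0`, and honest validators propose only
what they have SP-locked. -/
theorem Run.ta_sound (ρ : Run S) (i : ℕ) {A sn tx} :
    (ρ.st i).ta A sn = some tx →
      tx.key = some (A, sn) ∧ (ρ.st i).Backed (S.n - S.p - 2 * S.f) tx := by
  induction i with
  | zero => rw [ρ.st_zero]; simp [System.start]
  | succ i ih =>
    intro h
    rcases (ρ.step i).ta A sn with h₁ | ⟨B', -, h₁, h₂⟩
    · rw [h₁] at h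
      exact ⟨(ih h).1, (ih h).2.step (ρ.step i)⟩
    · rw [h₂, Option.some.injEq] at h
      subst h
      have : Set.Nonempty {V | V ∉ S.byz ∧
          (((ρ.st i).loc V).user A).taProposed sn = some B'} := by
        rw [Set.nonempty_iff_ne_empty]
        intro h₄
        rw [h₄, Set.ncard_empty] at h₁
        have := S.size'
        omega
      obtain ⟨V, -, hV⟩ := this
      exact ⟨(ρ.taProposed i hV).1, (ρ.taProposed i hV).2.step (ρ.step i)⟩

theorem Run.taDecided (ρ : Run S) (i : ℕ) {V A sn tx} :
    (((ρ.st i).loc V).user A).taDecided sn = some tx → (ρ.st i).ta A sn = some tx := by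
  induction i with
  | zero => rw [ρ.st_zero]; simp [System.start]
  | succ i ih =>
    intro h
    suffices (((ρ.st i).loc V).user A).taDecided sn = some tx ∨ (ρ.st i).ta A sn = some tx by
      exact (ρ.step i).ta_mono (this.elim ih id)
    have hu := (ρ.step i).userStep V A
    generalize ((ρ.st (i + 1)).loc V).user A = u at hu h
    generalize ρ.act i = a at hu
    cases hu <;> try exact .inl h
    case taDecide sn' _ _ =>
      by_cases h₁ : sn = sn'
      · subst h₁; right; simpa using h
      · left; simpa [h₁] using h

/-! ### Conflicts between fast decisions, slow decisions and competing transactions. -/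

/-- `tx` wins the competition for its sequence number: it is FP-locked by a fast quorum or decided
in Transaction Agreement. -/
def State.Confirmed (σ : State S) (tx : Tx N) : Prop :=
  σ.Backed (S.n - S.p) tx ∨ ∃ A sn, tx.key = some (A, sn) ∧ σ.ta A sn = some tx

/-- A stable witness for the fact that no block is decided by votes in instance `k` of the POA of
`X`. -/
def State.NoFast (σ : State S) (X : N.Reactive) (k : ℕ) : Prop :=
  (∃ (R : Set N.Validator) (w : N.Validator → Option (Block N)), S.n - S.f ≤ R.ncard ∧
    (∀ W ∈ R, W ∉ S.byz → ∃ fb, ∃ q ∈ σ.sent, q.src = Sum.inl W ∧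
      q.msg = Msg.poaVote X k (w W) fb) ∧
    ∀ B, {W ∈ R | W ∉ S.byz ∧ w W = some B}.ncard < S.n - S.p - 2 * S.f) ∨
  ∃ B tx tx' q, σ.Votes (S.n - S.p - 2 * S.f) X k B ∧ tx ∈ B ∧ tx.IsUARA ∧
    tx.key = some q ∧ tx'.key = some q ∧ tx ≠ tx' ∧ σ.Backed (S.n - S.p - 2 * S.f) tx'

section

variable {a : Action N} {σ σ' : State S}

theorem State.Confirmed.step {tx : Tx N} (hf : σ.Confirmed tx) (h : Step a σ σ') :
    σ'.Confirmed tx :=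
  hf.imp (·.step h) fun ⟨A, sn, h₁, h₂⟩ => ⟨A, sn, h₁, h.ta_mono h₂⟩

theorem State.NoFast.step {X k} (hf : σ.NoFast X k) (h : Step a σ σ') : σ'.NoFast X k := by
  rcases hf with ⟨R, w, h₁, h₂, h₃⟩ | ⟨B, tx, tx', q, h₁, h₂, h₃, h₄, h₅, h₆, h₇⟩
  · refine .inl ⟨R, w, h₁, fun W hW hb => ?_, h₃⟩
    obtain ⟨fb, q, hq, h₄⟩ := h₂ W hW hb
    exact ⟨fb, q, h.sent_subset hq, h₄⟩
  · exact .inr ⟨B, tx, tx', q, h₁.step h, h₂, h₃, h₄, h₅, h₆, h₇.step h⟩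

/-- A slow result requires the Transaction Agreement of every UA-RA transaction in the block to be
decided. These outcomes are final, so the result does not change any more. -/
theorem State.PoaCert.step {X k B} (hf : σ.PoaCert X k B) (h : Step a σ σ') :
    σ'.PoaCert X k B := by
  rcases hf with hf | ⟨Bqc, h₁, h₂, h₃⟩
  · exact .inl (State.Votes.step (m := S.n - S.p) hf h)
  · have hta : ∀ A sn b s, Tx.uara A sn b s ∈ Bqc → σ'.ta A sn = σ.ta A sn := by
      intro A sn b s hm
      obtain ⟨tx, htx⟩ := Option.ne_none_iff_exists'.1 (h₂ A sn b s hm)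
      rw [htx, h.ta_mono htx]
    refine .inr ⟨Bqc, h.qc_mono h₁, fun A sn b s hm => ?_, fun tx => ?_⟩
    · rw [hta A sn b s hm]; exact h₂ A sn b s hm
    · rw [h₃]
      refine and_congr_right fun hm => forall_congr' fun A => forall_congr' fun sn =>
        forall_congr' fun b => forall_congr' fun s => ?_
      refine forall_congr' fun he => ?_
      subst he
      rw [hta A sn b s hm]

theorem State.PobCert.step {tx : Tx N} (hf : σ.PobCert tx) (h : Step a σ σ') :
    σ'.PobCert tx := by
  obtain ⟨A, sn, h₁, h₂⟩ := hf
  refine ⟨A, sn, h₁, h₂.imp (fun ⟨Q, h₃, h₄⟩ => ⟨Q, h₃, fun W hW hb => ?_⟩) h.ta_mono⟩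
  obtain ⟨q, hq, h₅⟩ := h₄ W hW hb
  exact ⟨q, h.sent_subset hq, h₅⟩

theorem Step.inst (h : Step a σ σ') (V X) :
    ((σ'.loc V).actor X).inst = ((σ.loc V).actor X).inst ∧
      (((σ.loc V).actor X).cur.voted → ((σ'.loc V).actor X).cur.voted) ∨
    ((σ'.loc V).actor X).inst = ((σ.loc V).actor X).inst + 1 ∧
      ∃ B, a = .internal V (.poaDecide X B) := by
  have hu := h.actorStep V X
  generalize (σ'.loc V).actor X = u at hu ⊢
  cases hu <;> try exact .inl ⟨rfl, id⟩
  case vote => exact .inl ⟨rfl, fun _ => trivial⟩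
  case poaDecide B _ _ => exact .inr ⟨rfl, B, rfl⟩

theorem Step.spLocked_mono (h : Step a σ σ') {V A sn tx}
    (hf : ((σ.loc V).user A).spLocked sn = some tx) :
    ((σ'.loc V).user A).spLocked sn = some tx := by
  have hu := h.userStep V A
  generalize (σ'.loc V).user A = u at hu ⊢
  cases hu <;> try exact hf
  case spLock => exact lockIfFree_of_eq_some hf
  case taInitiate => exact lockIfFree_of_eq_some hf
  case pobSlow sn' os c s _ _ h₁ =>
    by_cases h₂ : sn = sn'
    · subst h₂; simp_all
    · simp [h₂, hf]

theorem SendStep.vote_inv {src X k v fb W} (h : SendStep σ a src (.poaVote X k v fb))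
    (hs : src = .inl W) (hb : W ∉ S.byz) :
    a = .internal W (.vote X) ∧ k = ((σ.loc W).actor X).inst ∧
      ¬ ((σ.loc W).actor X).cur.voted ∧ fb = ((σ.loc W).actor X).pool ∧
      ∃ B t, ((σ.loc W).actor X).cur.fp = some (B, t) ∧
        (∀ tx ∈ B, tx.IsUARA → ((σ.loc W).actor X).cur.fpReply tx ≠ none) ∧
        v = if ∀ tx ∈ B, tx.IsUARA → ((σ.loc W).actor X).cur.fpReply tx = some true then some B
          else none := by
  generalize v = v' at h
  cases h
  case vote V B t hV hn hf hr =>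
    cases hs
    exact ⟨rfl, rfl, hn, rfl, B, t, hf, hr, rfl⟩
  case adversary hs' _ _ _ => subst hs; exact absurd hs' hb

end

/-- A vote leaves a permanent trace at an honest sender: the flag `voted` remains set until the
instance counter has moved on. -/
theorem Run.vote_inst (ρ : Run S) (i : ℕ) {q : Packet N} {W X k v fb}
    (hq : q ∈ (ρ.st i).sent) (hW : q.src = .inl W) (hb : W ∉ S.byz)
    (hm : q.msg = .poaVote X k v fb) :
    k < (((ρ.st i).loc W).actor X).inst ∨
      k = (((ρ.st i).loc W).actor X).inst ∧ (((ρ.st i).loc W).actor X).cur.voted := by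
  induction i with
  | zero => rw [ρ.st_zero] at hq; simp [System.start] at hq
  | succ i ih =>
    rcases (ρ.step i).sendStep q hq with h | ⟨-, h⟩
    · have h₁ := ih h
      rcases (ρ.step i).inst W X with ⟨h₂, h₃⟩ | ⟨h₂, -⟩
      · rw [h₂]; exact h₁.imp_right (And.imp_right h₃)
      · left; omega
    · rw [hm] at h
      obtain ⟨ha, h₁, -⟩ := h.vote_inv hW hb
      have hu := (ρ.step i).actorStep W X
      rw [ha] at hu
      generalize ((ρ.st (i + 1)).loc W).actor X = u at hu ⊢
      cases hu
      case refl h => exact absurd rfl (h _ rfl)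
      case vote => exact .inr ⟨h₁, trivial⟩

/-- A later vote in the same instance is excluded by the trace that the first one leaves,
`Run.vote_inst`; two votes sent in the same step are computed from the same state. -/
theorem Run.vote_unique (ρ : Run S) (i : ℕ) {q q' : Packet N} {W X k v fb v' fb'}
    (hq : q ∈ (ρ.st i).sent) (hq' : q' ∈ (ρ.st i).sent) (hW : q.src = .inl W)
    (hW' : q'.src = .inl W) (hb : W ∉ S.byz) (hm : q.msg = .poaVote X k v fb)
    (hm' : q'.msg = .poaVote X k v' fb') : v = v' := by
  induction i with
  | zero => rw [ρ.st_zero] at hq; simp [System.start] at hq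
  | succ i ih =>
    have key : ∀ {q q' : Packet N} {v v' fb fb'}, q ∈ (ρ.st i).sent → q.src = .inl W →
        q.msg = .poaVote X k v fb → q'.src = .inl W → q'.msg = .poaVote X k v' fb' →
        SendStep (ρ.st i) (ρ.act i) q'.src q'.msg → False := by
      intro q q' v v' fb fb' h₁ h₂ h₃ h₄ h₅ h₆
      rw [h₅] at h₆
      obtain ⟨-, h₇, h₈, -⟩ := h₆.vote_inv h₄ hb
      rcases ρ.vote_inst i h₁ h₂ hb h₃ with h₉ | h₉
      · omega
      · exact h₈ h₉.2
    rcases (ρ.step i).sendStep q hq with h | ⟨-, h⟩ <;>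
      rcases (ρ.step i).sendStep q' hq' with h' | ⟨-, h'⟩
    · exact ih h h'
    · exact (key h hW hm hW' hm' h').elim
    · exact (key h' hW' hm' hW hm h).elim
    · rw [hm] at h
      rw [hm'] at h'
      obtain ⟨-, -, -, -, B, t, h₁, -, h₂⟩ := h.vote_inv hW hb
      obtain ⟨-, -, -, -, B', t', h₁', -, h₂'⟩ := h'.vote_inv hW' hb
      rw [h₁] at h₁'
      cases h₁'
      rw [h₂, h₂']

theorem Run.votes_eq (ρ : Run S) (i : ℕ) {m m' X k B B'} (h : (ρ.st i).Votes m X k B)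
    (h' : (ρ.st i).Votes m' X k B') (hm : S.n + S.f < m + m') : B = B' := by
  obtain ⟨Q, h₁, h₂⟩ := h
  obtain ⟨Q', h₁', h₂'⟩ := h'
  obtain ⟨W, hW, hW', hb⟩ := S.exists_honest_inter (Q := Q) (R := Q') (by omega)
  obtain ⟨fb, q, h₃, h₄, h₅⟩ := h₂ W hW hb
  obtain ⟨fb', q', h₃', h₄', h₅'⟩ := h₂' W hW' hb
  simpa using ρ.vote_unique i h₃ h₃' h₄ h₄' hb h₅ h₅'

/-- In the first case a fast quorum meets the `n - f` recorded voters in at least `n - p - f`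
validators, of which `n - p - 2f` are honest and voted for `B`; this is too many. In the second case
`B` must be the block with `n - p - 2f` votes, and then its transaction `tx` would be backed by a
fast quorum while its rival `tx'` is backed by `n - p - 2f` validators. -/
theorem Run.not_votes_of_noFast (ρ : Run S) (i : ℕ) {X k B} (h : (ρ.st i).NoFast X k) :
    ¬ (ρ.st i).Votes (S.n - S.p) X k B := by
  intro hv
  have hn := S.size'
  rcases h with ⟨R, w, h₁, h₂, h₃⟩ | ⟨B', tx, tx', q, h₁, h₂, h₃, h₄, h₅, h₆, h₇⟩
  · obtain ⟨Q, h₄, h₅⟩ := hv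
    have h₆ := S.add_ncard_le Q R
    have h₇ := S.le_ncard_honest (Q ∩ R)
    have h₈ := h₃ B
    have h₉ : {W ∈ Q ∩ R | W ∉ S.byz} ⊆ {W ∈ R | W ∉ S.byz ∧ w W = some B} := by
      rintro W ⟨⟨hQ, hR⟩, hb⟩
      refine ⟨hR, hb, ?_⟩
      obtain ⟨fb, q, h₃, h₄, h₅⟩ := h₅ W hQ hb
      obtain ⟨fb', q', h₃', h₄', h₅'⟩ := h₂ W hR hb
      exact ρ.vote_unique i h₃' h₃ h₄' h₄ hb h₅' h₅
    have := S.ncard_mono h₉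
    have := S.byz_card
    omega
  · obtain rfl := ρ.votes_eq i h₁ hv (by omega)
    have := (ρ.backed_of_votes i hv (by omega) h₂).2 h₃
    exact h₆ (this.eq h₇ h₄ h₅ (by omega))

/-- Two outcomes of Transaction Agreement agree because it decides once. If a fast quorum is
involved, it intersects the backing of the other transaction in an honest validator. -/
theorem Run.confirmed_unique (ρ : Run S) (i : ℕ) {tx tx' q} (h : (ρ.st i).Confirmed tx)
    (h' : (ρ.st i).Confirmed tx') (hq : tx.key = some q) (hq' : tx'.key = some q) :
    tx = tx' := by
  have hn := S.size'
  rcases h with h | ⟨A, sn, h₁, h₂⟩ <;> rcases h' with h' | ⟨A', sn', h₁', h₂'⟩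
  · exact h.eq h' hq hq' (by omega)
  · exact h.eq (ρ.ta_sound i h₂').2 hq hq' (by omega)
  · exact (h'.eq (ρ.ta_sound i h₂).2 hq' hq (by omega)).symm
  · rw [hq] at h₁
    rw [hq', h₁, Option.some.injEq] at h₁'
    cases h₁'
    rw [h₂] at h₂'
    simpa using h₂'

theorem Run.confirmed_backed (ρ : Run S) (i : ℕ) {tx} (h : (ρ.st i).Confirmed tx) :
    (ρ.st i).Backed (S.n - S.p - 2 * S.f) tx := by
  rcases h with h | ⟨A, sn, -, h⟩
  · exact h.mono (by omega)
  · exact (ρ.ta_sound i h).2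

/-! ### The slow path -/

theorem Run.noFast_of_slowDue (ρ : Run S) (i : ℕ) {V X k}
    (h : S.n - S.f ≤ (((ρ.st i).loc V).poaAllVoters X k).ncard)
    (h' : ∀ B, (((ρ.st i).loc V).poaVoters X k (some B)).ncard < S.n - S.p - 2 * S.f) :
    (ρ.st i).NoFast X k := by
  -- One received vote is selected for each voter, since a Byzantine validator may have sent
  -- several. The value `none` for the others is arbitrary.
  have hw : ∀ W, ∃ v, W ∈ ((ρ.st i).loc V).poaAllVoters X k →
      W ∈ ((ρ.st i).loc V).poaVoters X k v := by
    intro W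
    by_cases hW : W ∈ ((ρ.st i).loc V).poaAllVoters X k
    · obtain ⟨v, hv⟩ := hW
      exact ⟨v, fun _ => hv⟩
    · exact ⟨none, fun h => absurd h hW⟩
  choose w hw using hw
  refine .inl ⟨_, w, h, fun W hW hb => ?_, fun B => lt_of_le_of_lt (S.ncard_mono ?_) (h' B)⟩
  · obtain ⟨fb, hfb⟩ := hw W hW
    obtain ⟨t, ht⟩ := ρ.sent_of_inbox i hfb
    exact ⟨fb, _, ht, rfl, rfl⟩
  · rintro W ⟨hW, -, h₁⟩
    have := hw W hW
    rwa [h₁] at this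

/-- After an attempted SP-lock the slot is occupied, by this transaction or by a rival. Hence a
failed attempt yields a rival, which is what `State.NoFast` asks for. -/
theorem Run.candidate (ρ : Run S) (i : ℕ) {V X B tried} :
    (((ρ.st i).loc V).actor X).cur.slow = .candidate B tried →
      (ρ.st i).Votes (S.n - S.p - 2 * S.f) X (((ρ.st i).loc V).actor X).inst B ∧
      ∀ tx ∈ tried, ∀ A sn, tx.key = some (A, sn) →
        ∃ tx', (((ρ.st i).loc V).user A).spLocked sn = some tx' := by
  induction i generalizing tried with
  | zero => rw [ρ.st_zero]; simp [System.start, Attempt.fresh]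
  | succ i ih =>
    intro h
    have hsp := fun A sn tx => (ρ.step i).spLocked_mono (V := V) (A := A) (sn := sn) (tx := tx)
    have huser := fun A => (ρ.step i).userStep V A
    have hu := (ρ.step i).actorStep V X
    have ih' : ∀ tried', (((ρ.st i).loc V).actor X).cur.slow = .candidate B tried' →
        (ρ.st (i + 1)).Votes (S.n - S.p - 2 * S.f) X (((ρ.st i).loc V).actor X).inst B ∧
      ∀ tx ∈ tried', ∀ A sn, tx.key = some (A, sn) →
        ∃ tx', (((ρ.st (i + 1)).loc V).user A).spLocked sn = some tx' := by
      intro tried' h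
      refine ⟨(ih h).1.step (ρ.step i), fun tx htx A sn hk => ?_⟩
      obtain ⟨tx', h'⟩ := (ih h).2 tx htx A sn hk
      exact ⟨tx', hsp _ _ _ h'⟩
    have hst := ρ.step i
    generalize ((ρ.st (i + 1)).loc V).actor X = u at hu h ⊢
    generalize ρ.act i = a at hu hst huser
    cases hu <;> try exact ih' _ h
    case slowCandidate B' _ _ hq =>
      simp only [SlowPhase.candidate.injEq] at h
      obtain ⟨rfl, rfl⟩ := h
      exact ⟨(ρ.votes_of_inbox i hq).step hst, by simp⟩
    case slowFallback => cases h
    case spCandidate A sn b s B' tried' _ hs =>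
      simp only [SlowPhase.candidate.injEq] at h
      obtain ⟨rfl, rfl⟩ := h
      refine ⟨(ih' _ hs).1, fun tx htx A' sn' hk => ?_⟩
      rcases htx with rfl | htx
      · cases hk
        have hu := huser A
        generalize ((ρ.st (i + 1)).loc V).user A = u at hu ⊢
        cases hu
        case refl h => exact absurd rfl (h _ rfl)
        case spLock => exact Option.ne_none_iff_exists'.1 (lockIfFree_self_ne_none _ _ _)
      · exact (ih' _ hs).2 tx htx A' sn' hk
    case spFallback => cases h
    case qcPropose => cases h
    case poaDecide => cases h

/-- The fallback is entered when no block has `n - p - 2f` votes among `n - f` received ones, or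
when the candidate contains a transaction with an SP-locked rival. Either is a reason why no fast
decision can ever occur. -/
theorem Run.fallback (ρ : Run S) (i : ℕ) {V X B tried} :
    (((ρ.st i).loc V).actor X).cur.slow = .fallback B tried →
      (ρ.st i).NoFast X (((ρ.st i).loc V).actor X).inst := by
  induction i generalizing tried with
  | zero => rw [ρ.st_zero]; simp [System.start, Attempt.fresh]
  | succ i ih =>
    intro h
    have hu := (ρ.step i).actorStep V X
    have ih' : ∀ tried', (((ρ.st i).loc V).actor X).cur.slow = .fallback B tried' →
        (ρ.st (i + 1)).NoFast X (((ρ.st i).loc V).actor X).inst :=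
      fun _ h => (ih h).step (ρ.step i)
    have hst := ρ.step i
    generalize ((ρ.st (i + 1)).loc V).actor X = u at hu h ⊢
    generalize ρ.act i = a at hu hst
    cases hu <;> try exact ih' _ h
    case slowCandidate => cases h
    case slowFallback T _ hd _ =>
      refine State.NoFast.step ?_ hst
      rcases hd with ⟨⟨_, h₁⟩, h₂⟩ | ⟨B', tried', h₁, h₂, tx, htx, hu, hsp⟩
      · exact ρ.noFast_of_slowDue i h₁ h₂
      -- The second alternative of `State.NoFast`: the rival `tx'` occupies the SP-slot and is
      -- backed because it is SP-locked.
      · obtain ⟨A, sn, b, s, rfl⟩ := hu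
        obtain ⟨tx', htx'⟩ := (ρ.candidate i h₁).2 _ (h₂ _ htx ⟨_, _, _, _, rfl⟩) A sn rfl
        refine .inr ⟨B', _, tx', (A, sn), (ρ.candidate i h₁).1, htx, ⟨_, _, _, _, rfl⟩, rfl,
          (ρ.spLocked i htx').1, fun h => hsp ⟨A, sn, rfl, h ▸ htx'⟩, (ρ.spLocked i htx').2⟩
    case spCandidate => cases h
    case spFallback A sn b s B' tried' _ hs =>
      simp only [SlowPhase.fallback.injEq] at h
      obtain ⟨rfl, rfl⟩ := h
      exact ih' _ hs
    case qcPropose => cases h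
    case poaDecide => cases h

theorem Run.qcProposed (ρ : Run S) (i : ℕ) {V X k P} :
    (((ρ.st i).loc V).actor X).qcProposed k = some P →
      (ρ.st i).Votes (S.n - S.p - 2 * S.f) X k P ∨ (ρ.st i).NoFast X k := by
  induction i with
  | zero => rw [ρ.st_zero]; simp [System.start]
  | succ i ih =>
    intro h
    suffices (((ρ.st i).loc V).actor X).qcProposed k = some P ∨
        ((ρ.st i).Votes (S.n - S.p - 2 * S.f) X k P ∨ (ρ.st i).NoFast X k) by
      exact (this.elim ih id).imp (·.step (ρ.step i)) (·.step (ρ.step i))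
    have hu := (ρ.step i).actorStep V X
    generalize ((ρ.st (i + 1)).loc V).actor X = u at hu h
    generalize ρ.act i = a at hu
    cases hu <;> try exact .inl h
    case qcPropose B tried P' _ hs =>
      by_cases hk : k = (((ρ.st i).loc V).actor X).inst
      · subst hk
        simp only [Function.update_self, Option.some.injEq] at h
        subst h
        right
        rcases hs with ⟨hs, rfl⟩ | ⟨hs, rfl⟩
        · exact .inl (ρ.candidate i hs).1
        · exact .inr (ρ.fallback i hs)
      · left; simpa [hk] using h

/-- `Ps` collects the honest proposals made up to the decision. Fixing this set makes the two halves
of Quorum Validity independent of proposals made afterwards. -/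
theorem Run.qc_valid (ρ : Run S) (i : ℕ) {X k B} :
    (ρ.st i).qc X k = some B → ∃ Ps : Set (Block N),
      (∀ P ∈ Ps, (ρ.st i).Votes (S.n - S.p - 2 * S.f) X k P ∨ (ρ.st i).NoFast X k) ∧
      (∀ tx, (∀ P ∈ Ps, tx ∈ P) → tx ∈ B) ∧ ∀ tx ∈ B, ∃ P ∈ Ps, tx ∈ P := by
  induction i with
  | zero => rw [ρ.st_zero]; simp [System.start]
  | succ i ih =>
    intro h
    rcases (ρ.step i).qc X k with h₁ | ⟨B', -, h₁, h₂⟩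
    · obtain ⟨Ps, h₂, h₃⟩ := ih (h₁ ▸ h)
      exact ⟨Ps, fun P hP => (h₂ P hP).imp (·.step (ρ.step i)) (·.step (ρ.step i)), h₃⟩
    · rw [h₂, Option.some.injEq] at h
      subst h
      refine ⟨{P | ∃ V, V ∉ S.byz ∧ (((ρ.st i).loc V).actor X).qcProposed k = some P}, ?_,
        fun tx h => h₁.1 tx fun V hV P hP => h P ⟨V, hV, hP⟩, fun tx htx => ?_⟩
      · rintro P ⟨V, -, hP⟩
        exact (ρ.qcProposed i hP).imp (·.step (ρ.step i)) (·.step (ρ.step i))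
      · have h₃ := h₁.2 tx htx
        have : Set.Nonempty {V | V ∉ S.byz ∧ ∃ P,
            (((ρ.st i).loc V).actor X).qcProposed k = some P ∧ tx ∈ P} := by
          rw [Set.nonempty_iff_ne_empty]
          intro h₄
          rw [h₄, Set.ncard_empty] at h₃
          have := S.size'
          omega
        obtain ⟨V, hV, P, hP, htx⟩ := this
        exact ⟨P, ⟨V, hV, hP⟩, htx⟩

/-! ### Certificates -/

/-- Given fast votes for `B`, no honest proposal can come from the fallback, and each candidate
equals `B` by quorum intersection; so Quorum Consensus returns `B`. No transaction is removed from
it, because a Transaction Agreement outcome with the same sender and number shares an honest FP-lock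
with the fast quorum. -/
theorem Run.poaCert_eq_of_votes (ρ : Run S) (i : ℕ) {X k B B'}
    (h : (ρ.st i).Votes (S.n - S.p) X k B) (h' : (ρ.st i).PoaCert X k B') : B' = B := by
  have hn := S.size'
  rcases h' with h' | ⟨Bqc, h₁, h₂, h₃⟩
  · exact ρ.votes_eq i (m := S.n - S.p) h' h (by omega)
  · obtain ⟨Ps, h₄, h₅, h₆⟩ := ρ.qc_valid i h₁
    have hP : ∀ P ∈ Ps, P = B := by
      intro P hP
      rcases h₄ P hP with h₇ | h₇
      · exact ρ.votes_eq i h₇ h (by omega)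
      · exact absurd h (ρ.not_votes_of_noFast i h₇)
    have hB : Bqc = B := by
      ext tx
      constructor
      · intro htx
        obtain ⟨P, h₇, h₈⟩ := h₆ tx htx
        rwa [hP P h₇] at h₈
      · exact fun htx => h₅ tx fun P h₇ => by rwa [hP P h₇]
    subst hB
    ext tx
    rw [h₃]
    refine ⟨And.left, fun htx => ⟨htx, ?_⟩⟩
    rintro A sn b s rfl
    obtain ⟨tx', htx'⟩ := Option.ne_none_iff_exists'.1 (h₂ A sn b s htx)
    have h₇ := (ρ.backed_of_votes i h (by omega) htx).2 ⟨_, _, _, _, rfl⟩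
    obtain ⟨h₈, h₉⟩ := ρ.ta_sound i htx'
    rw [htx', h₇.eq h₉ rfl h₈ (by omega)]

theorem Run.poaCert_unique (ρ : Run S) (i : ℕ) {X k B B'} (h : (ρ.st i).PoaCert X k B)
    (h' : (ρ.st i).PoaCert X k B') : B = B' := by
  rcases h with h | ⟨Bqc, h₁, h₂, h₃⟩
  · exact (ρ.poaCert_eq_of_votes i h h').symm
  · rcases h' with h' | ⟨Bqc', h₁', h₂', h₃'⟩
    · exact ρ.poaCert_eq_of_votes i h' (.inr ⟨Bqc, h₁, h₂, h₃⟩)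
    · rw [h₁, Option.some.injEq] at h₁'
      subst h₁'
      ext tx
      rw [h₃, h₃']

theorem Run.poaCert_sound (ρ : Run S) (i : ℕ) {X k B tx} (h : (ρ.st i).PoaCert X k B)
    (htx : tx ∈ B) :
    tx.receiver = some X ∧ (tx.IsUARA → (ρ.st i).Confirmed tx) := by
  rcases h with h | ⟨Bqc, h₁, h₂, h₃⟩
  · have := ρ.backed_of_votes i (m := S.n - S.p) h (by have := S.size'; omega) htx
    exact ⟨this.1, fun hu => .inl (this.2 hu)⟩
  · obtain ⟨h₄, h₅⟩ := (h₃ tx).1 htx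
    refine ⟨(ρ.qc_sound i h₁ h₄).1, ?_⟩
    rintro ⟨A, sn, b, s, rfl⟩
    exact .inr ⟨A, sn, rfl, h₅ A sn b s rfl⟩

/-- The outcomes known locally agree with the global ones, and a slow result depends only on those
that are decided. -/
theorem Run.poaCert_of_slowResult (ρ : Run S) (i : ℕ) {V X B Bqc}
    (h : (((ρ.st i).loc V).actor X).cur.qcDecided = some Bqc)
    (h' : SlowResult Bqc (fun A sn => (((ρ.st i).loc V).user A).taDecided sn) B) :
    (ρ.st i).PoaCert X (((ρ.st i).loc V).actor X).inst B := by
  have hta : ∀ A sn b s, Tx.uara A sn b s ∈ Bqc →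
      (((ρ.st i).loc V).user A).taDecided sn = (ρ.st i).ta A sn := by
    intro A sn b s hm
    obtain ⟨tx, htx⟩ := Option.ne_none_iff_exists'.1 (h'.1 A sn b s hm)
    dsimp only at htx
    rw [htx, ρ.taDecided i htx]
  refine .inr ⟨Bqc, ρ.qcDecided i h, fun A sn b s hm => ?_, fun tx => ?_⟩
  · rw [← hta A sn b s hm]; exact h'.1 A sn b s hm
  · rw [h'.2]
    refine and_congr_right fun hm => forall_congr' fun A => forall_congr' fun sn =>
      forall_congr' fun b => forall_congr' fun s => forall_congr' fun he => ?_
    subst he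
    dsimp only
    rw [hta A sn b s hm]

/-- A proof that merely relays a received one goes back to an earlier packet, which is covered by
induction over the run; a Byzantine sender can only send a proof for which the signatures exist. -/
theorem Run.poaCert_of_sent (ρ : Run S) (i : ℕ) {q : Packet N} {X k B}
    (hq : q ∈ (ρ.st i).sent) (hm : q.msg = .poaProof X k B) : (ρ.st i).PoaCert X k B := by
  induction i generalizing q with
  | zero => rw [ρ.st_zero] at hq; simp [System.start] at hq
  | succ i ih =>
    refine State.PoaCert.step ?_ (ρ.step i)
    rcases (ρ.step i).sendStep q hq with h | ⟨-, h⟩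
    · exact ih h hm
    · rw [hm] at h
      generalize q.src = src at h
      generalize ρ.act i = a at h
      cases h
      case poaProof V hV hd =>
        rcases hd with h | ⟨src, h⟩ | ⟨Bqc, h₁, h₂⟩
        · exact .inl (ρ.votes_of_inbox i h)
        · obtain ⟨t, ht⟩ := ρ.sent_of_inbox i h
          exact ih ht rfl
        · exact ρ.poaCert_of_slowResult i h₁ h₂
      case adversary _ _ _ h => exact h X k B rfl

theorem Run.poaCert_of_decide (ρ : Run S) (i : ℕ) {V X B}
    (h : ρ.act i = .internal V (.poaDecide X B)) :
    (ρ.st i).PoaCert X (((ρ.st i).loc V).actor X).inst B := by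
  have hs := ρ.step i
  rw [h] at hs
  obtain ⟨-, -, hd, -⟩ := hs
  rcases hd with h | ⟨src, h⟩ | ⟨Bqc, h₁, -, h₂⟩
  · exact .inl (ρ.votes_of_inbox i h)
  · obtain ⟨t, ht⟩ := ρ.sent_of_inbox i h
    exact ρ.poaCert_of_sent i ht rfl
  · exact ρ.poaCert_of_slowResult i h₁ h₂

theorem Run.pobCert_of_voters (ρ : Run S) (i : ℕ) {V A sn tx} (hk : tx.key = some (A, sn))
    (h : S.n - S.p ≤ (((ρ.st i).loc V).pobVoters A sn tx).ncard) : (ρ.st i).PobCert tx := by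
  refine ⟨A, sn, hk, .inl ⟨_, h, fun W hW _ => ?_⟩⟩
  obtain ⟨t, ht⟩ := ρ.sent_of_inbox i hW
  exact ⟨_, ht, rfl, rfl⟩

theorem Run.pobCert_of_sent (ρ : Run S) (i : ℕ) {q : Packet N} {tx}
    (hq : q ∈ (ρ.st i).sent) (hm : q.msg = .pobProof tx) : (ρ.st i).PobCert tx := by
  induction i generalizing q with
  | zero => rw [ρ.st_zero] at hq; simp [System.start] at hq
  | succ i ih =>
    refine State.PobCert.step ?_ (ρ.step i)
    rcases (ρ.step i).sendStep q hq with h | ⟨-, h⟩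
    · exact ih h hm
    · rw [hm] at h
      generalize q.src = src at h
      generalize ρ.act i = a at h
      cases h
      case pobProof V A sn hV hk hd =>
        rcases hd with h | ⟨src, h⟩ | h
        · exact ρ.pobCert_of_voters i hk h
        · obtain ⟨t, ht⟩ := ρ.sent_of_inbox i h
          exact ih ht rfl
        · exact ⟨A, sn, hk, .inr (ρ.taDecided i h)⟩
      case adversary _ _ h _ => exact h tx rfl

theorem Run.pobDecided (ρ : Run S) (i : ℕ) {V A sn tx} :
    (((ρ.st i).loc V).user A).pobDecided sn = some tx →
      tx.key = some (A, sn) ∧ (ρ.st i).PobCert tx := by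
  induction i with
  | zero => rw [ρ.st_zero]; simp [System.start]
  | succ i ih =>
    intro h
    suffices (((ρ.st i).loc V).user A).pobDecided sn = some tx ∨
        tx.key = some (A, sn) ∧ (ρ.st i).PobCert tx by
      have := this.elim ih id
      exact ⟨this.1, this.2.step (ρ.step i)⟩
    have hu := (ρ.step i).userStep V A
    generalize ((ρ.st (i + 1)).loc V).user A = u at hu h
    generalize ρ.act i = a at hu
    cases hu <;> try exact .inl h
    case pobDecide sn' tx' _ _ hk hd =>
      by_cases h₁ : sn = sn'
      · subst h₁
        simp only [Function.update_self, Option.some.injEq] at h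
        subst h
        refine .inr ⟨hk, ?_⟩
        rcases hd with h | ⟨src, h⟩ | h
        · exact ρ.pobCert_of_voters i hk h
        · obtain ⟨t, ht⟩ := ρ.sent_of_inbox i h
          exact ρ.pobCert_of_sent i ht rfl
        · exact ⟨A, sn, hk, .inr (ρ.taDecided i h)⟩
      · left; simpa [h₁] using h

-- An honest vote in the certificate was cast in the step that established the FP-lock, or later.
theorem Run.confirmed_of_pobCert (ρ : Run S) (i : ℕ) {tx} (h : (ρ.st i).PobCert tx) :
    (ρ.st i).Confirmed tx := by
  obtain ⟨A, sn, hk, ⟨Q, h₁, h₂⟩ | h⟩ := h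
  · refine .inl ⟨Q, h₁, fun W hW hb => ?_⟩
    obtain ⟨q, hq, h₃, h₄⟩ := h₂ W hW hb
    exact ρ.pobVote_fpLocked i hq h₃ hb h₄
  · exact .inr ⟨A, sn, hk, h⟩

/-! ### Transactions of honest users -/

theorem Run.sent_user (ρ : Run S) (i : ℕ) {q : Packet N} {A} (hq : q ∈ (ρ.st i).sent)
    (hs : q.src = .inr A) (hA : A ∈ S.honestUser) :
    ∃ tx sn, q.msg = .tx tx ∧ tx.key = some (A, sn) ∧ tx ∈ (ρ.st i).issued := by
  induction i with
  | zero => rw [ρ.st_zero] at hq; simp [System.start] at hq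
  | succ i ih =>
    rcases (ρ.step i).sendStep q hq with h | ⟨-, h⟩
    · obtain ⟨tx, sn, h₁, h₂, h₃⟩ := ih h
      exact ⟨tx, sn, h₁, h₂, (ρ.step i).issued_mono h₃⟩
    · rw [hs] at h
      have hst := ρ.step i
      generalize hm : q.msg = m at h ⊢
      generalize ρ.act i = a at h hst
      cases h
      case issue =>
        obtain ⟨-, hk, -, -, -, h⟩ := hst
        refine ⟨_, _, rfl, hk, ?_⟩
        rw [h]
        exact Set.mem_insert _ _
      case adversary hs' _ _ _ => exact absurd hA hs'

/-- The two statements need each other: an FP-lock may result from a block in a message, and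
messages of honest validators contain only transactions that are FP-locked at the sender, confirmed,
or received from the user. -/
theorem Run.signatures (ρ : Run S) (i : ℕ) :
    (∀ V A sn tx, A ∈ S.honestUser → (((ρ.st i).loc V).user A).fpLocked sn = some tx →
      tx ∈ (ρ.st i).issued) ∧
    ∀ q ∈ (ρ.st i).sent, ∀ tx ∈ q.msg.txs, ∀ A sn, tx.key = some (A, sn) → A ∈ S.honestUser →
      S.verify tx → tx ∈ (ρ.st i).issued := by
  induction i with
  | zero => rw [ρ.st_zero]; simp [System.start]
  | succ i ih =>
    obtain ⟨ih₁, ih₂⟩ := ih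
    have hmono := (ρ.step i).issued_mono
    have hfp : ∀ V A sn tx, A ∈ S.honestUser →
        (((ρ.st (i + 1)).loc V).user A).fpLocked sn = some tx → tx ∈ (ρ.st (i + 1)).issued := by
      intro V A sn tx hA h
      rcases (ρ.step i).fpLocked h with h | ⟨hk, ⟨t, h⟩ | ⟨hv, X, B, v, h, htx⟩⟩
      · exact hmono (ih₁ V A sn tx hA h)
      · obtain ⟨tx', sn', h₁, h₂, h₃⟩ := ρ.sent_user i h rfl hA
        cases h₁
        exact hmono h₃
      -- The block came in a proposal whose sender may be Byzantine, so the statement about messages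
      -- is applied to that packet.
      · obtain ⟨-, -, t, -, h⟩ := ρ.fp i h
        exact hmono (ih₂ _ h tx htx A sn hk hA hv)
    refine ⟨hfp, fun q hq tx htx A sn hk hA hv => ?_⟩
    have hfp' : ∀ V, (ρ.st (i + 1)).FPLocked V tx → tx ∈ (ρ.st (i + 1)).issued := by
      rintro V ⟨A', sn', h₁, h₂⟩
      rw [hk] at h₁
      cases h₁
      exact hfp V A sn tx hA h₂
    -- A confirmed transaction is backed by `n - p - 2f > f` validators, so it is FP-locked at an
    -- honest one.
    have hconf : (ρ.st (i + 1)).Confirmed tx → tx ∈ (ρ.st (i + 1)).issued := by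
      intro h
      obtain ⟨W, -, hW⟩ := (ρ.confirmed_backed _ h).exists_honest
        (by have := S.size'; omega)
      exact hfp' W hW
    rcases (ρ.step i).sendStep q hq with h | ⟨-, h⟩
    · exact hmono (ih₂ q h tx htx A sn hk hA hv)
    · generalize hm : q.msg = m at h htx
      generalize hs : q.src = src at h
      generalize ha : ρ.act i = a at h
      cases h
      case proposal V X _ _ =>
        have := (ρ.pool i htx).1
        exact hfp' V ((this.2 (Tx.isUARA_of_receiver this.1 hk)).step (ρ.step i))
      case vote V X B v hV hn hf hr =>
        have h := ρ.vote_fit (i + 1) hq hs hV hm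
        rcases htx with htx | ⟨B', hB', htx⟩
        · exact hfp' V ((h.2 tx htx).2 (Tx.isUARA_of_receiver (h.2 tx htx).1 hk))
        · exact hfp' V ((h.1 B' hB' tx htx).2
            (Tx.isUARA_of_receiver (h.1 B' hB' tx htx).1 hk))
      case poaProof V X B hV _ =>
        have := ρ.poaCert_sound (i + 1) (ρ.poaCert_of_sent (i + 1) hq hm) htx
        exact hconf (this.2 (Tx.isUARA_of_receiver this.1 hk))
      case pobProof V A sn tx' hV _ _ =>
        cases htx
        exact hconf (ρ.confirmed_of_pobCert _ (ρ.pobCert_of_sent (i + 1) hq hm))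
      case pobVote V A' sn' os c s hV hsent hf =>
        cases htx
        exact hfp' V (ρ.pobVote_fpLocked (i + 1) hq hs hV hm)
      case pobRefuse => cases htx
      case issue A' tx' hA' hk' hv' =>
        cases htx
        have hst := ρ.step i
        rw [ha] at hst
        obtain ⟨-, -, -, -, -, h⟩ := hst
        rw [h]
        exact Set.mem_insert _ _
      case adversary _ ht _ _ => exact hmono (ht tx htx A sn hk hA hv)

theorem Run.issued (ρ : Run S) (i : ℕ) {tx} : tx ∈ (ρ.st i).issued →
    S.verify tx ∧ ∃ A sn, tx.key = some (A, sn) ∧ A ∈ S.honestUser ∧ sn < (ρ.st i).nextSn A := by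
  induction i with
  | zero => rw [ρ.st_zero]; simp [System.start]
  | succ i ih =>
    intro h
    rcases (ρ.step i).issued with ⟨h₁, h₂⟩ | ⟨A, tx', ha, h₁, h₂⟩
    · rw [h₁] at h; rw [h₂]; exact ih h
    · have hst := ρ.step i
      rw [ha] at hst
      obtain ⟨hA, hk, hv, -⟩ := hst
      rw [h₁] at h
      rw [h₂]
      rcases h with rfl | h
      · exact ⟨hv, A, _, hk, hA, by simp⟩
      · obtain ⟨hv, A', sn, h₃, h₄, h₅⟩ := ih h
        refine ⟨hv, A', sn, h₃, h₄, ?_⟩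
        by_cases hAA : A' = A
        · subst hAA; simp; omega
        · simpa [hAA] using h₅

/-- Older transactions have numbers below `nextSn`, the number of the new one, and the rule for
issuing forbids consuming an object that an earlier transaction of the same user consumes. -/
theorem Run.issued_unique (ρ : Run S) (i : ℕ) {tx tx' A sn sn'} (h : tx ∈ (ρ.st i).issued)
    (h' : tx' ∈ (ρ.st i).issued) (hk : tx.key = some (A, sn)) (hk' : tx'.key = some (A, sn')) :
    tx = tx' ∨ sn ≠ sn' ∧ ∀ o ∈ tx.objs, o ∉ tx'.objs := by
  induction i with
  | zero => rw [ρ.st_zero] at h; simp [System.start] at h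
  | succ i ih =>
    rcases (ρ.step i).issued with ⟨h₁, -⟩ | ⟨A', tx₀, ha, h₁, -⟩
    · rw [h₁] at h h'; exact ih h h'
    · have hst := ρ.step i
      rw [ha] at hst
      obtain ⟨hA, hk₀, -, -, ho, -⟩ := hst
      have key : ∀ {tx₁ sn₁ sn₂}, tx₁ ∈ (ρ.st i).issued → tx₁.key = some (A, sn₁) →
          tx₀.key = some (A, sn₂) → sn₁ ≠ sn₂ ∧ ∀ o ∈ tx₀.objs, o ∉ tx₁.objs := by
        intro tx₁ sn₁ sn₂ h₂ h₃ h₄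
        obtain ⟨-, A₁, sn₃, h₅, -, h₆⟩ := ρ.issued i h₂
        rw [h₃] at h₅
        cases h₅
        rw [hk₀] at h₄
        cases h₄
        exact ⟨h₆.ne, fun o h₇ => (ho o h₇).2 tx₁ h₂ ⟨_, h₃⟩⟩
      rw [h₁] at h h'
      rcases h with rfl | h <;> rcases h' with rfl | h'
      · exact .inl rfl
      · have := key h' hk' hk
        exact .inr ⟨this.1.symm, this.2⟩
      · have := key h hk hk'
        exact .inr ⟨this.1, fun o h₁ h₂ => this.2 o h₂ h₁⟩
      · exact ih h h'

theorem Run.issued_eq (ρ : Run S) (i : ℕ) {tx tx' A sn} (h : tx ∈ (ρ.st i).issued)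
    (h' : tx' ∈ (ρ.st i).issued) (hk : tx.key = some (A, sn)) (hk' : tx'.key = some (A, sn)) :
    tx = tx' :=
  (ρ.issued_unique i h h' hk hk').resolve_right fun h => h.1 rfl

theorem Run.issued_of_fpLocked (ρ : Run S) (i : ℕ) {V tx A sn} (h : (ρ.st i).FPLocked V tx)
    (hk : tx.key = some (A, sn)) (hA : A ∈ S.honestUser) : tx ∈ (ρ.st i).issued := by
  obtain ⟨A', sn', h₁, h₂⟩ := h
  rw [hk] at h₁
  cases h₁
  exact (ρ.signatures i).1 V A sn tx hA h₂

theorem Run.issued_of_confirmed (ρ : Run S) (i : ℕ) {tx A sn} (h : (ρ.st i).Confirmed tx)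
    (hk : tx.key = some (A, sn)) (hA : A ∈ S.honestUser) : tx ∈ (ρ.st i).issued := by
  obtain ⟨W, -, hW⟩ := (ρ.confirmed_backed _ h).exists_honest (by have := S.size'; omega)
  exact ρ.issued_of_fpLocked i hW hk hA

/-! ### Votes -/

/-- Whether or not the attempt succeeded, the slot is occupied afterwards. So a failed FP-lock on a
correctly signed transaction exhibits a locked rival. -/
theorem Run.fpTried (ρ : Run S) (i : ℕ) {V X A sn b s} :
    Tx.uara A sn b s ∈ (((ρ.st i).loc V).actor X).cur.fpTried → S.verify (.uara A sn b s) →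
      ∃ tx, (((ρ.st i).loc V).user A).fpLocked sn = some tx := by
  induction i with
  | zero => rw [ρ.st_zero]; simp [System.start, Attempt.fresh]
  | succ i ih =>
    intro h hv
    have ih' : Tx.uara A sn b s ∈ (((ρ.st i).loc V).actor X).cur.fpTried →
        ∃ tx, (((ρ.st (i + 1)).loc V).user A).fpLocked sn = some tx := by
      intro h
      obtain ⟨tx, htx⟩ := ih h hv
      exact ⟨tx, (ρ.step i).fpLocked_mono htx⟩
    have huser := fun A => (ρ.step i).userStep V A
    have hu := (ρ.step i).actorStep V X
    generalize ((ρ.st (i + 1)).loc V).actor X = u at hu h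
    generalize ρ.act i = a at hu huser
    cases hu <;> try exact ih' h
    case fpLock A' sn' b' s' _ =>
      rcases h with h | h
      · cases h
        have hu := huser A
        generalize ((ρ.st (i + 1)).loc V).user A = u at hu ⊢
        cases hu
        case refl h => exact absurd rfl (h _ rfl)
        case fpLock =>
          dsimp only
          rw [if_pos hv]
          exact Option.ne_none_iff_exists'.1 (lockIfFree_self_ne_none _ _ _)
      · exact ih' h
    case poaDecide => simp [Attempt.fresh] at h

/-- The transaction `tx` cannot be FP-locked at `V`, or the time `v + Δ` for doing so is over. -/
def State.Refused (σ : State S) (V : N.Validator) (tx : Tx N) (v : ℝ) : Prop :=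
  ¬ S.verify tx ∨ (∃ tx' A sn, tx.key = some (A, sn) ∧ tx'.key = some (A, sn) ∧ tx' ≠ tx ∧
    σ.FPLocked V tx') ∨ v + S.Δ < σ.now

theorem State.Refused.step {a : Action N} {σ σ' : State S} {V tx v} (hr : σ.Refused V tx v)
    (h : Step a σ σ') : σ'.Refused V tx v := by
  rcases hr with h₁ | ⟨tx', A, sn, h₁, h₂, h₃, h₄⟩ | h₁
  · exact .inl h₁
  · exact .inr (.inl ⟨tx', A, sn, h₁, h₂, h₃, h₄.step h⟩)
  · exact .inr (.inr (h₁.trans_le h.now_le))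

/-- The reason for a refusal is turned into `State.Refused`, which persists; the guard itself, that
the slot does not hold `tx`, would not be a usable witness by itself. -/
theorem Run.fpReply_false (ρ : Run S) (i : ℕ) {V X tx} :
    (((ρ.st i).loc V).actor X).cur.fpReply tx = some false →
      ∃ B v, (((ρ.st i).loc V).actor X).cur.fp = some (B, v) ∧ tx ∈ B ∧ tx.IsUARA ∧
        (ρ.st i).Refused V tx v := by
  induction i with
  | zero => rw [ρ.st_zero]; simp [System.start, Attempt.fresh]
  | succ i ih =>
    intro h
    have ih' : (((ρ.st i).loc V).actor X).cur.fpReply tx = some false →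
      ∃ B v, (((ρ.st i).loc V).actor X).cur.fp = some (B, v) ∧ tx ∈ B ∧ tx.IsUARA ∧
        (ρ.st (i + 1)).Refused V tx v := by
      intro h
      obtain ⟨B, v, h₁, h₂, h₃, h₄⟩ := ih h
      exact ⟨B, v, h₁, h₂, h₃, h₄.step (ρ.step i)⟩
    have hst := ρ.step i
    have hu := (ρ.step i).actorStep V X
    generalize ((ρ.st (i + 1)).loc V).actor X = u at hu h ⊢
    generalize ρ.act i = a at hu hst
    cases hu <;> try exact ih' h
    -- A reply recorded earlier presupposes a block being FP-locked, but taking up a block requires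
    -- that there is none.
    case fpBegin B _ hn _ _ =>
      obtain ⟨B, v, h₁, -⟩ := ih' h
      simp [hn] at h₁
    case fpReply A sn b s ok B v _ hf htx _ hff htr =>
      by_cases h₁ : tx = .uara A sn b s
      · subst h₁
        simp only [Function.update_self, Option.some.injEq] at h
        refine ⟨B, v, hf, htx, ⟨_, _, _, _, rfl⟩, State.Refused.step ?_ hst⟩
        by_cases hv : S.verify (.uara A sn b s)
        · rcases hff h with h₂ | h₂ | h₂
          · exact absurd hv h₂
          · obtain ⟨tx', h₃⟩ := ρ.fpTried i htr hv
            refine .inr (.inl ⟨tx', A, sn, rfl, ρ.fpLocked_key i h₃, ?_, A, sn,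
              ρ.fpLocked_key i h₃, h₃⟩)
            rintro rfl
            exact h₂ h₃
          · exact .inr (.inr h₂)
        · exact .inl hv
      · exact ih' (by simpa [h₁] using h)
    case poaDecide => simp [Attempt.fresh] at h

/-- An honest vote, positive or not, answers a proposal of the leader; a negative one has a lasting
reason, dated by the time `u ≥ t` at which the block was taken up. -/
theorem Run.vote_proposal (ρ : Run S) (i : ℕ) {q : Packet N} {W X k v fb}
    (hq : q ∈ (ρ.st i).sent) (hW : q.src = .inl W) (hb : W ∉ S.byz)
    (hm : q.msg = .poaVote X k v fb) :
    ∃ B t u, (⟨.inl (S.leader X k), W, .proposal X k B, t⟩ : Packet N) ∈ (ρ.st i).sent ∧ t ≤ u ∧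
      (v = some B ∨ v = none ∧ ∃ tx ∈ B, tx.IsUARA ∧ (ρ.st i).Refused W tx u) := by
  induction i with
  | zero => rw [ρ.st_zero] at hq; simp [System.start] at hq
  | succ i ih =>
    suffices ∃ B t u, (⟨.inl (S.leader X k), W, .proposal X k B, t⟩ : Packet N) ∈
        (ρ.st i).sent ∧ t ≤ u ∧
        (v = some B ∨ v = none ∧ ∃ tx ∈ B, tx.IsUARA ∧ (ρ.st i).Refused W tx u) by
      obtain ⟨B, t, u, h₁, h₂, h₃⟩ := this
      exact ⟨B, t, u, (ρ.step i).sent_subset h₁, h₂, h₃.imp_right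
        fun ⟨hv, tx, h₁, h₂, h₃⟩ => ⟨hv, tx, h₁, h₂, h₃.step (ρ.step i)⟩⟩
    rcases (ρ.step i).sendStep q hq with h | ⟨-, h⟩
    · exact ih h
    · rw [hm] at h
      obtain ⟨-, rfl, -, -, B, u, h₁, h₂, h₃⟩ := h.vote_inv hW hb
      obtain ⟨-, -, t, ht, hp⟩ := ρ.fp i h₁
      refine ⟨B, t, u, hp, ht, ?_⟩
      split_ifs at h₃ with h₄
      · exact .inl h₃
      · right
        push Not at h₄
        obtain ⟨tx, h₅, h₆, h₇⟩ := h₄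
        have h₈ : (((ρ.st i).loc W).actor X).cur.fpReply tx = some false := by
          rcases h₉ : (((ρ.st i).loc W).actor X).cur.fpReply tx with _ | _ | _
          · exact absurd h₉ (h₂ tx h₅ h₆)
          · rfl
          · exact absurd h₉ h₇
        obtain ⟨B', u', h₁', -, -, hr⟩ := ρ.fpReply_false i h₈
        rw [h₁] at h₁'
        cases h₁'
        exact ⟨h₃, tx, h₅, h₆, hr⟩

theorem Run.voted_sent (ρ : Run S) (i : ℕ) {V X} :
    (((ρ.st i).loc V).actor X).cur.voted → ∃ v fb, ∀ W, ∃ t,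
      (⟨.inl V, W, .poaVote X (((ρ.st i).loc V).actor X).inst v fb, t⟩ : Packet N) ∈
        (ρ.st i).sent := by
  induction i with
  | zero => rw [ρ.st_zero]; simp [System.start, Attempt.fresh]
  | succ i ih =>
    intro h
    have ih' : (((ρ.st i).loc V).actor X).cur.voted → ∃ v fb, ∀ W, ∃ t,
      (⟨.inl V, W, .poaVote X (((ρ.st i).loc V).actor X).inst v fb, t⟩ : Packet N) ∈
        (ρ.st (i + 1)).sent := by
      intro h
      obtain ⟨v, fb, h₁⟩ := ih h
      exact ⟨v, fb, fun W => (h₁ W).imp fun t ht => (ρ.step i).sent_subset ht⟩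
    have hst := ρ.step i
    have hu := (ρ.step i).actorStep V X
    generalize ((ρ.st (i + 1)).loc V).actor X = u at hu h ⊢
    generalize ρ.act i = a at hu hst
    cases hu <;> try exact ih' h
    case vote =>
      obtain ⟨-, -, B, v, h₁, -, h₂⟩ := hst
      rw [h₂]
      exact ⟨_, _, fun W => ⟨_, .inr ⟨rfl, rfl, rfl⟩⟩⟩
    case poaDecide => simp [Attempt.fresh] at h

/-! ### Votes in Parallel Optimistic Broadcast, and proofs -/

/-- For an honest user the vote is always positive: the slot can hold only an issued transaction
with this number, and there is only one. -/
theorem Run.pobVote_sent (ρ : Run S) (i : ℕ) {V A sn os c s} (hA : A ∈ S.honestUser) :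
    (.inr A, .tx (.ua A sn os c s)) ∈ ((ρ.st i).loc V).inbox → ∀ W, ∃ t,
      (⟨.inl V, W, .pobVote A sn (some (.ua A sn os c s)), t⟩ : Packet N) ∈
        (ρ.st i).sent := by
  induction i with
  | zero => rw [ρ.st_zero]; simp [System.start]
  | succ i ih =>
    intro h
    rcases (ρ.step i).inbox V with h₁ | ⟨src, m, ha, ⟨t₀, hsent⟩, h₁⟩
    · rw [h₁] at h
      exact fun W => (ih h W).imp fun t ht => (ρ.step i).sent_subset ht
    · rw [h₁] at h
      rcases h with h | h
      · cases h
        have hst := ρ.step i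
        rw [ha] at hst
        obtain ⟨hV, -, -, h⟩ := hst
        obtain ⟨tx', sn', h₂, h₃, h₄⟩ := ρ.sent_user i hsent rfl hA
        cases h₂
        have hf : (((ρ.st i).loc V).user A).fpLocked sn = none ∨
            (((ρ.st i).loc V).user A).fpLocked sn = some (.ua A sn os c s) := by
          rcases h₅ : (((ρ.st i).loc V).user A).fpLocked sn with _ | tx'
          · exact .inl rfl
          · right
            rw [ρ.issued_eq i ((ρ.signatures i).1 V A sn tx' hA h₅) h₄ (ρ.fpLocked_key i h₅) rfl]
        have h₁ : (((ρ.st i).setLocal V { (ρ.st i).loc V with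
          inbox := insert (Sum.inr A, Msg.tx (.ua A sn os c s)) ((ρ.st i).loc V).inbox }).loc
            V).user A = ((ρ.st i).loc V).user A := by simp [State.setLocal_loc]
        simp only [State.react] at h
        rw [h₁, if_neg (by simp), if_pos hf] at h
        rw [h]
        exact fun W => ⟨_, .inr ⟨rfl, rfl, rfl⟩⟩
      · exact fun W => (ih h W).imp fun t ht => (ρ.step i).sent_subset ht

theorem Run.pobProof_sent (ρ : Run S) (i : ℕ) {V A sn tx} :
    (((ρ.st i).loc V).user A).pobDecided sn = some tx → ∀ W, ∃ t,
      (⟨.inl V, W, .pobProof tx, t⟩ : Packet N) ∈ (ρ.st i).sent := by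
  induction i with
  | zero => rw [ρ.st_zero]; simp [System.start]
  | succ i ih =>
    intro h
    have ih' : (((ρ.st i).loc V).user A).pobDecided sn = some tx → ∀ W, ∃ t,
        (⟨.inl V, W, .pobProof tx, t⟩ : Packet N) ∈ (ρ.st (i + 1)).sent := by
      intro h W
      exact (ih h W).imp fun t ht => (ρ.step i).sent_subset ht
    have hst := ρ.step i
    have hu := (ρ.step i).userStep V A
    generalize ((ρ.st (i + 1)).loc V).user A = u at hu h
    generalize ρ.act i = a at hu hst
    cases hu <;> try exact ih' h
    case pobDecide sn' tx' _ _ hk hd =>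
      by_cases h₁ : sn = sn'
      · subst h₁
        simp only [Function.update_self, Option.some.injEq] at h
        subst h
        obtain ⟨-, -, -, -, h⟩ := hst
        rw [h]
        exact fun W => ⟨_, .inr ⟨rfl, rfl, rfl⟩⟩
      · exact ih' (by simpa [h₁] using h)

/-- The counter passes `k` only by a decision in instance `k`, which broadcasts its proof in the
same step. -/
theorem Run.poaProof_sent (ρ : Run S) (i : ℕ) {V X k} :
    k < (((ρ.st i).loc V).actor X).inst → ∃ B, ∀ W, ∃ t,
      (⟨.inl V, W, .poaProof X k B, t⟩ : Packet N) ∈ (ρ.st i).sent := by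
  induction i with
  | zero => rw [ρ.st_zero]; simp [System.start]
  | succ i ih =>
    intro h
    have ih' : k < (((ρ.st i).loc V).actor X).inst → ∃ B, ∀ W, ∃ t,
        (⟨.inl V, W, .poaProof X k B, t⟩ : Packet N) ∈ (ρ.st (i + 1)).sent := by
      intro h
      obtain ⟨B, hB⟩ := ih h
      exact ⟨B, fun W => (hB W).imp fun t ht => (ρ.step i).sent_subset ht⟩
    have hst := ρ.step i
    rcases (ρ.step i).inst V X with ⟨h₁, -⟩ | ⟨h₁, B, ha⟩
    · exact ih' (h₁ ▸ h)
    · by_cases hk : k < (((ρ.st i).loc V).actor X).inst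
      · exact ih' hk
      · obtain rfl : k = (((ρ.st i).loc V).actor X).inst := by omega
        rw [ha] at hst
        obtain ⟨-, -, -, h⟩ := hst
        rw [h]
        exact ⟨B, fun W => ⟨_, .inr ⟨rfl, rfl, rfl⟩⟩⟩

/-! ### Execution of a block -/

theorem mem_execTx_executed {X : N.Reactive} {a : Exec S} {tx tx' : Tx N} :
    tx ∈ (execTx X a tx').executed ↔ tx ∈ a.executed ∨ tx = tx' := by
  by_cases h : tx' ∈ a.executed
  · rw [execTx, if_pos h]
    exact ⟨.inl, fun h' => h'.elim id fun h' => h' ▸ h⟩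
  · rw [execTx, if_neg h]
    exact or_comm

theorem mem_foldl_executed {X : N.Reactive} {l : List (Tx N)} {a : Exec S} {tx : Tx N} :
    tx ∈ (l.foldl (execTx X) a).executed ↔ tx ∈ a.executed ∨ tx ∈ l := by
  induction l generalizing a with
  | nil => simp
  | cons tx' l ih => rw [List.foldl_cons, ih, mem_execTx_executed, List.mem_cons, or_assoc]

theorem mem_execBlock_executed {X : N.Reactive} {r : ActorEntity S} {B : Block N} {tx : Tx N} :
    tx ∈ (execBlock X r B).executed ↔ tx ∈ r.executed ∨ tx ∈ B := by
  rw [execBlock, mem_foldl_executed, S.mem_order]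

theorem VM.origin_run (vm : VM N) (X : N.Reactive) (m : vm.Mem) (tx : Tx N) :
    ∀ q ∈ (vm.run X m tx).2.userObjs, vm.origin q.2 = some tx :=
  vm.origin_post _ _

theorem foldl_notices {X : N.Reactive} {l : List (Tx N)} {a : Exec S} {q}
    (h : q ∈ (l.foldl (execTx X) a).notices) :
    q ∈ a.notices ∨ q.1 ∈ l ∧ q.1 ∉ a.executed ∧ q.1.IsUARA ∧
      ∀ o ∈ q.2, S.vm.origin o.2 = some q.1 := by
  induction l generalizing a with
  | nil => exact .inl h
  | cons tx l ih =>
    rw [List.foldl_cons] at h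
    rcases ih h with h | ⟨h₁, h₂, h₃⟩
    · by_cases htx : tx ∈ a.executed
      · rw [execTx, if_pos htx] at h
        exact .inl h
      · rw [execTx, if_neg htx] at h
        dsimp only at h
        split_ifs at h with hu
        · rcases h with rfl | h
          · exact .inr ⟨List.mem_cons_self, htx, hu, S.vm.origin_run _ _ _⟩
          · exact .inl h
        · exact .inl h
    · rw [mem_execTx_executed] at h₂
      exact .inr ⟨List.mem_cons_of_mem _ h₁, fun h => h₂ (.inl h), h₃⟩

/-- Within a block no transaction is run twice, since it counts as executed after the first time; so
it is reported with one set of created objects only. -/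
theorem foldl_notices_functional {X : N.Reactive} {l : List (Tx N)} {a : Exec S}
    (h₁ : ∀ q ∈ a.notices, q.1 ∈ a.executed)
    (h₂ : ∀ q ∈ a.notices, ∀ q' ∈ a.notices, q.1 = q'.1 → q = q') :
    ∀ q ∈ (l.foldl (execTx X) a).notices, ∀ q' ∈ (l.foldl (execTx X) a).notices,
      q.1 = q'.1 → q = q' := by
  induction l generalizing a with
  | nil => exact h₂
  | cons tx l ih =>
    rw [List.foldl_cons]
    by_cases htx : tx ∈ a.executed
    · rw [execTx, if_pos htx]
      exact ih h₁ h₂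
    · refine ih ?_ ?_
      · intro q hq
        rw [mem_execTx_executed]
        rw [execTx, if_neg htx] at hq
        dsimp only at hq
        split_ifs at hq
        · rcases hq with rfl | hq
          · exact .inr rfl
          · exact .inl (h₁ q hq)
        · exact .inl (h₁ q hq)
      · rw [execTx, if_neg htx]
        dsimp only
        split_ifs
        · rintro q (rfl | hq) q' (rfl | hq') he
          · rfl
          · exact absurd (h₁ q' hq') (by rw [← he]; exact htx)
          · exact absurd (h₁ q hq) (by rw [he]; exact htx)
          · exact h₂ q hq q' hq' he
        · exact h₂

theorem foldl_credits {X : N.Reactive} {l : List (Tx N)} {a : Exec S} {q}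
    (h : q ∈ (l.foldl (execTx X) a).credits) :
    q ∈ a.credits ∨ ∃ tx ∈ l, tx ∉ a.executed ∧ ¬ tx.IsUARA ∧ S.vm.origin q.2 = some tx := by
  induction l generalizing a with
  | nil => exact .inl h
  | cons tx l ih =>
    rw [List.foldl_cons] at h
    rcases ih h with h | ⟨tx', h₁, h₂, h₃⟩
    · by_cases htx : tx ∈ a.executed
      · rw [execTx, if_pos htx] at h
        exact .inl h
      · rw [execTx, if_neg htx] at h
        dsimp only at h
        split_ifs at h with hu
        · exact .inl h
        · rcases h with h | h
          · exact .inl h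
          · exact .inr ⟨tx, List.mem_cons_self, htx, hu, S.vm.origin_run _ _ _ q h⟩
    · rw [mem_execTx_executed] at h₂
      exact .inr ⟨tx', List.mem_cons_of_mem _ h₁, fun h => h₂ (.inl h), h₃⟩

theorem execBlock_congr {X : N.Reactive} {r r' : ActorEntity S} (B : Block N)
    (h₁ : r.mem = r'.mem) (h₂ : r.owned = r'.owned) (h₃ : r.executed = r'.executed) :
    execBlock X r B = execBlock X r' B := by
  unfold execBlock
  rw [h₁, h₂, h₃]

/-! ### The sequence of blocks of a reactive actor -/

theorem Run.poaCert_mono (ρ : Run S) {i j : ℕ} (hij : i ≤ j) {X k B}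
    (h : (ρ.st i).PoaCert X k B) : (ρ.st j).PoaCert X k B :=
  ρ.mono (P := fun σ => σ.PoaCert X k B) (fun k h => h.step (ρ.step k)) hij h

theorem Run.confirmed_mono (ρ : Run S) {i j : ℕ} (hij : i ≤ j) {tx}
    (h : (ρ.st i).Confirmed tx) : (ρ.st j).Confirmed tx :=
  ρ.mono (P := fun σ => σ.Confirmed tx) (fun k h => h.step (ρ.step k)) hij h

/-- The block decided in instance `k` of the POA of `X`. -/
noncomputable def Run.block (ρ : Run S) (X : N.Reactive) (k : ℕ) : Block N :=
  if h : ∃ B i, (ρ.st i).PoaCert X k B then h.choose else ∅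

theorem Run.block_eq (ρ : Run S) {i X k B} (h : (ρ.st i).PoaCert X k B) :
    ρ.block X k = B := by
  have hex : ∃ B i, (ρ.st i).PoaCert X k B := ⟨B, i, h⟩
  rw [Run.block, dif_pos hex]
  obtain ⟨j, hj⟩ := hex.choose_spec
  -- Certificates persist, so both are compared in a common later state.
  exact ρ.poaCert_unique (max i j) (ρ.poaCert_mono (le_max_right _ _) hj)
    (ρ.poaCert_mono (le_max_left _ _) h)

theorem Run.receiver_of_mem_block (ρ : Run S) {X k tx} (h : tx ∈ ρ.block X k) :
    tx.receiver = some X := by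
  by_cases hex : ∃ B i, (ρ.st i).PoaCert X k B
  · obtain ⟨B, i, hB⟩ := hex
    rw [ρ.block_eq hB] at h
    exact (ρ.poaCert_sound i hB h).1
  · rw [Run.block, dif_neg hex] at h
    simp at h

/-- The state of `X` before the execution of its `k`-th block (the fields `mem`, `owned` and
`executed` only). -/
noncomputable def Run.spec (ρ : Run S) (X : N.Reactive) : ℕ → ActorEntity S
  | 0 =>
    { created := False
      inst := 0
      started := none
      pool := ∅
      mem := S.vm.mem₀ X
      owned := S.genesisActorObjs X
      executed := ∅
      cur := Attempt.fresh N
      qcProposed := fun _ => none }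
  | k + 1 =>
    { Run.spec ρ X k with
      mem := (execBlock X (Run.spec ρ X k) (ρ.block X k)).mem
      owned := (execBlock X (Run.spec ρ X k) (ρ.block X k)).owned
      executed := (execBlock X (Run.spec ρ X k) (ρ.block X k)).executed }

/-- The outcome of the execution of the `k`-th block of `X`. -/
noncomputable def Run.out (ρ : Run S) (X : N.Reactive) (k : ℕ) : Exec S :=
  execBlock X (ρ.spec X k) (ρ.block X k)

theorem Run.mem_spec_executed (ρ : Run S) {X k tx} :
    tx ∈ (ρ.spec X k).executed ↔ ∃ m < k, tx ∈ ρ.block X m := by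
  induction k with
  | zero => simp [Run.spec]
  | succ k ih =>
    change tx ∈ (execBlock X (ρ.spec X k) (ρ.block X k)).executed ↔ _
    rw [mem_execBlock_executed, ih]
    constructor
    · rintro (⟨m, h₁, h₂⟩ | h)
      · exact ⟨m, by omega, h₂⟩
      · exact ⟨k, by omega, h⟩
    · rintro ⟨m, h₁, h₂⟩
      by_cases h : m = k
      · exact .inr (h ▸ h₂)
      · exact .inl ⟨m, by omega, h₂⟩

/-- Transactions executed in earlier blocks are skipped, so a report is produced at the first
occurrence only. -/
theorem Run.out_notices (ρ : Run S) {X k q} (h : q ∈ (ρ.out X k).notices) :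
    q.1 ∈ ρ.block X k ∧ (∀ m < k, q.1 ∉ ρ.block X m) ∧ q.1.IsUARA ∧
      ∀ o ∈ q.2, S.vm.origin o.2 = some q.1 := by
  rcases foldl_notices h with h | ⟨h₁, h₂, h₃⟩
  · exact absurd h (Set.notMem_empty _)
  · exact ⟨(S.mem_order _ _).1 h₁,
      fun m hm h => h₂ ((ρ.mem_spec_executed (k := k)).2 ⟨m, hm, h⟩), h₃⟩

theorem Run.out_credits (ρ : Run S) {X k q} (h : q ∈ (ρ.out X k).credits) :
    ∃ tx ∈ ρ.block X k, (∀ m < k, tx ∉ ρ.block X m) ∧ ¬ tx.IsUARA ∧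
      S.vm.origin q.2 = some tx := by
  rcases foldl_credits h with h | ⟨tx, h₁, h₂, h₃⟩
  · exact absurd h (Set.notMem_empty _)
  · exact ⟨tx, (S.mem_order _ _).1 h₁,
      fun m hm h => h₂ ((ρ.mem_spec_executed (k := k)).2 ⟨m, hm, h⟩), h₃⟩

/-- The receiver determines the reactive actor, first occurrence determines the block, and within a
block the report is unique. Thus the created objects depend on the transaction alone, on whichever
validator it is executed. -/
theorem Run.out_notices_unique (ρ : Run S) {X k X' k' tx e e'}
    (h : (tx, e) ∈ (ρ.out X k).notices) (h' : (tx, e') ∈ (ρ.out X' k').notices) : e = e' := by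
  obtain ⟨h₁, h₂, -⟩ := ρ.out_notices h
  obtain ⟨h₁', h₂', -⟩ := ρ.out_notices h'
  obtain rfl : X = X' := by
    have h₃ := ρ.receiver_of_mem_block h₁
    rw [ρ.receiver_of_mem_block h₁'] at h₃
    simpa using h₃.symm
  obtain rfl : k = k' := by
    rcases lt_trichotomy k k' with h₃ | h₃ | h₃
    · exact absurd h₁ (h₂' k h₃)
    · exact h₃
    · exact absurd h₁' (h₂ k' h₃)
  have := foldl_notices_functional (X := X) (l := S.order (ρ.block X k))
    (a := { mem := (ρ.spec X k).mem, owned := (ρ.spec X k).owned,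
            executed := (ρ.spec X k).executed, emitted := ∅, notices := ∅, credits := ∅,
            actors := ∅ }) (by simp) (by simp) _ h _ h' rfl
  simpa using this

/-- Every validator executes the unique certified block of each instance, deterministically. Hence
two validators with equal instance counters have the same `mem`, `owned` and `executed`. -/
theorem Run.actor_spec (ρ : Run S) (i : ℕ) (V X) :
    (((ρ.st i).loc V).actor X).mem = (ρ.spec X (((ρ.st i).loc V).actor X).inst).mem ∧
    (((ρ.st i).loc V).actor X).owned = (ρ.spec X (((ρ.st i).loc V).actor X).inst).owned ∧
    (((ρ.st i).loc V).actor X).executed =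
      (ρ.spec X (((ρ.st i).loc V).actor X).inst).executed := by
  induction i with
  | zero => rw [ρ.st_zero]; exact ⟨rfl, rfl, rfl⟩
  | succ i ih =>
    have hu := (ρ.step i).actorStep V X
    have hd := fun B => ρ.poaCert_of_decide i (V := V) (X := X) (B := B)
    generalize ((ρ.st (i + 1)).loc V).actor X = u at hu ⊢
    generalize ρ.act i = a at hu hd
    cases hu <;> try exact ih
    case poaDecide B _ _ =>
      dsimp only
      rw [execBlock_congr B ih.1 ih.2.1 ih.2.2, ← ρ.block_eq (hd B rfl)]
      exact ⟨rfl, rfl, rfl⟩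

theorem Run.mem_executed (ρ : Run S) (i : ℕ) {V X tx} :
    tx ∈ (((ρ.st i).loc V).actor X).executed ↔
      ∃ m < (((ρ.st i).loc V).actor X).inst, tx ∈ ρ.block X m := by
  rw [(ρ.actor_spec i V X).2.2, ρ.mem_spec_executed]

theorem Run.decide_eq (ρ : Run S) (i : ℕ) {V X B}
    (h : ρ.act i = .internal V (.poaDecide X B)) :
    B = ρ.block X (((ρ.st i).loc V).actor X).inst ∧
      execBlock X (((ρ.st i).loc V).actor X) B = ρ.out X (((ρ.st i).loc V).actor X).inst := by
  have h₁ := ρ.block_eq (ρ.poaCert_of_decide i h)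
  have h₂ := ρ.actor_spec i V X
  refine ⟨h₁.symm, ?_⟩
  rw [Run.out, h₁, execBlock_congr B h₂.1 h₂.2.1 h₂.2.2]

/-! ### Changes of the executed part of the state of a validator -/

/-- What a step does to the executed part of the state of `V`. -/
theorem Run.exec_step (ρ : Run S) (i : ℕ) (V : N.Validator) :
    ((∀ A, (((ρ.st (i + 1)).loc V).user A).done = (((ρ.st i).loc V).user A).done ∧
        (((ρ.st (i + 1)).loc V).user A).owned = (((ρ.st i).loc V).user A).owned ∧
        (((ρ.st (i + 1)).loc V).user A).notices = (((ρ.st i).loc V).user A).notices) ∧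
      ∀ X, (((ρ.st (i + 1)).loc V).actor X).inst = (((ρ.st i).loc V).actor X).inst ∧
        (((ρ.st (i + 1)).loc V).actor X).created = (((ρ.st i).loc V).actor X).created) ∨
    (∃ X, ρ.act i = .internal V
        (.poaDecide X (ρ.block X (((ρ.st i).loc V).actor X).inst)) ∧
      (((ρ.st i).loc V).actor X).started ≠ none ∧
      (∀ A, (((ρ.st (i + 1)).loc V).user A).done = (((ρ.st i).loc V).user A).done ∧
        (((ρ.st (i + 1)).loc V).user A).owned = (((ρ.st i).loc V).user A).owned ∪
          {o | (A, o) ∈ (ρ.out X (((ρ.st i).loc V).actor X).inst).credits} ∧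
        (((ρ.st (i + 1)).loc V).user A).notices = (((ρ.st i).loc V).user A).notices ∪
          {q | q ∈ (ρ.out X (((ρ.st i).loc V).actor X).inst).notices ∧
            ∃ sn, q.1.key = some (A, sn)}) ∧
      ∀ Y, (((ρ.st (i + 1)).loc V).actor Y).inst =
          (if Y = X then (((ρ.st i).loc V).actor X).inst + 1 else (((ρ.st i).loc V).actor Y).inst) ∧
        (((ρ.st (i + 1)).loc V).actor Y).created = ((((ρ.st i).loc V).actor Y).created ∨
          Y ∈ (ρ.out X (((ρ.st i).loc V).actor X).inst).actors)) ∨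
    (∃ A sn os c s, ρ.act i = .internal V (.execUA A sn os c s) ∧
      (((ρ.st i).loc V).user A).pobDecided sn = some (.ua A sn os c s) ∧
      S.verify (.ua A sn os c s) ∧
      (((ρ.st i).loc V).user A).done sn = none ∧ (((ρ.st i).loc V).user A).Ready sn os ∧
      (∀ A', (((ρ.st (i + 1)).loc V).user A').done = (if A' = A then
          Function.update (((ρ.st i).loc V).user A).done sn (some (.ua A sn os c s))
          else (((ρ.st i).loc V).user A').done) ∧
        (((ρ.st (i + 1)).loc V).user A').owned =
          (if A' = A then (((ρ.st i).loc V).user A).owned \ os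
            else (((ρ.st i).loc V).user A').owned) ∪
          {o | (A', o) ∈ (S.vm.runUA (.ua A sn os c s)).userObjs} ∧
        (((ρ.st (i + 1)).loc V).user A').notices = (((ρ.st i).loc V).user A').notices) ∧
      ∀ X, (((ρ.st (i + 1)).loc V).actor X).inst = (((ρ.st i).loc V).actor X).inst ∧
        (((ρ.st (i + 1)).loc V).actor X).created = ((((ρ.st i).loc V).actor X).created ∨
          X ∈ (S.vm.runUA (.ua A sn os c s)).actors)) ∨
    (∃ A sn b s e, ρ.act i = .internal V (.finishUARA A sn b s e) ∧
      (Tx.uara A sn b s, e) ∈ (((ρ.st i).loc V).user A).notices ∧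
      (((ρ.st i).loc V).user A).done sn = none ∧ (((ρ.st i).loc V).user A).Ready sn b.objs ∧
      (∀ A', (((ρ.st (i + 1)).loc V).user A').done = (if A' = A then
          Function.update (((ρ.st i).loc V).user A).done sn (some (.uara A sn b s))
          else (((ρ.st i).loc V).user A').done) ∧
        (((ρ.st (i + 1)).loc V).user A').owned =
          (if A' = A then (((ρ.st i).loc V).user A).owned \ b.objs
            else (((ρ.st i).loc V).user A').owned) ∪ {o | (A', o) ∈ e} ∧
        (((ρ.st (i + 1)).loc V).user A').notices = (((ρ.st i).loc V).user A').notices) ∧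
      ∀ X, (((ρ.st (i + 1)).loc V).actor X).inst = (((ρ.st i).loc V).actor X).inst ∧
        (((ρ.st (i + 1)).loc V).actor X).created = (((ρ.st i).loc V).actor X).created) := by
  have hu := fun A => (ρ.step i).userStep V A
  have hr := fun X => (ρ.step i).actorStep V X
  by_cases h₁ : ∃ X B, ρ.act i = .internal V (.poaDecide X B)
  · obtain ⟨X, B, ha⟩ := h₁
    obtain ⟨hB, hout⟩ := ρ.decide_eq i ha
    refine .inr (.inl ⟨X, ha.trans (by rw [← hB]), ?_, fun A => ?_, fun Y => ?_⟩)
    · have hst := ρ.step i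
      rw [ha] at hst
      exact hst.2.1
    · have hu := hu A
      rw [ha] at hu
      rw [← hout]
      generalize ((ρ.st (i + 1)).loc V).user A = u at hu ⊢
      cases hu
      case refl h => exact absurd trivial (h _ rfl)
      case poaDecide => exact ⟨rfl, rfl, rfl⟩
    · have hr := hr Y
      rw [ha] at hr
      rw [← hout]
      generalize ((ρ.st (i + 1)).loc V).actor Y = u at hr ⊢
      cases hr
      case refl h => exact absurd trivial (h _ rfl)
      case poaDecide => rw [if_pos rfl]; exact ⟨rfl, rfl⟩
      case poaDecideOther => rw [if_neg ‹Y ≠ X›]; exact ⟨rfl, rfl⟩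
  by_cases h₂ : ∃ A sn os c s, ρ.act i = .internal V (.execUA A sn os c s)
  · obtain ⟨A, sn, os, c, s, ha⟩ := h₂
    have hst := ρ.step i
    rw [ha] at hst
    obtain ⟨-, hg₁, hg₂, hg₃, hg₄, -⟩ := hst
    refine .inr (.inr (.inl ⟨A, sn, os, c, s, ha, hg₁, hg₂, hg₃, hg₄, fun A' => ?_, fun Y => ?_⟩))
    · have hu := hu A'
      rw [ha] at hu
      generalize ((ρ.st (i + 1)).loc V).user A' = u at hu ⊢
      cases hu
      case refl h => exact absurd trivial (h _ rfl)
      case execUA => exact ⟨rfl, rfl, rfl⟩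
    · have hr := hr Y
      rw [ha] at hr
      generalize ((ρ.st (i + 1)).loc V).actor Y = u at hr ⊢
      cases hr
      case refl h => exact absurd trivial (h _ rfl)
      case execUA => exact ⟨rfl, rfl⟩
  by_cases h₃ : ∃ A sn b s e, ρ.act i = .internal V (.finishUARA A sn b s e)
  · obtain ⟨A, sn, b, s, e, ha⟩ := h₃
    have hst := ρ.step i
    rw [ha] at hst
    obtain ⟨-, hg₁, hg₂, hg₃, -⟩ := hst
    refine .inr (.inr (.inr ⟨A, sn, b, s, e, ha, hg₁, hg₂, hg₃, fun A' => ?_, fun Y => ?_⟩))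
    · have hu := hu A'
      rw [ha] at hu
      generalize ((ρ.st (i + 1)).loc V).user A' = u at hu ⊢
      cases hu
      case refl h => exact absurd trivial (h _ rfl)
      case finishUARA => exact ⟨rfl, rfl, rfl⟩
    · have hr := hr Y
      rw [ha] at hr
      generalize ((ρ.st (i + 1)).loc V).actor Y = u at hr ⊢
      cases hr
      case refl h => exact ⟨rfl, rfl⟩
  refine .inl ⟨fun A => ?_, fun X => ?_⟩
  · have hu := hu A
    generalize ((ρ.st (i + 1)).loc V).user A = u at hu ⊢
    generalize ρ.act i = a at hu h₁ h₂ h₃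
    cases hu <;> try exact ⟨rfl, rfl, rfl⟩
    case poaDecide => exact absurd ⟨_, _, rfl⟩ h₁
    case execUA => exact absurd ⟨_, _, _, _, _, rfl⟩ h₂
    case finishUARA => exact absurd ⟨_, _, _, _, _, rfl⟩ h₃
  · have hr := hr X
    generalize ((ρ.st (i + 1)).loc V).actor X = u at hr ⊢
    generalize ρ.act i = a at hr h₁ h₂ h₃
    cases hr <;> try exact ⟨rfl, rfl⟩
    case poaDecide => exact absurd ⟨_, _, rfl⟩ h₁
    case poaDecideOther => exact absurd ⟨_, _, rfl⟩ h₁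
    case execUA => exact absurd ⟨_, _, _, _, _, rfl⟩ h₂

theorem Run.inst_mono (ρ : Run S) {i j : ℕ} (hij : i ≤ j) (V X) :
    (((ρ.st i).loc V).actor X).inst ≤ (((ρ.st j).loc V).actor X).inst := by
  refine ρ.mono (P := fun σ => (((ρ.st i).loc V).actor X).inst ≤ ((σ.loc V).actor X).inst)
    (fun m h => h.trans ?_) hij le_rfl
  rcases (ρ.step m).inst V X with h | h <;> omega

theorem Run.executed_mono (ρ : Run S) {i j : ℕ} (hij : i ≤ j) {V X tx}
    (h : tx ∈ (((ρ.st i).loc V).actor X).executed) :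
    tx ∈ (((ρ.st j).loc V).actor X).executed := by
  rw [ρ.mem_executed] at h ⊢
  obtain ⟨m, h₁, h₂⟩ := h
  exact ⟨m, h₁.trans_le (ρ.inst_mono hij V X), h₂⟩

theorem Run.poaCert_of_lt (ρ : Run S) (i : ℕ) {V X k}
    (h : k < (((ρ.st i).loc V).actor X).inst) : (ρ.st i).PoaCert X k (ρ.block X k) := by
  obtain ⟨B, hB⟩ := ρ.poaProof_sent i h
  obtain ⟨t, ht⟩ := hB V
  have := ρ.poaCert_of_sent i ht rfl
  rwa [ρ.block_eq this]

/-- The set of reports is expressed by the instance counters alone, which lets it be compared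
between validators; `Run.created` does the same for the existence of reactive actors, with the
executed UA transactions as additional data. -/
theorem Run.notices (ρ : Run S) (i : ℕ) {V A q} :
    q ∈ (((ρ.st i).loc V).user A).notices ↔
      (∃ X, ∃ m < (((ρ.st i).loc V).actor X).inst, q ∈ (ρ.out X m).notices) ∧
        ∃ sn, q.1.key = some (A, sn) := by
  induction i with
  | zero => rw [ρ.st_zero]; simp [System.start]
  | succ i ih =>
    rcases ρ.exec_step i V with ⟨h₁, h₂⟩ | ⟨X, -, -, h₁, h₂⟩ |
      ⟨_, _, _, _, _, -, -, -, -, -, h₁, h₂⟩ | ⟨_, _, _, _, _, -, -, -, -, h₁, h₂⟩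
    · rw [(h₁ A).2.2, ih]; simp only [(h₂ _).1]
    · rw [(h₁ A).2.2]
      simp only [(h₂ _).1]
      constructor
      · rintro (h | ⟨h, hk⟩)
        · obtain ⟨⟨Y, m, h₃, h₄⟩, hk⟩ := ih.1 h
          refine ⟨⟨Y, m, ?_, h₄⟩, hk⟩
          split_ifs with hY
          · subst hY; omega
          · exact h₃
        · exact ⟨⟨X, _, by simp, h⟩, hk⟩
      · rintro ⟨⟨Y, m, h₃, h₄⟩, hk⟩
        split_ifs at h₃ with hY
        · subst hY
          by_cases hm : m = (((ρ.st i).loc V).actor Y).inst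
          · subst hm; exact .inr ⟨h₄, hk⟩
          · exact .inl (ih.2 ⟨⟨Y, m, by omega, h₄⟩, hk⟩)
        · exact .inl (ih.2 ⟨⟨Y, m, h₃, h₄⟩, hk⟩)
    · rw [(h₁ A).2.2, ih]; simp only [(h₂ _).1]
    · rw [(h₁ A).2.2, ih]; simp only [(h₂ _).1]

theorem Run.created (ρ : Run S) (i : ℕ) {V X} :
    (((ρ.st i).loc V).actor X).created ↔ X ∈ S.genesisActors ∨
      (∃ A sn os c s, (((ρ.st i).loc V).user A).done sn = some (.ua A sn os c s) ∧
        X ∈ (S.vm.runUA (.ua A sn os c s)).actors) ∨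
      ∃ Y, ∃ m < (((ρ.st i).loc V).actor Y).inst, X ∈ (ρ.out Y m).actors := by
  induction i with
  | zero => rw [ρ.st_zero]; simp [System.start]
  | succ i ih =>
    rcases ρ.exec_step i V with ⟨h₁, h₂⟩ | ⟨Z, -, -, h₁, h₂⟩ |
      ⟨A₀, sn₀, os₀, c₀, s₀, -, -, -, hn, -, h₁, h₂⟩ | ⟨A₀, sn₀, b₀, s₀, e₀, -, -, hn, -, h₁, h₂⟩
    · rw [(h₂ X).2, ih]; simp only [(h₂ _).1, (h₁ _).1]
    · rw [(h₂ X).2, ih]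
      simp only [(h₂ _).1, (h₁ _).1]
      rw [or_assoc, or_assoc]
      refine or_congr_right (or_congr_right ?_)
      constructor
      · rintro (⟨Y, m, h₃, h₄⟩ | h)
        · refine ⟨Y, m, ?_, h₄⟩
          split_ifs with hY
          · subst hY; omega
          · exact h₃
        · exact ⟨Z, _, by simp, h⟩
      · rintro ⟨Y, m, h₃, h₄⟩
        split_ifs at h₃ with hY
        · subst hY
          by_cases hm : m = (((ρ.st i).loc V).actor Y).inst
          · subst hm; exact .inr h₄
          · exact .inl ⟨Y, m, by omega, h₄⟩
        · exact .inl ⟨Y, m, h₃, h₄⟩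
    · rw [(h₂ X).2, ih]
      simp only [(h₂ _).1, (h₁ _).1]
      constructor
      · rintro ((h | ⟨A, sn, os, c, s, h₃, h₄⟩ | h) | h)
        · exact .inl h
        · refine .inr (.inl ⟨A, sn, os, c, s, ?_, h₄⟩)
          split_ifs with hA
          · subst hA
            rw [Function.update_of_ne, h₃]
            rintro rfl
            simp [hn] at h₃
          · exact h₃
        · exact .inr (.inr h)
        · exact .inr (.inl ⟨A₀, sn₀, os₀, c₀, s₀, by simp, h⟩)
      · rintro (h | ⟨A, sn, os, c, s, h₃, h₄⟩ | h)
        · exact .inl (.inl h)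
        · split_ifs at h₃ with hA
          · subst hA
            by_cases hsn : sn = sn₀
            · subst hsn
              simp only [Function.update_self, Option.some.injEq] at h₃
              cases h₃
              exact .inr h₄
            · rw [Function.update_of_ne hsn] at h₃
              exact .inl (.inr (.inl ⟨A, sn, os, c, s, h₃, h₄⟩))
          · exact .inl (.inr (.inl ⟨A, sn, os, c, s, h₃, h₄⟩))
        · exact .inl (.inr (.inr h))
    · rw [(h₂ X).2, ih]
      simp only [(h₂ _).1, (h₁ _).1]
      refine or_congr_right (or_congr_left ?_)
      refine exists_congr fun A => exists_congr fun sn => exists_congr fun os =>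
        exists_congr fun c => exists_congr fun s => and_congr_left fun _ => ?_
      split_ifs with hA
      · subst hA
        by_cases hsn : sn = sn₀
        · subst hsn; simp [hn]
        · rw [Function.update_of_ne hsn]
      · rfl

/-! ### Executed user transactions -/

/-- Execution requires a decision in Parallel Optimistic Broadcast or a report from a decided block,
and both carry a confirmation; the execution preconditions supply the predecessor. -/
theorem Run.done (ρ : Run S) (i : ℕ) {V A sn tx} :
    (((ρ.st i).loc V).user A).done sn = some tx →
      tx.key = some (A, sn) ∧ (ρ.st i).Confirmed tx ∧
      (∀ m, sn = m + 1 → ∃ tx', (((ρ.st i).loc V).user A).done m = some tx') ∧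
      ((∃ os c s, tx = .ua A sn os c s) ∨ ∃ b s e X m, tx = .uara A sn b s ∧
        m < (((ρ.st i).loc V).actor X).inst ∧ (tx, e) ∈ (ρ.out X m).notices) := by
  induction i with
  | zero => rw [ρ.st_zero]; simp [System.start]
  | succ i ih =>
    intro h
    have ih' : (((ρ.st i).loc V).user A).done sn = some tx →
      tx.key = some (A, sn) ∧ (ρ.st (i + 1)).Confirmed tx ∧
      (∀ m, sn = m + 1 → ∃ tx', (((ρ.st (i + 1)).loc V).user A).done m = some tx') ∧
      ((∃ os c s, tx = .ua A sn os c s) ∨ ∃ b s e X m, tx = .uara A sn b s ∧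
        m < (((ρ.st (i + 1)).loc V).actor X).inst ∧ (tx, e) ∈ (ρ.out X m).notices) := by
      intro h
      obtain ⟨h₁, h₂, h₃, h₄⟩ := ih h
      refine ⟨h₁, h₂.step (ρ.step i), fun m hm => ?_, h₄.imp_right ?_⟩
      · obtain ⟨tx', h'⟩ := h₃ m hm
        exact ⟨tx', (ρ.step i).done_mono h'⟩
      · rintro ⟨b, s, e, X, m, h₅, h₆, h₇⟩
        exact ⟨b, s, e, X, m, h₅, h₆.trans_le (ρ.inst_mono (Nat.le_succ i) V X), h₇⟩
    have hready : ∀ {os}, (((ρ.st i).loc V).user A).Ready sn os →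
        ∀ m, sn = m + 1 → ∃ tx', (((ρ.st (i + 1)).loc V).user A).done m = some tx' := by
      intro os hr m hm
      obtain ⟨tx', h'⟩ := Option.ne_none_iff_exists'.1 (hr.1 m hm)
      exact ⟨tx', (ρ.step i).done_mono h'⟩
    rcases ρ.exec_step i V with ⟨h₁, h₂⟩ | ⟨Z, -, -, h₁, h₂⟩ |
      ⟨A₀, sn₀, os₀, c₀, s₀, -, hd, hv, hn, hr, h₁, h₂⟩ |
      ⟨A₀, sn₀, b₀, s₀, e₀, -, he, hn, hr, h₁, h₂⟩
    · rw [(h₁ A).1] at h; exact ih' h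
    · rw [(h₁ A).1] at h; exact ih' h
    · have h₀ := h
      rw [(h₁ A).1] at h
      split_ifs at h with hA
      · subst hA
        by_cases hsn : sn = sn₀
        · subst hsn
          simp only [Function.update_self, Option.some.injEq] at h
          subst h
          obtain ⟨hk, hc⟩ := ρ.pobDecided i hd
          exact ⟨hk, (ρ.confirmed_of_pobCert i hc).step (ρ.step i), hready hr,
            .inl ⟨_, _, _, rfl⟩⟩
        · rw [Function.update_of_ne hsn] at h
          exact ih' h
      · exact ih' h
    · rw [(h₁ A).1] at h
      split_ifs at h with hA
      · subst hA
        by_cases hsn : sn = sn₀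
        · subst hsn
          simp only [Function.update_self, Option.some.injEq] at h
          subst h
          obtain ⟨⟨X, m, h₃, h₄⟩, -⟩ := (ρ.notices i).1 he
          have h₅ := ρ.poaCert_sound i (ρ.poaCert_of_lt i h₃) (ρ.out_notices h₄).1
          refine ⟨rfl, (h₅.2 ⟨_, _, _, _, rfl⟩).step (ρ.step i), hready hr,
            .inr ⟨_, _, _, X, m, rfl, ?_, h₄⟩⟩
          rw [(h₂ X).1]
          exact h₃
        · rw [Function.update_of_ne hsn] at h
          exact ih' h
      · exact ih' h

theorem Run.done_of_le (ρ : Run S) (i : ℕ) {V A m sn tx} (hm : m ≤ sn)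
    (h : (((ρ.st i).loc V).user A).done sn = some tx) :
    ∃ tx', (((ρ.st i).loc V).user A).done m = some tx' := by
  induction sn generalizing tx with
  | zero => obtain rfl : m = 0 := by omega
            exact ⟨tx, h⟩
  | succ sn ih =>
    by_cases hs : m = sn + 1
    · subst hs; exact ⟨tx, h⟩
    · obtain ⟨tx', h'⟩ := (ρ.done i h).2.2.1 sn rfl
      exact ih (by omega) h'

/-! ### Ownership -/

/-- The object `o` was given to `V.A` in the beginning or by the execution of a transaction. -/
def Run.Credited (ρ : Run S) (i : ℕ) (V : N.Validator) (A : N.User) (o : N.Obj) : Prop :=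
  (A, o) ∈ S.genesisUserObjs ∨
  (∃ A' sn os c s, (((ρ.st i).loc V).user A').done sn = some (.ua A' sn os c s) ∧
    (A, o) ∈ (S.vm.runUA (.ua A' sn os c s)).userObjs) ∨
  (∃ A' sn tx X m e, (((ρ.st i).loc V).user A').done sn = some tx ∧
    (tx, e) ∈ (ρ.out X m).notices ∧ (A, o) ∈ e) ∨
  ∃ X, ∃ m < (((ρ.st i).loc V).actor X).inst, (A, o) ∈ (ρ.out X m).credits

/-- The object `o` was consumed by a transaction executed by `V.A`. -/
def Run.Consumed (ρ : Run S) (i : ℕ) (V : N.Validator) (A : N.User) (o : N.Obj) : Prop :=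
  ∃ sn tx, (((ρ.st i).loc V).user A).done sn = some tx ∧ o ∈ tx.objs

theorem Run.Credited.mono {ρ : Run S} {i j : ℕ} {V A o} (hij : i ≤ j)
    (h : ρ.Credited i V A o) : ρ.Credited j V A o := by
  rcases h with h | ⟨A', sn, os, c, s, h₁, h₂⟩ | ⟨A', sn, tx, X, m, e, h₁, h₂⟩ | ⟨X, m, h₁, h₂⟩
  · exact .inl h
  · exact .inr (.inl ⟨A', sn, os, c, s, ρ.done_mono hij h₁, h₂⟩)
  · exact .inr (.inr (.inl ⟨A', sn, tx, X, m, e, ρ.done_mono hij h₁, h₂⟩))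
  · exact .inr (.inr (.inr ⟨X, m, h₁.trans_le (ρ.inst_mono hij V X), h₂⟩))

/-- A created object remembers its creator. The creator is either a user transaction executed at the
entity of its sender or an RA-RA transaction in a decided block. -/
theorem Run.Credited.origin {ρ : Run S} {i V A o} (h : ρ.Credited i V A o) :
    S.vm.origin o = none ∨
    (∃ A' sn tx, (((ρ.st i).loc V).user A').done sn = some tx ∧ S.vm.origin o = some tx) ∨
    ∃ X, ∃ m < (((ρ.st i).loc V).actor X).inst, ∃ tx ∈ ρ.block X m, ¬ tx.IsUARA ∧
      S.vm.origin o = some tx := by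
  rcases h with h | ⟨A', sn, os, c, s, h₁, h₂⟩ | ⟨A', sn, tx, X, m, e, h₁, h₂, h₃⟩ |
    ⟨X, m, h₁, h₂⟩
  · exact .inl (S.genesis_origin _ h)
  · exact .inr (.inl ⟨A', sn, _, h₁, S.vm.origin_runUA _ _ h₂⟩)
  · exact .inr (.inl ⟨A', sn, tx, h₁, (ρ.out_notices h₂).2.2.2 _ h₃⟩)
  · obtain ⟨tx, h₃, -, h₄, h₅⟩ := ρ.out_credits h₂
    exact .inr (.inr ⟨X, m, h₁, tx, h₃, h₄, h₅⟩)

/-- Objects created by a user transaction cannot circulate at `V` before the entity of its sender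
has executed it: UA-RA transactions deliver their objects only then, through the report. -/
theorem Run.not_credited_of_done_eq_none (ρ : Run S) {i V A A' sn o tx}
    (hk : tx.key = some (A', sn)) (hn : (((ρ.st i).loc V).user A').done sn = none)
    (ho : S.vm.origin o = some tx) : ¬ ρ.Credited i V A o := by
  intro h
  rcases h.origin with h | ⟨A₁, sn₁, tx₁, h₁, h₂⟩ | ⟨X, m, -, tx₁, h₁, h₂, h₃⟩
  · simp [ho] at h
  · rw [ho, Option.some.injEq] at h₂
    subst h₂
    have := (ρ.done i h₁).1
    rw [hk] at this
    cases this
    simp [hn] at h₁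
  · rw [ho, Option.some.injEq] at h₃
    subst h₃
    exact h₂ (Tx.isUARA_of_receiver (ρ.receiver_of_mem_block h₁) hk)

/-- Ownership becomes independent of the order of executions. The point is that a newly credited
object was not consumed before: whatever is consumed was credited earlier, whereas a new object is
not. -/
theorem Run.owned_iff (ρ : Run S) (i : ℕ) (V) :
    (∀ A o, ρ.Consumed i V A o → ρ.Credited i V A o) ∧
    ∀ A o, o ∈ (((ρ.st i).loc V).user A).owned ↔ ρ.Credited i V A o ∧ ¬ ρ.Consumed i V A o := by
  induction i with
  | zero =>
    unfold Run.Consumed Run.Credited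
    rw [ρ.st_zero]
    simp [System.start]
  | succ i ih =>
    obtain ⟨ih₁, ih₂⟩ := ih
    -- Common treatment of the two rules by which a user entity applies a transaction, a decided UA
    -- transaction or a reported UA-RA transaction; `new` is the set of created objects.
    have key : ∀ A₀ sn₀ tx₀ objs (new : Set (N.User × N.Obj)),
        tx₀.key = some (A₀, sn₀) → tx₀.objs = objs →
        (((ρ.st i).loc V).user A₀).done sn₀ = none →
        (((ρ.st i).loc V).user A₀).Ready sn₀ objs →
        (∀ q ∈ new, S.vm.origin q.2 = some tx₀) →
        (∀ A, (((ρ.st (i + 1)).loc V).user A).done = (if A = A₀ then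
          Function.update (((ρ.st i).loc V).user A₀).done sn₀ (some tx₀)
          else (((ρ.st i).loc V).user A).done) ∧
          (((ρ.st (i + 1)).loc V).user A).owned =
            (if A = A₀ then (((ρ.st i).loc V).user A₀).owned \ objs
              else (((ρ.st i).loc V).user A).owned) ∪ {o | (A, o) ∈ new}) →
        (∀ A o, ρ.Credited (i + 1) V A o ↔ ρ.Credited i V A o ∨ (A, o) ∈ new) →
        (∀ A o, ρ.Consumed (i + 1) V A o → ρ.Credited (i + 1) V A o) ∧
        ∀ A o, o ∈ (((ρ.st (i + 1)).loc V).user A).owned ↔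
          ρ.Credited (i + 1) V A o ∧ ¬ ρ.Consumed (i + 1) V A o := by
      intro A₀ sn₀ tx₀ objs new hk hobjs hn hr hnew h₁ hcred
      subst hobjs
      have hcons : ∀ A o, ρ.Consumed (i + 1) V A o ↔
          ρ.Consumed i V A o ∨ A = A₀ ∧ o ∈ tx₀.objs := by
        intro A o
        unfold Run.Consumed
        rw [(h₁ A).1]
        constructor
        · rintro ⟨sn, tx, h, ho⟩
          split_ifs at h with hA
          · subst hA
            by_cases hsn : sn = sn₀
            · subst hsn
              simp only [Function.update_self, Option.some.injEq] at h
              subst h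
              exact .inr ⟨rfl, ho⟩
            · rw [Function.update_of_ne hsn] at h
              exact .inl ⟨sn, tx, h, ho⟩
          · exact .inl ⟨sn, tx, h, ho⟩
        · rintro (⟨sn, tx, h, ho⟩ | ⟨rfl, ho⟩)
          · refine ⟨sn, tx, ?_, ho⟩
            split_ifs with hA
            · subst hA
              rw [Function.update_of_ne, h]
              rintro rfl
              simp [hn] at h
            · exact h
          · exact ⟨sn₀, tx₀, by simp, ho⟩
      have hobjs : ∀ o ∈ tx₀.objs, ρ.Credited i V A₀ o := fun o ho => ((ih₂ _ _).1 (hr.2 ho)).1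
      have hfresh : ∀ A o, (A, o) ∈ new → ¬ ρ.Credited i V A o := fun A o h =>
        ρ.not_credited_of_done_eq_none hk hn (hnew _ h)
      refine ⟨fun A o h => ?_, fun A o => ?_⟩
      · rw [hcred]
        rcases (hcons A o).1 h with h | ⟨rfl, h⟩
        · exact .inl (ih₁ A o h)
        · exact .inl (hobjs o h)
      · rw [hcons, hcred, (h₁ A).2]
        constructor
        · rintro (h | h)
          · split_ifs at h with hA
            · subst hA
              have := (ih₂ _ _).1 h.1
              exact ⟨.inl this.1, fun h' => h'.elim this.2 fun h' => h.2 h'.2⟩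
            · have := (ih₂ _ _).1 h
              exact ⟨.inl this.1, fun h' => h'.elim this.2 fun h' => hA h'.1⟩
          · refine ⟨.inr h, ?_⟩
            rintro (h' | ⟨rfl, h'⟩)
            · exact hfresh A o h (ih₁ A o h')
            · exact hfresh A o h (hobjs o h')
        · rintro ⟨h | h, h'⟩
          · left
            rw [not_or] at h'
            have := (ih₂ A o).2 ⟨h, h'.1⟩
            split_ifs with hA
            · subst hA; exact ⟨this, fun ho => h'.2 ⟨rfl, ho⟩⟩
            · exact this
          · exact .inr h
    rcases ρ.exec_step i V with ⟨h₁, h₂⟩ | ⟨Z, -, -, h₁, h₂⟩ |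
      ⟨A₀, sn₀, os₀, c₀, s₀, -, hd, hv, hn, hr, h₁, h₂⟩ |
      ⟨A₀, sn₀, b₀, s₀, e₀, -, he, hn, hr, h₁, h₂⟩
    · unfold Run.Consumed Run.Credited at ih₁ ih₂ ⊢
      simp only [(h₁ _).1, (h₁ _).2.1, (h₂ _).1]
      exact ⟨ih₁, ih₂⟩
    · have hcred : ∀ A o, ρ.Credited (i + 1) V A o ↔ ρ.Credited i V A o ∨
          (A, o) ∈ (ρ.out Z (((ρ.st i).loc V).actor Z).inst).credits := by
        intro A o
        constructor
        · unfold Run.Credited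
          simp only [(h₁ _).1, (h₂ _).1]
          rintro (h | h | h | ⟨X, m, hm, h⟩)
          · exact .inl (.inl h)
          · exact .inl (.inr (.inl h))
          · exact .inl (.inr (.inr (.inl h)))
          · split_ifs at hm with hX
            · subst hX
              by_cases hm' : m = (((ρ.st i).loc V).actor X).inst
              · subst hm'; exact .inr h
              · exact .inl (.inr (.inr (.inr ⟨X, m, by omega, h⟩)))
            · exact .inl (.inr (.inr (.inr ⟨X, m, hm, h⟩)))
        · rintro (h | h)
          · exact h.mono (Nat.le_succ i)
          · refine .inr (.inr (.inr ⟨Z, _, ?_, h⟩))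
            rw [(h₂ Z).1]
            simp
      have hcons : ∀ A o, ρ.Consumed (i + 1) V A o ↔ ρ.Consumed i V A o := by
        intro A o
        unfold Run.Consumed
        rw [(h₁ A).1]
      refine ⟨fun A o h => ?_, fun A o => ?_⟩
      · rw [hcred]; rw [hcons] at h; exact .inl (ih₁ A o h)
      · rw [hcons, hcred, (h₁ A).2.1, Set.mem_union, ih₂]
        constructor
        · rintro (h | h)
          · exact ⟨.inl h.1, h.2⟩
          -- The creator of the object is an RA-RA transaction executed for the first time in this
          -- block. If the object had been consumed, it would have been credited before, so its
          -- creator would be a user transaction or lie in an earlier block of the same actor.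
          · refine ⟨.inr h, fun hc => ?_⟩
            obtain ⟨tx, h₃, h₄, h₅, h₆⟩ := ρ.out_credits h
            rcases (ih₁ A o hc).origin with h₇ | ⟨A', sn, tx', h₇, h₈⟩ |
              ⟨X, m, hm, tx', h₇, -, h₈⟩
            · simp [h₇] at h₆
            · rw [h₈, Option.some.injEq] at h₆
              subst h₆
              exact h₅ (Tx.isUARA_of_receiver (ρ.receiver_of_mem_block h₃) (ρ.done i h₇).1)
            · rw [h₈, Option.some.injEq] at h₆
              subst h₆
              have h₉ := ρ.receiver_of_mem_block h₃
              rw [ρ.receiver_of_mem_block h₇, Option.some.injEq] at h₉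
              subst h₉
              exact h₄ m hm h₇
        · rintro ⟨h | h, h'⟩
          · exact .inl ⟨h, h'⟩
          · exact .inr h
    · refine key A₀ sn₀ (.ua A₀ sn₀ os₀ c₀ s₀) os₀ _ rfl rfl hn hr (S.vm.origin_runUA _)
        (fun A => ⟨(h₁ A).1, (h₁ A).2.1⟩) fun A o => ?_
      constructor
      · unfold Run.Credited
        simp only [(h₁ _).1, (h₂ _).1]
        rintro (h | ⟨A', sn, os, c, s, h₃, h₄⟩ | ⟨A', sn, tx, X, m, e, h₃, h₄⟩ | h)
        · exact .inl (.inl h)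
        · split_ifs at h₃ with hA
          · subst hA
            by_cases hsn : sn = sn₀
            · subst hsn
              simp only [Function.update_self, Option.some.injEq] at h₃
              cases h₃
              exact .inr h₄
            · rw [Function.update_of_ne hsn] at h₃
              exact .inl (.inr (.inl ⟨_, sn, os, c, s, h₃, h₄⟩))
          · exact .inl (.inr (.inl ⟨_, sn, os, c, s, h₃, h₄⟩))
        · split_ifs at h₃ with hA
          · subst hA
            by_cases hsn : sn = sn₀
            · subst hsn
              simp only [Function.update_self, Option.some.injEq] at h₃
              subst h₃
              obtain ⟨_, _, _, _, h₅⟩ := (ρ.out_notices h₄.1).2.2.1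
              cases h₅
            · rw [Function.update_of_ne hsn] at h₃
              exact .inl (.inr (.inr (.inl ⟨_, sn, tx, X, m, e, h₃, h₄⟩)))
          · exact .inl (.inr (.inr (.inl ⟨_, sn, tx, X, m, e, h₃, h₄⟩)))
        · exact .inl (.inr (.inr (.inr h)))
      · rintro (h | h)
        · exact h.mono (Nat.le_succ i)
        · refine .inr (.inl ⟨A₀, sn₀, os₀, c₀, s₀, ?_, h⟩)
          rw [(h₁ A₀).1]
          simp
    · obtain ⟨⟨X₀, m₀, -, he⟩, -⟩ := (ρ.notices i).1 he
      refine key A₀ sn₀ (.uara A₀ sn₀ b₀ s₀) b₀.objs e₀ rfl rfl hn hr (ρ.out_notices he).2.2.2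
        (fun A => ⟨(h₁ A).1, (h₁ A).2.1⟩) fun A o => ?_
      constructor
      · unfold Run.Credited
        simp only [(h₁ _).1, (h₂ _).1]
        rintro (h | ⟨A', sn, os, c, s, h₃, h₄⟩ | ⟨A', sn, tx, X, m, e, h₃, h₄⟩ | h)
        · exact .inl (.inl h)
        · split_ifs at h₃ with hA
          · subst hA
            by_cases hsn : sn = sn₀
            · subst hsn
              simp at h₃
            · rw [Function.update_of_ne hsn] at h₃
              exact .inl (.inr (.inl ⟨_, sn, os, c, s, h₃, h₄⟩))
          · exact .inl (.inr (.inl ⟨_, sn, os, c, s, h₃, h₄⟩))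
        · split_ifs at h₃ with hA
          · subst hA
            by_cases hsn : sn = sn₀
            · subst hsn
              simp only [Function.update_self, Option.some.injEq] at h₃
              subst h₃
              obtain rfl := ρ.out_notices_unique he h₄.1
              exact .inr h₄.2
            · rw [Function.update_of_ne hsn] at h₃
              exact .inl (.inr (.inr (.inl ⟨_, sn, tx, X, m, e, h₃, h₄⟩)))
          · exact .inl (.inr (.inr (.inl ⟨_, sn, tx, X, m, e, h₃, h₄⟩)))
        · exact .inl (.inr (.inr (.inr h)))
      · rintro (h | h)
        · exact h.mono (Nat.le_succ i)
        · refine .inr (.inr (.inl ⟨A₀, sn₀, _, X₀, m₀, e₀, ?_, he, h⟩))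
          rw [(h₁ A₀).1]
          simp

/-! ### Pools -/

theorem Run.inst_eq_of_ne_decide (ρ : Run S) (i : ℕ) {V}
    (h : ∀ X B, ρ.act i ≠ .internal V (.poaDecide X B)) (X) :
    (((ρ.st (i + 1)).loc V).actor X).inst = (((ρ.st i).loc V).actor X).inst := by
  rcases (ρ.step i).inst V X with h₁ | ⟨-, B, h₁⟩
  · exact h₁.1
  · exact absurd h₁ (h X B)

theorem Run.not_executed_of_pool (ρ : Run S) (i : ℕ) {V X tx} :
    tx ∈ (((ρ.st i).loc V).actor X).pool → tx ∉ (((ρ.st i).loc V).actor X).executed := by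
  induction i with
  | zero => rw [ρ.st_zero]; simp [System.start]
  | succ i ih =>
    have hu := (ρ.step i).actorStep V X
    generalize ((ρ.st (i + 1)).loc V).actor X = u at hu ⊢
    generalize ρ.act i = a at hu
    cases hu <;> try exact ih
    case offer A sn b s _ _ _ _ =>
      dsimp only
      split_ifs with h
      · exact ih
      · rw [Finset.mem_insert]
        rintro (rfl | h')
        · exact h
        · exact ih h'
    case poaDecide B _ _ =>
      simp only [Finset.mem_union, Finset.mem_sdiff, Finset.mem_filter]
      rintro (⟨h₁, h₂⟩ | ⟨-, -, h⟩)
      · rw [mem_execBlock_executed, not_or]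
        exact ⟨ih h₁, h₂⟩
      · exact h
    case poaDecideOther =>
      simp only [Finset.mem_union, Finset.mem_filter]
      rintro (h | ⟨-, -, h⟩)
      · exact ih h
      · exact h

/-- The RA-RA part of a pool is a function of the instance counters: emitted by some decided block
and not yet executed. A validator that has caught up therefore has the leader's RA-RA transactions,
except those executed meanwhile. -/
theorem Run.mem_pool_rara (ρ : Run S) (i : ℕ) {V X tx} (htx : tx.IsRARA) :
    tx ∈ (((ρ.st i).loc V).actor X).pool ↔ tx.receiver = some X ∧
      (∃ Y, ∃ m < (((ρ.st i).loc V).actor Y).inst, tx ∈ (ρ.out Y m).emitted) ∧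
      tx ∉ (((ρ.st i).loc V).actor X).executed := by
  induction i with
  | zero => rw [ρ.st_zero]; simp [System.start]
  | succ i ih =>
    have hu := (ρ.step i).actorStep V X
    by_cases hd : ∃ Y B, ρ.act i = .internal V (.poaDecide Y B)
    · obtain ⟨Y, B, ha⟩ := hd
      obtain ⟨-, hout⟩ := ρ.decide_eq i ha
      have hinst : (∃ Z, ∃ m < (((ρ.st (i + 1)).loc V).actor Z).inst, tx ∈ (ρ.out Z m).emitted) ↔
          (∃ Z, ∃ m < (((ρ.st i).loc V).actor Z).inst, tx ∈ (ρ.out Z m).emitted) ∨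
            tx ∈ (ρ.out Y (((ρ.st i).loc V).actor Y).inst).emitted := by
        have hY : (((ρ.st (i + 1)).loc V).actor Y).inst =
            (((ρ.st i).loc V).actor Y).inst + 1 := by
          have hu := (ρ.step i).actorStep V Y
          rw [ha] at hu
          generalize ((ρ.st (i + 1)).loc V).actor Y = u at hu ⊢
          cases hu
          case refl h => exact absurd trivial (h _ rfl)
          case poaDecide => rfl
          case poaDecideOther => exact absurd rfl ‹Y ≠ Y›
        constructor
        · rintro ⟨Z, m, hm, h⟩
          by_cases hm' : m < (((ρ.st i).loc V).actor Z).inst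
          · exact .inl ⟨Z, m, hm', h⟩
          · rcases (ρ.step i).inst V Z with h₁ | ⟨h₁, B', h₂⟩
            · omega
            · rw [ha] at h₂
              cases h₂
              obtain rfl : m = (((ρ.st i).loc V).actor Y).inst := by omega
              exact .inr h
        · rintro (⟨Z, m, hm, h⟩ | h)
          · exact ⟨Z, m, hm.trans_le (ρ.inst_mono (Nat.le_succ i) V Z), h⟩
          · exact ⟨Y, _, by omega, h⟩
      rw [hinst]
      rw [ha] at hu
      rw [← hout]
      generalize ((ρ.st (i + 1)).loc V).actor X = u at hu ⊢
      cases hu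
      case refl h => exact absurd trivial (h _ rfl)
      case poaDecide =>
        simp only [Finset.mem_union, Finset.mem_sdiff, Finset.mem_filter, ih,
          mem_execBlock_executed]
        clear hinst ih hout
        generalize (∃ Y, ∃ m < (((ρ.st i).loc V).actor Y).inst, tx ∈ (ρ.out Y m).emitted) = p
        constructor
        · rintro (⟨⟨h₁, h₂, h₃⟩, h₄⟩ | ⟨h₁, h₂, h₃⟩)
          · exact ⟨h₁, .inl h₂, fun h => h.elim h₃ h₄⟩
          · exact ⟨h₂, .inr h₁, h₃⟩
        · rintro ⟨h₁, h₂ | h₂, h₃⟩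
          · exact .inl ⟨⟨h₁, h₂, fun h => h₃ (.inl h)⟩, fun h => h₃ (.inr h)⟩
          · exact .inr ⟨h₂, h₁, h₃⟩
      case poaDecideOther =>
        simp only [Finset.mem_union, Finset.mem_filter, ih]
        clear hinst ih hout
        generalize (∃ Y, ∃ m < (((ρ.st i).loc V).actor Y).inst, tx ∈ (ρ.out Y m).emitted) = p
        constructor
        · rintro (⟨h₁, h₂, h₃⟩ | ⟨h₁, h₂, h₃⟩)
          · exact ⟨h₁, .inl h₂, h₃⟩
          · exact ⟨h₂, .inr h₁, h₃⟩
        · rintro ⟨h₁, h₂ | h₂, h₃⟩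
          · exact .inl ⟨h₁, h₂, h₃⟩
          · exact .inr ⟨h₂, h₁, h₃⟩
    · have hinst := ρ.inst_eq_of_ne_decide i (V := V) (fun X B h => hd ⟨X, B, h⟩)
      simp only [hinst]
      generalize ((ρ.st (i + 1)).loc V).actor X = u at hu ⊢
      generalize ρ.act i = a at hu hd
      cases hu <;> try exact ih
      case offer A sn b s _ _ _ _ =>
        rw [← ih]
        dsimp only
        split_ifs with h
        · rfl
        · rw [Finset.mem_insert]
          refine or_iff_right ?_
          rintro rfl
          obtain ⟨_, _, h⟩ := htx
          cases h
      case poaDecide => exact absurd ⟨_, _, rfl⟩ hd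
      case poaDecideOther => exact absurd ⟨_, _, rfl⟩ hd

/-- Ownership at the time of entering the pool is kept in the weaker form of being credited, because
this persists and can be carried over to other validators. -/
theorem Run.pool_uara (ρ : Run S) (i : ℕ) {V X A sn b s} :
    Tx.uara A sn b s ∈ (((ρ.st i).loc V).actor X).pool →
      (∀ m, sn = m + 1 → ∃ tx, (((ρ.st i).loc V).user A).done m = some tx) ∧
      ∀ o ∈ b.objs, ρ.Credited i V A o := by
  induction i with
  | zero => rw [ρ.st_zero]; simp [System.start]
  | succ i ih =>
    intro h
    suffices (∀ m, sn = m + 1 → ∃ tx, (((ρ.st i).loc V).user A).done m = some tx) ∧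
        ∀ o ∈ b.objs, ρ.Credited i V A o from
      ⟨fun m hm => (this.1 m hm).imp fun tx h => (ρ.step i).done_mono h,
        fun o ho => (this.2 o ho).mono (Nat.le_succ i)⟩
    have hu := (ρ.step i).actorStep V X
    generalize ((ρ.st (i + 1)).loc V).actor X = u at hu h
    generalize ρ.act i = a at hu
    cases hu <;> try exact ih h
    case offer A' sn' b' s' _ _ _ hr =>
      dsimp only at h
      split_ifs at h
      · exact ih h
      · rw [Finset.mem_insert] at h
        rcases h with h | h
        · cases h
          exact ⟨fun m hm => Option.ne_none_iff_exists'.1 (hr.1 m hm),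
            fun o ho => (((ρ.owned_iff i V).2 A o).1 (hr.2 ho)).1⟩
        · exact ih h
    case poaDecide B _ _ =>
      simp only [Finset.mem_union, Finset.mem_sdiff, Finset.mem_filter] at h
      rcases h with h | h
      · exact ih h.1
      · obtain ⟨_, _, h⟩ := isRARA_of_mem_emitted h.1
        cases h
    case poaDecideOther Y B _ _ =>
      simp only [Finset.mem_union, Finset.mem_filter] at h
      rcases h with h | h
      · exact ih h
      · obtain ⟨_, _, h⟩ := isRARA_of_mem_emitted h.1
        cases h

theorem Run.pool_or_executed (ρ : Run S) (i : ℕ) {V X tx}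
    (h : tx ∈ (((ρ.st i).loc V).actor X).pool ∨ tx ∈ (((ρ.st i).loc V).actor X).executed) :
    tx ∈ (((ρ.st (i + 1)).loc V).actor X).pool ∨
      tx ∈ (((ρ.st (i + 1)).loc V).actor X).executed := by
  have hu := (ρ.step i).actorStep V X
  generalize ((ρ.st (i + 1)).loc V).actor X = u at hu ⊢
  generalize ρ.act i = a at hu
  cases hu <;> try exact h
  case offer =>
    refine h.imp_left fun h => ?_
    dsimp only
    split_ifs
    · exact h
    · exact Finset.mem_insert_of_mem h
  case poaDecide B _ _ =>
    simp only [Finset.mem_union, Finset.mem_sdiff, mem_execBlock_executed]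
    tauto
  case poaDecideOther =>
    simp only [Finset.mem_union]
    tauto

/-- On reception the FP-lock succeeds, since only this issued transaction can occupy the slot. Then
`awaiting` is left only towards the pool, unless the transaction is executed already, and the pool
only by execution. -/
theorem Run.received_uara (ρ : Run S) (i : ℕ) {V A sn b s} (hA : A ∈ S.honestUser) :
    (.inr A, .tx (.uara A sn b s)) ∈ ((ρ.st i).loc V).inbox →
      Tx.uara A sn b s ∈ (((ρ.st i).loc V).user A).awaiting ∨
      Tx.uara A sn b s ∈ (((ρ.st i).loc V).actor b.receiver).pool ∨
      Tx.uara A sn b s ∈ (((ρ.st i).loc V).actor b.receiver).executed := by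
  induction i with
  | zero => rw [ρ.st_zero]; simp [System.start]
  | succ i ih =>
    intro h
    have ih' : (.inr A, .tx (.uara A sn b s)) ∈ ((ρ.st i).loc V).inbox →
        Tx.uara A sn b s ∈ (((ρ.st (i + 1)).loc V).user A).awaiting ∨
        Tx.uara A sn b s ∈ (((ρ.st (i + 1)).loc V).actor b.receiver).pool ∨
        Tx.uara A sn b s ∈ (((ρ.st (i + 1)).loc V).actor b.receiver).executed := by
      intro h
      rcases ih h with h | h
      · have hu := (ρ.step i).userStep V A
        have hr := (ρ.step i).actorStep V b.receiver
        generalize ((ρ.st (i + 1)).loc V).user A = u at hu ⊢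
        generalize ρ.act i = a at hu hr
        cases hu <;> try exact .inl h
        case offer sn' b' s' _ _ _ =>
          by_cases htx : Tx.uara A sn b s = .uara A sn' b' s'
          · right
            cases htx
            generalize ((ρ.st (i + 1)).loc V).actor b.receiver = u at hr ⊢
            cases hr
            case refl h => exact absurd rfl (h _ rfl)
            case offer =>
              dsimp only
              split_ifs with h'
              · exact .inr h'
              · exact .inl (Finset.mem_insert_self _ _)
          · exact .inl ⟨h, htx⟩
        case receiveUARA => exact .inl (.inr h)
      · exact .inr (ρ.pool_or_executed i h)
    rcases (ρ.step i).inbox V with h₁ | ⟨src, m, ha, ⟨t₀, hsent⟩, h₁⟩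
    · rw [h₁] at h
      exact ih' h
    · rw [h₁] at h
      rcases h with h | h
      · cases h
        left
        have hst := ρ.step i
        rw [ha] at hst
        obtain ⟨hV, -, -, h⟩ := hst
        obtain ⟨tx', sn', h₂, h₃, h₄⟩ := ρ.sent_user i hsent rfl hA
        cases h₂
        have hf : (((ρ.st i).loc V).user A).fpLocked sn = none ∨
            (((ρ.st i).loc V).user A).fpLocked sn = some (.uara A sn b s) := by
          rcases h₅ : (((ρ.st i).loc V).user A).fpLocked sn with _ | tx'
          · exact .inl rfl
          · right
            rw [ρ.issued_eq i ((ρ.signatures i).1 V A sn tx' hA h₅) h₄ (ρ.fpLocked_key i h₅) rfl]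
        have h₁ : (((ρ.st i).setLocal V { (ρ.st i).loc V with
          inbox := insert (Sum.inr A, Msg.tx (.uara A sn b s)) ((ρ.st i).loc V).inbox }).loc
            V).user A = ((ρ.st i).loc V).user A := by simp [State.setLocal_loc]
        simp only [State.react] at h
        rw [h₁, if_pos ⟨trivial, (ρ.issued i h₄).1, hf⟩] at h
        rw [h]
        simp [State.setLocal_loc, Local.setUser_user]
      · exact ih' h

/-! ### Settled states -/

/-- No honest validator has a local action to take. -/
def State.Quiet (σ : State S) : Prop :=
  ∀ V, V ∉ S.byz → ∀ a σ'', ¬ InternalStep V a σ σ''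

/-- No honest validator has a local action to take, and it has received all messages that were
sent to it until time `T`. -/
def State.Settled (σ : State S) (T : ℝ) : Prop :=
  σ.Quiet ∧ ∀ q ∈ σ.sent, q.dst ∉ S.byz → q.time ≤ T → (q.src, q.msg) ∈ (σ.loc q.dst).inbox

theorem Run.created_mono (ρ : Run S) {i j : ℕ} (hij : i ≤ j) {V X}
    (h : (((ρ.st i).loc V).actor X).created) : (((ρ.st j).loc V).actor X).created := by
  rw [ρ.created] at h ⊢
  rcases h with h | ⟨A, sn, os, c, s, h₁, h₂⟩ | ⟨Y, m, h₁, h₂⟩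
  · exact .inl h
  · exact .inr (.inl ⟨A, sn, os, c, s, ρ.done_mono hij h₁, h₂⟩)
  · exact .inr (.inr ⟨Y, m, h₁.trans_le (ρ.inst_mono hij V Y), h₂⟩)

theorem Run.created_of_started (ρ : Run S) (i : ℕ) {V X} :
    (((ρ.st i).loc V).actor X).started ≠ none → (((ρ.st i).loc V).actor X).created := by
  induction i with
  | zero => rw [ρ.st_zero]; simp [System.start]
  | succ i ih =>
    intro h
    by_contra hc
    have hc' : ¬ (((ρ.st i).loc V).actor X).created := fun h => hc (ρ.created_mono (Nat.le_succ i) h)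
    have hu := (ρ.step i).actorStep V X
    generalize ((ρ.st (i + 1)).loc V).actor X = u at hu h
    generalize ρ.act i = a at hu
    cases hu <;> try exact hc' (ih h)
    case initiate h₁ h₂ h₃ => exact hc' ‹_›
    case poaDecide => exact h rfl

/-- What a validator has done is known to every other validator in a settled state. -/
def Run.Reached (ρ : Run S) (i : ℕ) (V' : N.Validator) (j : ℕ) (V : N.Validator) : Prop :=
  (∀ A sn tx, (((ρ.st i).loc V').user A).done sn = some tx →
    (((ρ.st j).loc V).user A).done sn = some tx) ∧
  ∀ X, (((ρ.st i).loc V').actor X).inst ≤ (((ρ.st j).loc V).actor X).inst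

theorem Run.Reached.created {ρ : Run S} {i V' j V} (h : ρ.Reached i V' j V) {X}
    (hc : (((ρ.st i).loc V').actor X).created) : (((ρ.st j).loc V).actor X).created := by
  rw [ρ.created] at hc ⊢
  rcases hc with hc | ⟨A, sn, os, c, s, h₁, h₂⟩ | ⟨Y, m, h₁, h₂⟩
  · exact .inl hc
  · exact .inr (.inl ⟨A, sn, os, c, s, h.1 _ _ _ h₁, h₂⟩)
  · exact .inr (.inr ⟨Y, m, h₁.trans_le (h.2 Y), h₂⟩)

theorem Run.Reached.credited {ρ : Run S} {i V' j V} (h : ρ.Reached i V' j V) {A o}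
    (hc : ρ.Credited i V' A o) : ρ.Credited j V A o := by
  rcases hc with hc | ⟨A', sn, os, c, s, h₁, h₂⟩ | ⟨A', sn, tx, X, m, e, h₁, h₂⟩ | ⟨X, m, h₁, h₂⟩
  · exact .inl hc
  · exact .inr (.inl ⟨A', sn, os, c, s, h.1 _ _ _ h₁, h₂⟩)
  · exact .inr (.inr (.inl ⟨A', sn, tx, X, m, e, h.1 _ _ _ h₁, h₂⟩))
  · exact .inr (.inr (.inr ⟨X, m, h₁.trans_le (h.2 X), h₂⟩))

theorem Run.Reached.notices {ρ : Run S} {i V' j V} (h : ρ.Reached i V' j V) {A q}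
    (hq : q ∈ (((ρ.st i).loc V').user A).notices) : q ∈ (((ρ.st j).loc V).user A).notices := by
  rw [ρ.notices] at hq ⊢
  obtain ⟨⟨X, m, h₁, h₂⟩, h₃⟩ := hq
  exact ⟨⟨X, m, h₁.trans_le (h.2 X), h₂⟩, h₃⟩

/-- An object needed by number `sn` could be missing at `V` only if some number `m` consumed it
there. If `m < sn`, then `V'` has executed number `m` as well, with the same transaction, and would
lack the object too. If `m ≥ sn`, then number `sn` would itself be executed at `V`, since the
executed numbers form an initial segment. -/
theorem Run.Reached.ready {ρ : Run S} {i V' j V} (h : ρ.Reached i V' j V) {A sn objs}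
    (hr : (((ρ.st i).loc V').user A).Ready sn objs)
    (hn : (((ρ.st j).loc V).user A).done sn = none) :
    (((ρ.st j).loc V).user A).Ready sn objs := by
  refine ⟨fun m hm => ?_, fun o ho => ?_⟩
  · obtain ⟨tx, htx⟩ := Option.ne_none_iff_exists'.1 (hr.1 m hm)
    simp [h.1 _ _ _ htx]
  · obtain ⟨h₁, h₂⟩ := ((ρ.owned_iff i V').2 A o).1 (hr.2 ho)
    refine ((ρ.owned_iff j V).2 A o).2 ⟨h.credited h₁, ?_⟩
    rintro ⟨m, tx, hm, htx⟩
    rcases Nat.lt_or_ge m sn with hlt | hge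
    · obtain ⟨l, rfl⟩ : ∃ l, sn = l + 1 := ⟨sn - 1, by omega⟩
      obtain ⟨tx₁, htx₁⟩ := Option.ne_none_iff_exists'.1 (hr.1 l rfl)
      obtain ⟨tx₂, htx₂⟩ := ρ.done_of_le i (Nat.le_of_lt_succ hlt) htx₁
      have := h.1 _ _ _ htx₂
      rw [hm] at this
      cases this
      exact h₂ ⟨m, tx, htx₂, htx⟩
    · obtain ⟨tx', h'⟩ := ρ.done_of_le j hge hm
      rw [hn] at h'
      cases h'

theorem Run.started_of_quiet (ρ : Run S) {j V X} (hq : (ρ.st j).Quiet) (hV : V ∉ S.byz)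
    (hc : (((ρ.st j).loc V).actor X).created) : (((ρ.st j).loc V).actor X).started ≠ none :=
  fun h => hq V hV (.initiate X) _ ⟨hc, h, rfl⟩

/-- Induction over the steps of `V'`. Each decision or execution there is backed by a proof that was
broadcast, or by reports that `V` has by induction. If `V` had not followed, one of its actions
would be enabled, contrary to quietness; if it had executed something else, uniqueness of confirmed
transactions would be violated. -/
theorem Run.reached (ρ : Run S) {i j : ℕ} {T : ℝ} (hs : (ρ.st j).Settled T) (hij : i ≤ j)
    (hT : (ρ.st i).now ≤ T) (V') {V} (hV : V ∉ S.byz) :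
    ρ.Reached i V' j V := by
  induction i with
  | zero => rw [Run.Reached, ρ.st_zero]; simp [System.start]
  | succ i ih =>
    have ih := ih (by omega) ((ρ.now_mono (Nat.le_succ i)).trans hT)
    have recv : ∀ {src m t}, (⟨src, V, m, t⟩ : Packet N) ∈ (ρ.st (i + 1)).sent →
        (src, m) ∈ ((ρ.st j).loc V).inbox := fun h =>
      hs.2 _ (ρ.sent_mono hij h) hV ((ρ.time_le _ _ h).trans hT)
    have agree : ∀ {A sn tx tx'}, (((ρ.st (i + 1)).loc V').user A).done sn = some tx →
        (((ρ.st j).loc V).user A).done sn = some tx' → tx' = tx := fun h h' =>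
      ρ.confirmed_unique j (ρ.done j h').2.1 (ρ.confirmed_mono hij (ρ.done _ h).2.1)
        (ρ.done j h').1 (ρ.done _ h).1
    rcases ρ.exec_step i V' with ⟨h₁, h₂⟩ | ⟨X, ha, hst, h₁, h₂⟩ |
      ⟨A, sn, os, c, s, ha, hd, hv, hn, hr, h₁, h₂⟩ | ⟨A, sn, b, s, e, ha, hd, hn, hr, h₁, h₂⟩
    · exact ⟨fun A sn tx h => ih.1 _ _ _ ((h₁ A).1 ▸ h), fun X => (h₂ X).1 ▸ ih.2 X⟩
    · refine ⟨fun A sn tx h => ih.1 _ _ _ ((h₁ A).1 ▸ h), fun Y => ?_⟩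
      rw [(h₂ Y).1]
      split_ifs with hY
      swap
      · exact ih.2 Y
      subst hY
      -- If `V` were still in the instance that `V'` leaves, the proof received from `V'` would
      -- enable its decision.
      refine Nat.succ_le_of_lt (lt_of_le_of_ne (ih.2 Y) fun heq => ?_)
      obtain ⟨B, hB⟩ := ρ.poaProof_sent (i + 1) (V := V') (X := Y)
        (k := (((ρ.st i).loc V').actor Y).inst) (by rw [(h₂ Y).1, if_pos rfl]; omega)
      obtain ⟨t, hB⟩ := hB V
      refine hs.1 V hV (.poaDecide Y B) _ ⟨ρ.started_of_quiet hs.1 hV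
        (ih.created (ρ.created_of_started i hst)), .inr (.inl ⟨.inl V', ?_⟩), rfl⟩
      rw [← heq]
      exact recv hB
    · have hdone : (((ρ.st (i + 1)).loc V').user A).done sn = some (.ua A sn os c s) := by
        simp [(h₁ A).1]
      have key : (((ρ.st j).loc V).user A).done sn = some (.ua A sn os c s) := by
        rcases h : (((ρ.st j).loc V).user A).done sn with _ | tx'
        · exfalso
          obtain ⟨t, hp⟩ := ρ.pobProof_sent i hd V
          have hp := recv ((ρ.step i).sent_subset hp)
          rcases h' : (((ρ.st j).loc V).user A).pobDecided sn with _ | tx'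
          · exact hs.1 V hV (.pobDecide A sn _) _ ⟨h', rfl, .inr (.inl ⟨_, hp⟩), rfl⟩
          -- `V` has decided already, and by uniqueness the same transaction; so only its execution
          -- could be outstanding, and it is ready.
          · obtain ⟨hk, hc⟩ := ρ.pobDecided j h'
            obtain rfl := ρ.confirmed_unique j (ρ.confirmed_of_pobCert j hc)
              (ρ.confirmed_mono hij (ρ.done _ hdone).2.1) hk rfl
            exact hs.1 V hV (.execUA A sn os c s) _ ⟨h', hv, h, ih.ready hr h, rfl⟩
        · rw [agree hdone h]
      refine ⟨fun A' sn' tx h => ?_, fun X => (h₂ X).1 ▸ ih.2 X⟩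
      rw [(h₁ A').1] at h
      split_ifs at h with hA
      · subst hA
        by_cases hsn : sn' = sn
        · subst hsn
          rw [Function.update_self] at h
          rw [key, h]
        · rw [Function.update_of_ne hsn] at h
          exact ih.1 _ _ _ h
      · exact ih.1 _ _ _ h
    · have hdone : (((ρ.st (i + 1)).loc V').user A).done sn = some (.uara A sn b s) := by
        simp [(h₁ A).1]
      have key : (((ρ.st j).loc V).user A).done sn = some (.uara A sn b s) := by
        rcases h : (((ρ.st j).loc V).user A).done sn with _ | tx'
        · exact absurd ⟨ih.notices hd, h, ih.ready hr h, rfl⟩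
            (hs.1 V hV (.finishUARA A sn b s e) _)
        · rw [agree hdone h]
      refine ⟨fun A' sn' tx h => ?_, fun X => (h₂ X).1 ▸ ih.2 X⟩
      rw [(h₁ A').1] at h
      split_ifs at h with hA
      · subst hA
        by_cases hsn : sn' = sn
        · subst hsn
          rw [Function.update_self] at h
          rw [key, h]
        · rw [Function.update_of_ne hsn] at h
          exact ih.1 _ _ _ h
      · exact ih.1 _ _ _ h

/-! ### Timing -/

theorem Run.now_nonneg (ρ : Run S) (i : ℕ) : 0 ≤ (ρ.st i).now := by
  have := ρ.now_mono (Nat.zero_le i)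
  rwa [ρ.st_zero] at this

/-- The last state before the clock exceeds a given time is settled. -/
theorem Run.exists_settled (ρ : Run S) {T : ℝ} (hT : 0 ≤ T) :
    ∃ j, (ρ.st j).now ≤ T ∧ (∀ i, (ρ.st i).now ≤ T → i ≤ j) ∧ (ρ.st j).Quiet ∧
      ∀ T', S.gst ≤ T' → T' + S.δ ≤ T → (ρ.st j).Settled T' := by
  have hex : ∃ i, T < (ρ.st i).now := by
    obtain ⟨i, hi⟩ := ρ.unbounded (T + 1)
    exact ⟨i, by linarith⟩
  -- The clock starts at `0 ≤ T`, so the first index beyond `T` is positive.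
  obtain ⟨j, hj⟩ : ∃ j, Nat.find hex = j + 1 := by
    refine ⟨Nat.find hex - 1, ?_⟩
    have : Nat.find hex ≠ 0 := fun h => by
      have := Nat.find_spec hex
      rw [h, ρ.st_zero] at this
      exact absurd this (not_lt.2 hT)
    omega
  have h₁ : (ρ.st j).now ≤ T := not_lt.1 (Nat.find_min hex (by omega))
  have h₂ : T < (ρ.st (j + 1)).now := hj ▸ Nat.find_spec hex
  have hst := ρ.step j
  -- The step that carries the clock beyond `T` is a tick; its guards provide quietness and the
  -- delivery deadlines.
  rcases hst.now with h | ⟨-, t, ha⟩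
  · linarith
  rw [ha] at hst
  obtain ⟨-, hq, hd, heq⟩ := hst
  have ht : (ρ.st (j + 1)).now = t := by rw [heq]
  refine ⟨j, h₁, fun i hi => ?_, hq, fun T' hg hT' => ⟨hq, fun q hs hb htime => ?_⟩⟩
  · by_contra hlt
    exact absurd (ρ.now_mono (show j + 1 ≤ i by omega)) (by linarith)
  · by_contra hin
    have := hd q hs hb hin
    have : max q.time S.gst ≤ T' := max_le htime hg
    linarith

theorem Run.settled (ρ : Run S) {T T' : ℝ} {i : ℕ} (hg : S.gst ≤ T') (hT : T' + S.δ ≤ T)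
    (hi : (ρ.st i).now ≤ T) : ∃ j, i ≤ j ∧ (ρ.st j).now ≤ T ∧
      (∀ i, (ρ.st i).now ≤ T → i ≤ j) ∧ (ρ.st j).Settled T' := by
  obtain ⟨j, h₁, h₂, -, h₃⟩ := ρ.exists_settled ((ρ.now_nonneg i).trans hi)
  exact ⟨j, h₂ i hi, h₁, h₂, h₃ T' hg hT⟩

theorem Run.starts_of_started (ρ : Run S) (i : ℕ) {V X t} :
    (((ρ.st i).loc V).actor X).started = some t →
      ∃ i' < i, ρ.Starts i' V X (((ρ.st i).loc V).actor X).inst ∧ (ρ.st i').now = t := by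
  induction i with
  | zero => rw [ρ.st_zero]; simp [System.start]
  | succ i ih =>
    have ih' : (((ρ.st i).loc V).actor X).started = some t →
        ∃ i' < i + 1, ρ.Starts i' V X (((ρ.st i).loc V).actor X).inst ∧ (ρ.st i').now = t :=
      fun h => (ih h).imp fun _ h => ⟨h.1.trans (Nat.lt_succ_self i), h.2⟩
    clear ih
    have hu := (ρ.step i).actorStep V X
    have ha : ρ.act i = ρ.act i := rfl
    generalize ((ρ.st (i + 1)).loc V).actor X = u at hu ⊢
    generalize hb : ρ.act i = a at hu
    cases hu <;> try exact ih'
    case initiate =>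
      intro h
      cases h
      exact ⟨i, Nat.lt_succ_self i, ⟨hb, rfl⟩, rfl⟩
    case poaDecide =>
      intro h
      cases h

/-- Instance `k` of the POA of `X` has been started at `V`. -/
def State.Begun (σ : State S) (V : N.Validator) (X : N.Reactive) (k : ℕ) : Prop :=
  k < ((σ.loc V).actor X).inst ∨
    ((σ.loc V).actor X).inst = k ∧ ((σ.loc V).actor X).started ≠ none

theorem State.Begun.step {a : Action N} {σ σ' : State S} {V X k} (hb : σ.Begun V X k)
    (h : Step a σ σ') : σ'.Begun V X k := by
  unfold State.Begun at hb ⊢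
  have hu := h.actorStep V X
  generalize (σ'.loc V).actor X = u at hu ⊢
  cases hu <;> try exact hb
  case initiate => exact hb.imp_right fun h => ⟨h.1, by simp⟩
  case poaDecide => dsimp only; omega

theorem Run.Starts.begun {ρ : Run S} {i V X k} (h : ρ.Starts i V X k) :
    (ρ.st (i + 1)).Begun V X k := by
  obtain ⟨ha, hk⟩ := h
  have hu := (ρ.step i).actorStep V X
  rw [ha] at hu
  unfold State.Begun
  generalize ((ρ.st (i + 1)).loc V).actor X = u at hu ⊢
  cases hu
  case refl h => exact absurd rfl (h _ rfl)
  case initiate => exact .inr ⟨hk, by simp⟩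

theorem Run.Starts.pre {ρ : Run S} {i V X k} (h : ρ.Starts i V X k) :
    V ∉ S.byz ∧ (((ρ.st i).loc V).actor X).created ∧
      (((ρ.st i).loc V).actor X).started = none := by
  have hst := ρ.step i
  rw [h.1] at hst
  exact ⟨hst.1, hst.2.1, hst.2.2.1⟩

theorem Run.Starts.not_begun {ρ : Run S} {i V X k} (h : ρ.Starts i V X k) :
    ¬ (ρ.st i).Begun V X k := by
  rintro (h' | h')
  · exact absurd h.2 h'.ne'
  · exact h'.2 h.pre.2.2

/-- Once started, an instance remains started until the counter has passed it. -/
theorem Run.Starts.unique {ρ : Run S} {i j V X k} (h : ρ.Starts i V X k)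
    (h' : ρ.Starts j V X k) : i = j := by
  rcases lt_trichotomy i j with hlt | rfl | hlt
  · exact absurd (ρ.mono (P := fun σ => σ.Begun V X k) (fun i h => h.step (ρ.step i)) hlt h.begun)
      h'.not_begun
  · rfl
  · exact absurd (ρ.mono (P := fun σ => σ.Begun V X k) (fun i h => h.step (ρ.step i)) hlt h'.begun)
      h.not_begun

/-- The slow path is entered on expiry of the timer, whose value is the time at which the validator
itself started the instance. Proposals to Quorum Consensus come later still. -/
theorem Run.slow_late (ρ : Run S) (i : ℕ) {V X} :
    ((((ρ.st i).loc V).actor X).cur.slow ≠ .idle →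
      ∃ i', ρ.Starts i' V X (((ρ.st i).loc V).actor X).inst ∧
        (ρ.st i').now + 3 * S.Δ < (ρ.st i).now) ∧
    ∀ k, (((ρ.st i).loc V).actor X).qcProposed k ≠ none →
      ∃ i', ρ.Starts i' V X k ∧ (ρ.st i').now + 3 * S.Δ < (ρ.st i).now := by
  induction i with
  | zero => rw [ρ.st_zero]; simp [System.start, Attempt.fresh]
  | succ i ih =>
    have hle := ρ.now_mono (Nat.le_succ i)
    have ih' : ((((ρ.st i).loc V).actor X).cur.slow ≠ .idle →
        ∃ i', ρ.Starts i' V X (((ρ.st i).loc V).actor X).inst ∧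
          (ρ.st i').now + 3 * S.Δ < (ρ.st (i + 1)).now) ∧
        ∀ k, (((ρ.st i).loc V).actor X).qcProposed k ≠ none →
          ∃ i', ρ.Starts i' V X k ∧ (ρ.st i').now + 3 * S.Δ < (ρ.st (i + 1)).now :=
      ⟨fun h => (ih.1 h).imp fun _ h => ⟨h.1, h.2.trans_le hle⟩,
        fun k h => (ih.2 k h).imp fun _ h => ⟨h.1, h.2.trans_le hle⟩⟩
    clear ih
    have due : (ρ.st i).SlowDue V X → ∃ i', ρ.Starts i' V X (((ρ.st i).loc V).actor X).inst ∧
        (ρ.st i').now + 3 * S.Δ < (ρ.st (i + 1)).now := by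
      rintro ⟨⟨t, ht, hlt⟩, -⟩
      obtain ⟨i', -, h₁, rfl⟩ := ρ.starts_of_started i ht
      exact ⟨i', h₁, hlt.trans_le hle⟩
    have hu := (ρ.step i).actorStep V X
    generalize ((ρ.st (i + 1)).loc V).actor X = u at hu ⊢
    generalize ρ.act i = a at hu
    cases hu <;> try exact ih'
    case slowCandidate hd _ _ => exact ⟨fun _ => due ‹_›, ih'.2⟩
    case slowFallback =>
      refine ⟨fun _ => ?_, ih'.2⟩
      rename_i hd _ _
      rcases hd with hd | ⟨B, tried, hd, -⟩
      · exact due hd.1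
      · exact ih'.1 (by rw [hd]; simp)
    case spCandidate hs => exact ⟨fun _ => ih'.1 (by rw [hs]; simp), ih'.2⟩
    case spFallback hs => exact ⟨fun _ => ih'.1 (by rw [hs]; simp), ih'.2⟩
    case qcPropose hs =>
      have h₁ := ih'.1 (by rcases hs with hs | hs <;> rw [hs.1] <;> simp)
      refine ⟨fun _ => h₁, fun k hk => ?_⟩
      by_cases hk' : k = (((ρ.st i).loc V).actor X).inst
      · rw [hk']; exact h₁
      · dsimp only at hk
        rw [Function.update_of_ne hk'] at hk
        exact ih'.2 k hk
    case poaDecide => exact ⟨fun h => absurd rfl h, ih'.2⟩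

theorem Run.proposal (ρ : Run S) (i : ℕ) {q : Packet N} {L X k B} (hq : q ∈ (ρ.st i).sent)
    (hs : q.src = .inl L) (hL : L ∉ S.byz) (hm : q.msg = .proposal X k B) :
    ∃ i' < i, ρ.Starts i' L X k ∧ B = (((ρ.st i').loc L).actor X).pool ∧
      q.time = (ρ.st i').now := by
  induction i with
  | zero => rw [ρ.st_zero] at hq; simp [System.start] at hq
  | succ i ih =>
    rcases (ρ.step i).sendStep q hq with h | ⟨ht, h⟩
    · exact (ih h).imp fun _ h => ⟨h.1.trans (Nat.lt_succ_self i), h.2⟩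
    · rw [hm, hs] at h
      generalize ha : ρ.act i = a at h
      cases h
      case proposal => exact ⟨i, Nat.lt_succ_self i, ⟨ha, rfl⟩, rfl, ht⟩
      case adversary h _ _ _ => exact absurd h hL

theorem Run.Starts.proposal_sent {ρ : Run S} {i L X k} (h : ρ.Starts i L X k)
    (hl : S.leader X k = L) (W : N.Validator) :
    (⟨.inl L, W, .proposal X k (((ρ.st i).loc L).actor X).pool, (ρ.st i).now⟩ : Packet N) ∈
      (ρ.st (i + 1)).sent := by
  have hst := ρ.step i
  rw [h.1] at hst
  obtain ⟨-, -, -, hst⟩ := hst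
  dsimp only at hst
  rw [h.2, if_pos hl] at hst
  rw [hst]
  exact .inr ⟨rfl, rfl, rfl⟩

/-- Without any honest proposal, condition (I) of Quorum Validity would vacuously put every
transaction into the block, whereas (II) demands at least `n - 3f > 0` proposals for each of its
members. The argument `tx` serves as a transaction to which this applies. -/
theorem Run.exists_qcProposed (ρ : Run S) (i : ℕ) {X k B} (tx : Tx N) :
    (ρ.st i).qc X k = some B →
      ∃ i' ≤ i, ∃ V, V ∉ S.byz ∧ (((ρ.st i').loc V).actor X).qcProposed k ≠ none := by
  induction i with
  | zero => rw [ρ.st_zero]; simp [System.start]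
  | succ i ih =>
    intro h
    rcases (ρ.step i).qc X k with h₁ | ⟨B', -, ⟨h₁, h₂⟩, -⟩
    · rw [h₁] at h
      exact (ih h).imp fun _ h => ⟨h.1.trans (Nat.le_succ i), h.2⟩
    · refine ⟨i, Nat.le_succ i, ?_⟩
      by_contra! hc
      have htx : tx ∈ B' := h₁ tx fun V hV P hP => by simp [hc V hV] at hP
      have := h₂ tx htx
      have hempty : {V | V ∉ S.byz ∧ ∃ P, (((ρ.st i).loc V).actor X).qcProposed k = some P ∧
          tx ∈ P} = ∅ := by
        refine Set.eq_empty_iff_forall_notMem.2 ?_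
        rintro V ⟨hV, P, hP, -⟩
        simp [hc V hV] at hP
      rw [hempty, Set.ncard_empty] at this
      have := S.size'
      omega

/-! ### Issued transactions -/

theorem Run.executed_of_done (ρ : Run S) (i : ℕ) {V A A' m sn b s}
    (h : (((ρ.st i).loc V).user A).done m = some (.uara A' sn b s)) :
    Tx.uara A' sn b s ∈ (((ρ.st i).loc V).actor b.receiver).executed := by
  obtain ⟨-, -, -, ⟨os, c, s', h'⟩ | ⟨b', s', e, X, m', h₁, h₂, h₃⟩⟩ := ρ.done i h
  · cases h'
  · have hb := (ρ.out_notices h₃).1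
    have hX := ρ.receiver_of_mem_block hb
    cases hX
    exact (ρ.mem_executed i).2 ⟨m', h₂, hb⟩

/-- A consumed object can be missing only because an executed transaction of `A` consumed it. That
one is confirmed, hence issued by the honest user, and issued transactions consume disjoint sets of
objects; so it would be `tx` itself. -/
theorem Run.ready_of_issued (ρ : Run S) (i : ℕ) {V A sn tx} (hA : A ∈ S.honestUser)
    (htx : tx ∈ (ρ.st i).issued) (hk : tx.key = some (A, sn))
    (hn : (((ρ.st i).loc V).user A).done sn ≠ some tx)
    (hp : ∀ m, sn = m + 1 → (((ρ.st i).loc V).user A).done m ≠ none)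
    (ho : ∀ o ∈ tx.objs, ρ.Credited i V A o) :
    (((ρ.st i).loc V).user A).Ready sn tx.objs := by
  refine ⟨hp, fun o h => ((ρ.owned_iff i V).2 A o).2 ⟨ho o h, ?_⟩⟩
  rintro ⟨m, tx', h₁, h₂⟩
  obtain ⟨hk', hc, -⟩ := ρ.done i h₁
  rcases ρ.issued_unique i htx (ρ.issued_of_confirmed i hc hk' hA) hk hk' with rfl | ⟨-, h'⟩
  · rw [hk] at hk'
    cases hk'
    exact hn h₁
  · exact h' o h h₂

/-- When an honest user issues a transaction, its preconditions are met at honest validators. -/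
theorem Run.Issues.pre {ρ : Run S} {i A tx sn} (h : ρ.Issues i A tx) (hk : tx.key = some (A, sn)) :
    A ∈ S.honestUser ∧ tx ∈ (ρ.st (i + 1)).issued ∧ (ρ.st (i + 1)).now = (ρ.st i).now ∧
      (∀ W, (⟨.inr A, W, .tx tx, (ρ.st i).now⟩ : Packet N) ∈ (ρ.st (i + 1)).sent) ∧
      (∀ m, sn = m + 1 → ∃ V, V ∉ S.byz ∧ (((ρ.st i).loc V).user A).done m ≠ none) ∧
      ∀ o ∈ tx.objs, ∃ V, V ∉ S.byz ∧ ρ.Credited i V A o := by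
  have hst := ρ.step i
  rw [show ρ.act i = _ from h] at hst
  obtain ⟨hA, hk', hv, hp, ho, heq⟩ := hst
  rw [hk] at hk'
  cases hk'
  refine ⟨hA, ?_, ?_, fun W => ?_, hp, fun o h => ?_⟩
  · rw [heq]; exact Set.mem_insert _ _
  · rw [heq]; rfl
  · rw [heq]; exact .inr ⟨rfl, rfl, rfl⟩
  · obtain ⟨⟨V, hV, hV'⟩, -⟩ := ho o h
    exact ⟨V, hV, (((ρ.owned_iff i V).2 A o).1 hV').1⟩

/-- The preconditions of issuing hold at honest validators that may differ from object to object.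
One communication step carries all of them to `V`. -/
theorem Run.Issues.ready {ρ : Run S} {i j A tx sn V T} (h : ρ.Issues i A tx)
    (hk : tx.key = some (A, sn)) (hij : i < j) (hs : (ρ.st j).Settled T) (hT : (ρ.st i).now ≤ T)
    (hV : V ∉ S.byz) (hn : (((ρ.st j).loc V).user A).done sn ≠ some tx) :
    (((ρ.st j).loc V).user A).Ready sn tx.objs := by
  obtain ⟨hA, hi, -, -, hp, ho⟩ := h.pre hk
  refine ρ.ready_of_issued j hA (ρ.issued_mono hij hi) hk hn (fun m hm => ?_) fun o h => ?_
  · obtain ⟨V', -, h'⟩ := hp m hm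
    obtain ⟨tx', h'⟩ := Option.ne_none_iff_exists'.1 h'
    simp [(ρ.reached hs hij.le hT V' hV).1 _ _ _ h']
  · obtain ⟨V', -, h'⟩ := ho o h
    exact (ρ.reached hs hij.le hT V' hV).credited h'

/-! ### An instance with an honest leader -/

/-- At step `j`, `L` starts instance `k` of the POA of `X`, of which it is the leader, after GST
and with a good pool. -/
structure Run.Leads (ρ : Run S) (j : ℕ) (L : N.Validator) (X : N.Reactive) (k : ℕ) : Prop where
  leader : S.leader X k = L
  starts : ρ.Starts j L X k
  good : ρ.GoodPool j L X
  after : ρ.AfterGST X k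

namespace Run.Leads

variable {ρ : Run S} {j : ℕ} {L : N.Validator} {X : N.Reactive} {k : ℕ}

theorem honest (h : ρ.Leads j L X k) : L ∉ S.byz := h.starts.pre.1

theorem gst_le (h : ρ.Leads j L X k) : S.gst ≤ (ρ.st j).now := h.after j L h.honest h.starts

/-- If `V` started more than `δ` earlier, then by one communication step after that `L` would have
reached instance `k`, known that `X` exists, and started it, before its actual and only start. -/
theorem le_start (h : ρ.Leads j L X k) {i V} (hV : V ∉ S.byz) (hi : ρ.Starts i V X k) :
    (ρ.st j).now ≤ (ρ.st i).now + S.δ := by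
  by_contra! hlt
  obtain ⟨m, him, hm, -, hs⟩ := ρ.settled (i := i) (h.after i V hV hi) le_rfl
    (by linarith [S.δ_pos])
  have hr := ρ.reached hs him le_rfl V h.honest
  have hmj : m < j := by
    by_contra! hle
    linarith [ρ.now_mono hle]
  have hst := ρ.started_of_quiet hs.1 h.honest (hr.created hi.pre.2.1)
  have h₁ := hr.2 X
  have h₂ := ρ.inst_mono hmj.le L X
  rw [hi.2] at h₁
  rw [h.starts.2] at h₂
  obtain ⟨t, ht⟩ := Option.ne_none_iff_exists'.1 hst
  obtain ⟨i', hi', h₃, -⟩ := ρ.starts_of_started m ht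
  -- The counter of `L` is at least `k` because it has caught up with `V`, and at most `k` because
  -- `L` starts instance `k` later.
  rw [show (((ρ.st m).loc L).actor X).inst = k from le_antisymm h₂ h₁] at h₃
  have := h₃.unique h.starts
  omega

/-- A decision requires an honest proposal, made more than `3Δ` after its author's start, hence more
than `3Δ - δ ≥ 2δ` after the start of the leader. -/
theorem qc_eq_none (h : ρ.Leads j L X k) (tx : Tx N) {i}
    (hi : (ρ.st i).now ≤ (ρ.st j).now + 2 * S.δ) : (ρ.st i).qc X k = none := by
  by_contra hc
  obtain ⟨B, hB⟩ := Option.ne_none_iff_exists'.1 hc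
  obtain ⟨i', hi', V, hV, hP⟩ := ρ.exists_qcProposed i tx hB
  obtain ⟨i₀, h₁, h₂⟩ := (ρ.slow_late i').2 k hP
  linarith [h.le_start hV h₁, ρ.now_mono hi', S.δ_le]

theorem proposal_eq (h : ρ.Leads j L X k) {i V B t}
    (hp : (⟨.inl (S.leader X k), V, .proposal X k B, t⟩ : Packet N) ∈ (ρ.st i).sent) :
    j < i ∧ B = (((ρ.st j).loc L).actor X).pool ∧ t = (ρ.st j).now := by
  rw [h.leader] at hp
  obtain ⟨i', h₁, h₂, h₃, h₄⟩ := ρ.proposal i hp rfl h.honest rfl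
  obtain rfl := h₂.unique h.starts
  exact ⟨h₁, h₃, h₄⟩

/-- A fast certificate contains an honest vote, which can only be for the leader's single proposal;
a slow one is impossible so early. -/
theorem poaCert_eq (h : ρ.Leads j L X k) (tx : Tx N) {i B}
    (hi : (ρ.st i).now ≤ (ρ.st j).now + 2 * S.δ) (hB : (ρ.st i).PoaCert X k B) :
    B = (((ρ.st j).loc L).actor X).pool := by
  rcases hB with ⟨Q, hQ, hQ'⟩ | ⟨Bqc, hq, -⟩
  · have := S.size'
    obtain ⟨W, hW, hb⟩ := S.exists_honest (Q := Q) (by omega)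
    obtain ⟨fb, q, hq, hs, hm⟩ := hQ' W hW hb
    obtain ⟨B', t, u, hp, -, hv | ⟨hv, -⟩⟩ := ρ.vote_proposal i hq hs hb hm
    · cases hv
      exact (h.proposal_eq hp).2.1
    · cases hv
  · rw [h.qc_eq_none tx hi] at hq
    cases hq

theorem issued (h : ρ.Leads j L X k) {A sn b s}
    (htx : Tx.uara A sn b s ∈ (((ρ.st j).loc L).actor X).pool) :
    A ∈ S.honestUser ∧ Tx.uara A sn b s ∈ (ρ.st j).issued ∧ S.verify (.uara A sn b s) := by
  have hA := h.good _ _ _ _ htx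
  have hi := ρ.issued_of_fpLocked j ((ρ.pool j htx).1.2 ⟨_, _, _, _, rfl⟩) rfl hA
  exact ⟨hA, hi, (ρ.issued j hi).1⟩

/-- No reason for a refusal applies: the UA-RA transactions of a good pool are issued, so they are
correctly signed and have no FP-locked rival, and the block was taken up no earlier than it was
sent, so the delay `Δ ≥ δ` has not run out. -/
theorem vote_eq (h : ρ.Leads j L X k) {i} {q : Packet N} {W v fb}
    (hi : (ρ.st i).now ≤ (ρ.st j).now + S.δ) (hq : q ∈ (ρ.st i).sent) (hW : q.src = .inl W)
    (hb : W ∉ S.byz) (hm : q.msg = .poaVote X k v fb) :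
    v = some (((ρ.st j).loc L).actor X).pool := by
  obtain ⟨B, t, u, hp, htu, hv | ⟨-, tx, htx, ⟨A, sn, b, s, rfl⟩, hr⟩⟩ :=
    ρ.vote_proposal i hq hW hb hm
  · rw [hv, (h.proposal_eq hp).2.1]
  · exfalso
    obtain ⟨hji, rfl, rfl⟩ := h.proposal_eq hp
    obtain ⟨hA, h₁, h₂⟩ := h.issued htx
    rcases hr with hr | ⟨tx', A', sn', h₃, h₄, h₅, h₆⟩ | hr
    · exact hr h₂
    · cases h₃
      exact h₅ (ρ.issued_eq i (ρ.issued_of_fpLocked i h₆ h₄ hA) (ρ.issued_mono hji.le h₁) h₄ rfl)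
    · linarith [S.δ_le]

/-- The set of executed transactions depends only on the instance counter, which here has the value
that it had at the leader when it sent its pool. -/
theorem not_executed (h : ρ.Leads j L X k) {i V tx}
    (htx : tx ∈ (((ρ.st j).loc L).actor X).pool)
    (hV : (((ρ.st i).loc V).actor X).inst = k) :
    tx ∉ (((ρ.st i).loc V).actor X).executed := by
  have := ρ.not_executed_of_pool j htx
  rw [ρ.mem_executed, h.starts.2] at this
  rwa [ρ.mem_executed, hV]

/-- Within a communication step every honest validator in the instance votes. -/
theorem voted (h : ρ.Leads j L X k) {m V} (hjm : j < m) (hs : (ρ.st m).Settled (ρ.st j).now)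
    (hm : (ρ.st m).now ≤ (ρ.st j).now + S.δ) (hV : V ∉ S.byz)
    (hi : (((ρ.st m).loc V).actor X).inst = k) : (((ρ.st m).loc V).actor X).cur.voted := by
  have hr := ρ.reached hs hjm.le le_rfl L hV
  obtain ⟨t, ht⟩ := Option.ne_none_iff_exists'.1
    (ρ.started_of_quiet hs.1 hV (hr.created h.starts.pre.2.1))
  obtain ⟨i', -, h₁, h₂⟩ := ρ.starts_of_started m ht
  rw [hi] at h₁
  have hstart := h.le_start hV h₁
  rw [h₂] at hstart
  have hprop : (.inl (S.leader X (((ρ.st m).loc V).actor X).inst),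
      .proposal X (((ρ.st m).loc V).actor X).inst (((ρ.st j).loc L).actor X).pool) ∈
      ((ρ.st m).loc V).inbox := by
    rw [hi, h.leader]
    exact hs.2 _ (ρ.sent_mono hjm (h.starts.proposal_sent h.leader V)) hV le_rfl
  -- The blocks that emitted these transactions at `L` have been decided at `V` as well within the
  -- communication step.
  have hrara : ∀ tx ∈ (((ρ.st j).loc L).actor X).pool, tx.IsRARA →
      tx ∈ (((ρ.st m).loc V).actor X).pool := fun tx htx hR => by
    obtain ⟨h₃, ⟨Y, m', h₄, h₅⟩, -⟩ := (ρ.mem_pool_rara j hR).1 htx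
    exact (ρ.mem_pool_rara m hR).2 ⟨h₃, ⟨Y, m', h₄.trans_le (hr.2 Y), h₅⟩, h.not_executed htx hi⟩
  by_contra hvoted
  rcases hf : (((ρ.st m).loc V).actor X).cur.fp with _ | ⟨B, v⟩
  -- The leader's block may still be taken up: the clock is at most `t + 2δ ≤ t + 3Δ`, as `V`
  -- started no earlier than `δ` before the leader.
  · exact hs.1 V hV (.fpBegin X _) _ ⟨⟨t, ht, by linarith [S.δ_le, S.δ_pos]⟩, hf, hprop,
      fun tx htx => (ρ.pool j htx).1.1, hrara, rfl⟩
  obtain ⟨-, -, t', htv, hp⟩ := ρ.fp m hf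
  rw [hi] at hp
  obtain ⟨-, rfl, rfl⟩ := h.proposal_eq hp
  -- Not having voted, `V` must lack some reply, yet neither an attempt to FP-lock nor a positive
  -- reply can be outstanding in a quiet state.
  refine hs.1 V hV (.vote X) _ ⟨hvoted, _, v, hf, ?_, rfl⟩
  rintro _ htx ⟨A, sn, b, s, rfl⟩ hnone
  obtain ⟨hA, hiss, hver⟩ := h.issued htx
  have hiss := ρ.issued_mono hjm.le hiss
  have htried : Tx.uara A sn b s ∈ (((ρ.st m).loc V).actor X).cur.fpTried := by
    by_contra hc
    exact hs.1 V hV (.fpLock X A sn b s) _ ⟨⟨_, v, hf, htx⟩, hc, rfl⟩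
  have hlock : (((ρ.st m).loc V).user A).fpLocked sn = some (.uara A sn b s) := by
    obtain ⟨tx', h'⟩ := ρ.fpTried m htried hver
    have hk := ρ.fpLocked_key m h'
    rw [h', ρ.issued_eq m (ρ.issued_of_fpLocked m ⟨A, sn, hk, h'⟩ hk hA) hiss hk rfl]
  have hrecv : b.receiver = X := by
    have := (ρ.pool j htx).1.1
    cases this
    rfl
  obtain ⟨hpred, hcred⟩ := ρ.pool_uara j htx
  -- The transaction was ready at the leader when it entered the pool, and `V` has caught up; the
  -- deadline holds because FP-locking began no earlier than the leader's start, less than `Δ` or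
  -- exactly `Δ` ago at most.
  refine hs.1 V hV (.fpReply X A sn b s true) _ ⟨⟨_, v, hf, htx, fun _ => ⟨hver, hlock,
    ρ.ready_of_issued m (tx := .uara A sn b s) hA hiss rfl (fun hd => ?_) (fun l hl => ?_)
      fun o ho => hr.credited (hcred o ho), by linarith [S.δ_le]⟩, by simp⟩, htried, hnone, rfl⟩
  · have := ρ.executed_of_done m hd
    rw [hrecv] at this
    exact h.not_executed htx hi this
  · obtain ⟨tx', h'⟩ := hpred l hl
    simp [hr.1 _ _ _ h']

/-- Fast execution of the pool of an honest leader. -/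
theorem executed (h : ρ.Leads j L X k) (hp : S.byz.card ≤ S.p) {tx}
    (htx : tx ∈ (((ρ.st j).loc L).actor X).pool) {V} (hV : V ∉ S.byz) :
    ∃ i, (ρ.st i).now ≤ (ρ.st j).now + 2 * S.δ ∧
      tx ∈ (((ρ.st i).loc V).actor X).executed := by
  have hδ := S.δ_pos
  have hnow : (ρ.st (j + 1)).now = (ρ.st j).now := by
    rcases (ρ.step j).now with h' | ⟨-, t, h'⟩
    · exact h'
    · rw [h.starts.1] at h'
      cases h'
  obtain ⟨m, hjm, hm, -, hs⟩ := ρ.settled (i := j + 1) h.gst_le le_rfl (by linarith)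
  obtain ⟨m', hmm', hm', -, hs'⟩ := ρ.settled (i := m)
    (T' := (ρ.st j).now + S.δ) (T := (ρ.st j).now + 2 * S.δ) (by linarith [h.gst_le])
    (by linarith) (by linarith)
  suffices hk : k < (((ρ.st m').loc V).actor X).inst by
    refine ⟨m', hm', (ρ.mem_executed m').2 ⟨k, hk, ?_⟩⟩
    rw [h.poaCert_eq tx hm' (ρ.poaCert_of_lt m' hk)]
    exact htx
  have hr : ∀ W, W ∉ S.byz → ρ.Reached j L m W := fun W hW =>
    ρ.reached hs (by omega) le_rfl L hW
  -- If some honest validator has left instance `k` after the first communication step, its progress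
  -- reaches `V` in the second. Otherwise all honest validators have voted for the pool, and their
  -- votes arrive at `V`.
  by_cases hex : ∃ W, W ∉ S.byz ∧ (((ρ.st m).loc W).actor X).inst ≠ k
  · obtain ⟨W, hW, hne⟩ := hex
    have h₁ := (hr W hW).2 X
    rw [h.starts.2] at h₁
    exact (lt_of_le_of_ne h₁ hne.symm).trans_le ((ρ.reached hs' hmm' hm W hV).2 X)
  · push Not at hex
    have h₁ := (ρ.reached hs' hmm' hm V hV).2 X
    rw [hex V hV] at h₁
    refine lt_of_le_of_ne h₁ fun heq => ?_
    refine hs'.1 V hV (.poaDecide X (((ρ.st j).loc L).actor X).pool) _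
      ⟨ρ.started_of_quiet hs'.1 hV
        (ρ.created_mono hmm' ((hr V hV).created h.starts.pre.2.1)), .inl ?_, rfl⟩
    rw [← heq]
    refine S.le_ncard_of_honest hp fun W hW => ?_
    obtain ⟨v, fb, h₄⟩ := ρ.voted_sent m (h.voted hjm hs hm hW (hex W hW))
    obtain ⟨t, h₄⟩ := h₄ V
    rw [hex W hW] at h₄
    obtain rfl := h.vote_eq hm h₄ rfl hW rfl
    exact ⟨fb, hs'.2 _ (ρ.sent_mono hmm' h₄) hV ((ρ.time_le m _ h₄).trans hm)⟩

end Run.Leads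

/-! ### Fast execution -/

/-- All honest validators vote within one communication step, and the votes arrive within a second.
At that point `V` cannot have decided or executed a different transaction, because it would be
issued with the same number; so any missing decision or execution would be an enabled action. -/
theorem Run.executedBy_ua (ρ : Run S) (hp : S.byz.card ≤ S.p) {i A sn os c s}
    (h : ρ.Issues i A (.ua A sn os c s)) (hg : S.gst ≤ (ρ.st i).now) :
    ρ.ExecutedBy (.ua A sn os c s) ((ρ.st i).now + 2 * S.δ) := by
  intro V hV
  have hδ := S.δ_pos
  obtain ⟨hA, hiss, hnow, hsent, -⟩ := h.pre rfl
  obtain ⟨m, him, hm, -, hs⟩ := ρ.settled (i := i + 1) hg le_rfl (by linarith)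
  obtain ⟨m', hmm', hm', -, hs'⟩ := ρ.settled (i := m)
    (T' := (ρ.st i).now + S.δ) (T := (ρ.st i).now + 2 * S.δ) (by linarith)
    (by linarith) (by linarith)
  refine ⟨m', hm', ?_⟩
  have hiss' := ρ.issued_mono (him.trans hmm') hiss
  have hvotes : S.n - S.p ≤ (((ρ.st m').loc V).pobVoters A sn (.ua A sn os c s)).ncard := by
    refine S.le_ncard_of_honest hp fun W hW => ?_
    obtain ⟨t, h₄⟩ := ρ.pobVote_sent m hA
      (hs.2 _ (ρ.sent_mono him (hsent W)) hW le_rfl) V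
    exact hs'.2 _ (ρ.sent_mono hmm' h₄) hV ((ρ.time_le m _ h₄).trans hm)
  by_contra hex
  have hdec : (((ρ.st m').loc V).user A).pobDecided sn = some (.ua A sn os c s) := by
    rcases h' : (((ρ.st m').loc V).user A).pobDecided sn with _ | tx'
    · exact absurd ⟨h', rfl, .inl hvotes, rfl⟩ (hs'.1 V hV (.pobDecide A sn _) _)
    · obtain ⟨hk, hc⟩ := ρ.pobDecided m' h'
      rw [ρ.issued_eq m' (ρ.issued_of_confirmed m' (ρ.confirmed_of_pobCert m' hc) hk hA)
        hiss' hk rfl]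
  rcases h' : (((ρ.st m').loc V).user A).done sn with _ | tx'
  · exact hs'.1 V hV (.execUA A sn os c s) _ ⟨hdec, (ρ.issued m' hiss').1, h',
      h.ready (tx := .ua A sn os c s) rfl (by omega) hs' (by linarith) hV hex, rfl⟩
  · obtain ⟨hk, hc, -⟩ := ρ.done m' h'
    rw [ρ.issued_eq m' (ρ.issued_of_confirmed m' hc hk hA) hiss' hk rfl] at h'
    exact hex h'

theorem Run.executedBy_uara (ρ : Run S) (hp : S.byz.card ≤ S.p) {i A sn b s j L k}
    (h : ρ.Issues i A (.uara A sn b s)) (hg : S.gst ≤ (ρ.st i).now)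
    (hl : ρ.PromptLeader j L b.receiver k (.uara A sn b s)) (hgood : ρ.GoodPool j L b.receiver)
    (hafter : ρ.AfterGST b.receiver k) :
    ρ.ExecutedBy (.uara A sn b s) ((ρ.st i).now + 3 * S.δ) := by
  intro V hV
  have hδ := S.δ_pos
  obtain ⟨hL, hlead, hst, hpool, hprompt⟩ := hl
  -- One communication step after issuing, `L` has received the transaction and finds it ready, so
  -- it is in the pool by then. It cannot have been executed before, since it is in the pool when
  -- the leader starts later.
  have hτ : (ρ.st j).now ≤ (ρ.st i).now + S.δ := by
    by_contra! hlt
    obtain ⟨hA, hiss, hnow, hsent, -⟩ := h.pre rfl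
    obtain ⟨m, him, hm, -, hs⟩ := ρ.settled (i := i + 1) hg le_rfl (by linarith)
    have hmj : m < j := by
      by_contra! hle
      linarith [ρ.now_mono hle]
    have hnex : Tx.uara A sn b s ∉ (((ρ.st m).loc L).actor b.receiver).executed := fun hc =>
      ρ.not_executed_of_pool j hpool (ρ.executed_mono hmj.le hc)
    rcases ρ.received_uara m hA (hs.2 _ (ρ.sent_mono him (hsent L)) hL le_rfl) with h' | h' | h'
    · exact hs.1 L hL (.offer A sn b s) _ ⟨h', h.ready (tx := .uara A sn b s) rfl him hs le_rfl hL
        fun hd => hnex (ρ.executed_of_done m hd), rfl⟩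
    · linarith [hprompt m hmj.le h']
    · exact hnex h'
  obtain ⟨m, hm, hex⟩ := (⟨hlead, hst, hgood, hafter⟩ : ρ.Leads j L _ k).executed hp hpool hV
  exact ⟨m, by linarith, hex⟩

theorem Run.executedBy_rara (ρ : Run S) (hp : S.byz.card ≤ S.p) {i X b j L k}
    (h : ρ.Emits i L X (.rara X b))
    (hl : ρ.PromptLeader j L b.receiver k (.rara X b)) (hgood : ρ.GoodPool j L b.receiver)
    (hafter : ρ.AfterGST b.receiver k) :
    ρ.ExecutedBy (.rara X b) ((ρ.st i).now + 2 * S.δ) := by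
  intro V hV
  obtain ⟨hL, hlead, hst, hpool, hprompt⟩ := hl
  -- The emitting step itself puts the transaction into the pool at `L`, so no communication is
  -- needed before the leader's start.
  have hτ : (ρ.st j).now ≤ (ρ.st i).now := by
    obtain ⟨B, ha, hem⟩ := h
    have hnow : (ρ.st (i + 1)).now = (ρ.st i).now := by
      rcases (ρ.step i).now with h' | ⟨-, t, h'⟩
      · exact h'
      · rw [ha] at h'
        cases h'
    by_contra! hlt
    have hij : i + 1 ≤ j := by
      by_contra! hle
      linarith [ρ.now_mono (show j ≤ i by omega)]
    obtain ⟨-, hout⟩ := ρ.decide_eq i ha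
    rw [hout] at hem
    have hinst : (((ρ.st i).loc L).actor X).inst < (((ρ.st (i + 1)).loc L).actor X).inst := by
      have hu := (ρ.step i).actorStep L X
      rw [ha] at hu
      generalize ((ρ.st (i + 1)).loc L).actor X = u at hu ⊢
      cases hu
      case refl h => exact absurd trivial (h _ rfl)
      case poaDecide => exact Nat.lt_succ_self _
      case poaDecideOther => exact absurd rfl ‹X ≠ X›
    have hin : Tx.rara X b ∈ (((ρ.st (i + 1)).loc L).actor b.receiver).pool :=
      (ρ.mem_pool_rara (i + 1) ⟨X, b, rfl⟩).2 ⟨rfl, ⟨X, _, hinst, hem⟩, fun hc =>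
        ρ.not_executed_of_pool j hpool (ρ.executed_mono hij hc)⟩
    linarith [hprompt (i + 1) hij hin]
  obtain ⟨m, hm, hex⟩ := (⟨hlead, hst, hgood, hafter⟩ : ρ.Leads j L _ k).executed hp hpool hV
  exact ⟨m, by linarith, hex⟩

end Mangrove

theorem mainTheorem8 {N : Mangrove.Names} (S : Mangrove.System N) (ρ : Mangrove.Run S)
    (hp : S.byz.card ≤ S.p) :
    -- UA transactions
    (∀ (i : ℕ) (A : N.User) (sn : ℕ) (objs : Finset N.Obj) (code : N.Code) (sig : N.Sig),
      ρ.Issues i A (.ua A sn objs code sig) → S.gst ≤ (ρ.st i).now →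
      ρ.ExecutedBy (.ua A sn objs code sig) ((ρ.st i).now + 2 * S.δ)) ∧
    -- UA-RA transactions
    (∀ (i : ℕ) (A : N.User) (sn : ℕ) (b : Mangrove.CallBody N) (sig : N.Sig)
        (j : ℕ) (L : N.Validator) (k : ℕ),
      ρ.Issues i A (.uara A sn b sig) → S.gst ≤ (ρ.st i).now →
      ρ.PromptLeader j L b.receiver k (.uara A sn b sig) →
      ρ.GoodPool j L b.receiver → ρ.AfterGST b.receiver k →
      ρ.ExecutedBy (.uara A sn b sig) ((ρ.st i).now + 3 * S.δ)) ∧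
    -- RA-RA transactions
    (∀ (i : ℕ) (X : N.Reactive) (b : Mangrove.CallBody N) (j : ℕ) (L : N.Validator) (k : ℕ),
      ρ.Emits i L X (.rara X b) → S.gst ≤ (ρ.st i).now →
      ρ.PromptLeader j L b.receiver k (.rara X b) →
      ρ.GoodPool j L b.receiver → ρ.AfterGST b.receiver k →
      ρ.ExecutedBy (.rara X b) ((ρ.st i).now + 2 * S.δ)) :=
  ⟨fun _ _ _ _ _ _ h hg => ρ.executedBy_ua hp h hg,
    fun _ _ _ _ _ _ _ _ h hg hl hgood hafter => ρ.executedBy_uara hp h hg hl hgood hafter,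
    fun _ _ _ _ _ _ h _ hl hgood hafter => ρ.executedBy_rara hp h hl hgood hafter⟩
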